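/- (Weighted endpoint Strichartz.) There is an absolute constant $C$ such that the following holds. Let $I\subset\mathbb{R}$ be an interval, let $t_0\in I$, and let $u_0\in L^2_x(\mathbb{R}^2)$ and $f\in L^{4/3}_{t,x}(I\times\mathbb{R}^2)$ be spherically symmetric (in $x$). Let $e^{it\Delta}$ be the free Schrödinger propagator, that is, the Fourier multiplier with symbol $e^{-it|\xi|^2}$ (for $\hat g(\xi)=(2\pi)^{-1}\int_{\mathbb{R}^2}e^{-ix\cdot\xi}g(x)\,dx$), acting on tempered distributions. Then for every $t\in I$ the formula $$u(t) := e^{i(t-t_0)\Delta}u_0 - i\int_{t_0}^t e^{i(t-t')\Delta}f(t')\,dt'$$ defines an element $u(t)\in L^2_x(\mathbb{R}^2)$, where the integral is understood weakly (it converges absolutely after pairing with any Schwartz function), and $$\bigl\||x|^{1/2}u\bigr\|_{L^4_tL^\infty_x(I\times\mathbb{R}^2)} \le C\Bigl(\|u_0\|_{L^2_x(\mathbb{R}^2)}+\|f\|_{L^{4/3}_{t,x}(I\times\mathbb{R}^2)}\Bigr),$$ where $\|v\|_{L^4_tL^\infty_x(I\times\mathbb{R}^2)}=\bigl(\int_I\|v(t)\|_{L^\infty_x(\mathbb{R}^2)}^4\,dt\bigr)^{1/4}$,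 the integrand being measurable in $t$. -/

import Mathlib

open MeasureTheory TemperedDistribution
open scoped ENNReal NNReal SchwartzMap

noncomputable section

namespace WeightedStrichartz

/-- The Euclidean plane `ℝ²`. -/
abbrev Plane : Type := EuclideanSpace ℝ (Fin 2)

instance one_le_four_thirds : Fact ((1 : ℝ≥0∞) ≤ 4 / 3) :=
  ⟨by
    rw [ENNReal.le_div_iff_mul_le (by simp) (by simp)]
    norm_num⟩

/-- The symbol of `e^{itΔ}`. Mathlib's Fourier transform has the kernel `e^{-2πi⟨x,ξ⟩}`, so `Δ` is
the multiplier `-(2π)²|ξ|²` and `e^{itΔ}` is the multiplier `e^{-it(2π|ξ|)²}`. -/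
def schrodingerSymbol (t : ℝ) (ξ : Plane) : ℂ :=
  Complex.exp (-(Complex.I * ((t * (2 * Real.pi * ‖ξ‖) ^ 2 : ℝ) : ℂ)))

/-- The symbol is smooth of temperate growth, so that the Fourier multiplier below is the
genuine one (Mathlib gives it the value `0` for other symbols). -/
theorem schrodingerSymbol_hasTemperateGrowth (t : ℝ) :
    (schrodingerSymbol t).HasTemperateGrowth := by
  have key : (fun s : ℝ => Complex.exp (-(Complex.I * (s : ℂ)))).HasTemperateGrowth := by
    have hd : ∀ n : ℕ, iteratedDeriv n (fun s : ℝ => Complex.exp (-(Complex.I * (s : ℂ)))) =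
        fun s : ℝ => (-Complex.I) ^ n * Complex.exp (-(Complex.I * (s : ℂ))) := by
      intro n
      induction n with
      | zero => simp
      | succ n ih =>
        rw [iteratedDeriv_succ, ih]
        funext s
        have h1 : HasDerivAt (fun s : ℝ => -(Complex.I * (s : ℂ))) (-(Complex.I * 1)) s :=
          ((Complex.ofRealCLM.hasDerivAt (x := s)).const_mul Complex.I).neg
        have h2 := (h1.cexp).const_mul ((-Complex.I) ^ n)
        rw [h2.deriv]
        ring
    refine ⟨?_, fun n => ⟨0, 1, fun s => ?_⟩⟩
    · exact ContDiff.cexp (contDiff_const.mul Complex.ofRealCLM.contDiff).neg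
    · rw [norm_iteratedFDeriv_eq_norm_iteratedDeriv, hd n]
      simp [Complex.norm_exp]
  have hq : (fun ξ : Plane => t * (2 * Real.pi * ‖ξ‖) ^ 2).HasTemperateGrowth := by
    have : (fun ξ : Plane => t * (2 * Real.pi * ‖ξ‖) ^ 2) =
        fun ξ : Plane => (t * (2 * Real.pi) ^ 2) * ‖ξ‖ ^ 2 := by
      funext ξ
      ring
    rw [this]
    fun_prop
  exact key.comp hq

/-- The free Schrödinger propagator `e^{itΔ}`, acting on tempered distributions (in particular on
all `L^p` functions) as the Fourier multiplier with symbol `e^{-it|ξ|²}` (frequencies in the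
normalization `∫ e^{-i⟨x,ξ⟩} f(x) dx`). -/
def propagator (t : ℝ) : 𝓢'(Plane, ℂ) →L[ℂ] 𝓢'(Plane, ℂ) :=
  fourierMultiplierCLM ℂ (schrodingerSymbol t)

open Classical in
/-- A function `g ∈ L^{4/3}(ℝ²)` as the tempered distribution `φ ↦ ∫ φ g`. The value for other `g`
plays no role: almost every time slice of a function in `L^{4/3}_{t,x}` is in `L^{4/3}_x`. -/
def sliceDistribution (g : Plane → ℂ) : 𝓢'(Plane, ℂ) :=
  if hg : MemLp g (4 / 3) volume then Lp.toTemperedDistribution (hg.toLp g) else 0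

/-- Spherical symmetry of a function on the plane that is defined up to null sets. -/
def IsRadial (g : Plane → ℂ) : Prop :=
  ∃ h : ℝ → ℂ, g =ᵐ[volume] fun x => h ‖x‖

/-- `u(t) = e^{i(t-t₀)Δ} u₀ - i ∫_{t₀}^t e^{i(t-s)Δ} f(s) ds` for all `t ∈ I`, where `u(t) ∈ L²` and
the time integral is a weak one: it converges absolutely when tested against any Schwartz
function. -/
def IsDuhamel (I : Set ℝ) (t₀ : ℝ) (u₀ : Lp ℂ 2 (volume : Measure Plane))
    (f : ℝ → Plane → ℂ) (u : ℝ → Lp ℂ 2 (volume : Measure Plane)) : Prop :=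
  ∀ t ∈ I, ∀ φ : 𝓢(Plane, ℂ),
    IntervalIntegrable (fun s => propagator (t - s) (sliceDistribution (f s)) φ) volume t₀ t ∧
    Lp.toTemperedDistribution (u t) φ =
      propagator (t - t₀) (Lp.toTemperedDistribution u₀) φ -
        Complex.I * ∫ s in t₀..t, propagator (t - s) (sliceDistribution (f s)) φ

/-- The mixed norm `‖u‖_{L^q_t L^r_x(I × ℝ²)}`. -/
def mixedNorm (q r : ℝ≥0∞) (I : Set ℝ) (u : ℝ → Plane → ℂ) : ℝ≥0∞ :=
  eLpNorm (fun t => eLpNorm (u t) r volume) q (volume.restrict I)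

/-- The function `|x|^{1/2} u(t, x)`. -/
def weighted (u : ℝ → Lp ℂ 2 (volume : Measure Plane)) (t : ℝ) (x : Plane) : ℂ :=
  ((‖x‖ ^ (1 / 2 : ℝ) : ℝ) : ℂ) * u t x

end WeightedStrichartz

end

noncomputable section

namespace WeightedStrichartz

open FourierTransform

/-! Undoing the free flow, the solution is u(t) = e^{itΔ}(h - iD(t)) with h = e^{-it₀Δ}u₀ and D(t) =
∫_{t₀}^t e^{-isΔ} f(s) ds. A homogeneous estimate handles the fixed vector h. A chaining argument
then extends it to the moving vector D(t).

Homogeneous part. The kernel of e^{itΔ} on the plane has size 1/(4π|t|). Averaged over rotations it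
acquires a Bessel factor that decays like (|x||y|/|t|)^{-1/2}. With the weight |x|^{1/2} on both
sides, what remains is |t|^{-1/2}, uniformly in space
(`norm_integral_gaussianKernel_radialMean_le`). For a rotation invariant function the weighted sup
norm is a countable supremum of inner products with radially averaged, weighted indicators of small
balls (`eLpNorm_top_sqrt_norm_mul_eq`). The TT* method with the maximising index chosen measurably
in t, together with fractional integration of order 1/2 from L^{4/3} to L⁴ in time, gives the
estimate for a fixed vector (`lintegral_iSup_inner_pow_four_le`).

Inhomogeneous part. The unweighted L⁴ Strichartz estimate, proved by squaring the wave and using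
Schur's test (`lintegral_freeWave_pow_four_le`), shows by duality that D takes values in L² and that
‖D(t) - D(s)‖ ≤ 2|F(t) - F(s)|^{3/4}, where F is the accumulated mass of |f|^{4/3}
(`exists_forcing`). Cutting the range of F into 16^k cells and replacing D by a constant on each
cell costs a factor 16^{k/4} in L⁴, while successive approximations differ by a multiple of
16^{-3k/4}. The levels therefore sum geometrically (`eLpNorm_iSup_inner_path_le`). This is the
Christ–Kiselev mechanism, and it takes care of the retarded integral. -/

/-! ### Fractional integration of order 1/2 on the line -/

theorem lintegral_comp_abs_eq (g : ℝ → ℝ≥0∞) :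
    ∫⁻ τ : ℝ, g |τ| = 2 * ∫⁻ τ in Set.Ioi 0, g τ := by
  have h1 : ∫⁻ τ in Set.Ioi (0 : ℝ), g |τ| = ∫⁻ τ in Set.Ioi 0, g τ :=
    setLIntegral_congr_fun measurableSet_Ioi fun τ hτ => by
      rw [abs_of_pos hτ]
  have h2 : ∫⁻ τ in Set.Iic (0 : ℝ), g |τ| = ∫⁻ τ in Set.Ioi 0, g τ := by
    rw [← h1, ← setLIntegral_congr (Iio_ae_eq_Iic (a := (0 : ℝ))),
      ← (Measure.measurePreserving_neg (volume : Measure ℝ)).setLIntegral_comp_preimage_emb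
        (MeasurableEquiv.neg ℝ).measurableEmbedding]
    simp
  rw [← lintegral_add_compl _ (measurableSet_Ioi (a := (0 : ℝ))), Set.compl_Ioi, h1, h2, two_mul]

/-- The kernel `|τ|^{-1/2}` of one-dimensional fractional integration of order one half. -/
def rieszKernel (τ : ℝ) : ℝ≥0∞ := ENNReal.ofReal (|τ| ^ (-(1 / 2) : ℝ))

theorem measurable_rieszKernel : Measurable rieszKernel := by
  unfold rieszKernel; fun_prop

theorem rieszKernel_neg (τ : ℝ) : rieszKernel (-τ) = rieszKernel τ := by
  simp [rieszKernel]

theorem lintegral_rieszKernel_ball {R : ℝ} (hR : 0 < R) :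
    ∫⁻ τ in {τ | |τ| < R}, rieszKernel τ = ENNReal.ofReal (4 * R ^ (1 / 2 : ℝ)) := by
  have hm : MeasurableSet {τ : ℝ | |τ| < R} := measurableSet_lt (by fun_prop) (by fun_prop)
  have h1 : ∫⁻ τ in {τ | |τ| < R}, rieszKernel τ =
      ∫⁻ τ, (Set.Iio R).indicator (fun τ => ENNReal.ofReal (τ ^ (-(1 / 2) : ℝ))) |τ| := by
    rw [← lintegral_indicator hm]
    congr 1
  rw [h1, lintegral_comp_abs_eq, lintegral_indicator measurableSet_Iio,
    Measure.restrict_restrict measurableSet_Iio, Set.Iio_inter_Ioi,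
    setLIntegral_congr Ioo_ae_eq_Ioc,
    ← ofReal_integral_eq_lintegral_ofReal, ← intervalIntegral.integral_of_le hR.le,
    integral_rpow (Or.inl (by norm_num))]
  · rw [← ENNReal.ofReal_ofNat, ← ENNReal.ofReal_mul (by norm_num),
      show (-(1 / 2) + 1 : ℝ) = 1 / 2 by norm_num, Real.zero_rpow (by norm_num)]
    congr 1
    ring
  · exact (intervalIntegrable_iff_integrableOn_Ioc_of_le hR.le).1
      (intervalIntegral.intervalIntegrable_rpow' (by norm_num))
  · filter_upwards [ae_restrict_mem measurableSet_Ioc] with τ hτ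
    exact Real.rpow_nonneg hτ.1.le _

theorem lintegral_rieszKernel_pow_four_compl_ball {R : ℝ} (hR : 0 < R) :
    ∫⁻ τ in {τ | |τ| < R}ᶜ, rieszKernel τ ^ (4 : ℝ) = ENNReal.ofReal (2 / R) := by
  have hm : MeasurableSet {τ : ℝ | |τ| < R} := measurableSet_lt (by fun_prop) (by fun_prop)
  have h1 : ∫⁻ τ in {τ | |τ| < R}ᶜ, rieszKernel τ ^ (4 : ℝ) =
      ∫⁻ τ, (Set.Iio R)ᶜ.indicator (fun τ => ENNReal.ofReal (τ ^ (-2 : ℝ))) |τ| := by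
    rw [← lintegral_indicator hm.compl]
    congr 1
    ext τ
    by_cases h : |τ| < R
    · rw [Set.indicator_of_notMem (by simpa using h), Set.indicator_of_notMem (by simpa using h)]
    · rw [Set.indicator_of_mem (by simpa using h), Set.indicator_of_mem (by simpa using h),
        rieszKernel, ENNReal.ofReal_rpow_of_nonneg (by positivity) (by norm_num),
        ← Real.rpow_mul (abs_nonneg _)]
      norm_num
  rw [h1, lintegral_comp_abs_eq, lintegral_indicator measurableSet_Iio.compl,
    Measure.restrict_restrict measurableSet_Iio.compl, Set.compl_Iio,
    Set.inter_eq_left.2 (show Set.Ici R ⊆ Set.Ioi 0 from fun x hx => hR.trans_le hx),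
    ← setLIntegral_congr Ioi_ae_eq_Ici, ← ofReal_integral_eq_lintegral_ofReal,
    integral_Ioi_rpow_of_lt (by norm_num) hR]
  · rw [← ENNReal.ofReal_ofNat, ← ENNReal.ofReal_mul (by norm_num)]
    norm_num [Real.rpow_neg_one, div_eq_mul_inv]
  · exact integrableOn_Ioi_rpow_of_lt (by norm_num) hR
  · filter_upwards [ae_restrict_mem measurableSet_Ioi] with τ hτ
    exact Real.rpow_nonneg (hR.trans hτ).le _

/-- The kernel is split at distance R. Near the singularity it is integrable and the minimum is
bounded by the height a. Far away its fourth power is integrable, so Hölder with exponents 4 and 4/3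
applies to w. -/
theorem lintegral_rieszKernel_mul_min_le_add {w : ℝ → ℝ≥0∞} (hw : Measurable w) (a : ℝ≥0∞) (t : ℝ)
    {R : ℝ} (hR : 0 < R) :
    ∫⁻ s, rieszKernel (t - s) * min (w s) a ≤
      ENNReal.ofReal (4 * R ^ (1 / 2 : ℝ)) * a +
        ENNReal.ofReal (2 / R) ^ (1 / 4 : ℝ) * (∫⁻ s, w s ^ (4 / 3 : ℝ)) ^ (3 / 4 : ℝ) := by
  have hm : MeasurableSet {τ : ℝ | |τ| < R} := measurableSet_lt (by fun_prop) (by fun_prop)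
  have hk := measurable_rieszKernel
  rw [← lintegral_sub_left_eq_self _ t]
  simp only [sub_sub_cancel]
  rw [← lintegral_add_compl _ hm]
  gcongr
  · calc _ ≤ ∫⁻ τ in {τ | |τ| < R}, rieszKernel τ * a := by
          gcongr; exact min_le_right _ _
      _ = _ := by rw [lintegral_mul_const _ hk, lintegral_rieszKernel_ball hR]
  · calc _ ≤ ∫⁻ τ in {τ | |τ| < R}ᶜ, (rieszKernel * fun τ => w (t - τ)) τ := by
          simp only [Pi.mul_apply]
          gcongr; exact min_le_left _ _
      _ ≤ (∫⁻ τ in {τ | |τ| < R}ᶜ, rieszKernel τ ^ (4 : ℝ)) ^ (1 / 4 : ℝ) *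
          (∫⁻ τ in {τ | |τ| < R}ᶜ, w (t - τ) ^ (4 / 3 : ℝ)) ^ (1 / (4 / 3) : ℝ) :=
        ENNReal.lintegral_mul_le_Lp_mul_Lq _ ⟨by norm_num, by norm_num, by norm_num⟩
          hk.aemeasurable (hw.comp (by fun_prop)).aemeasurable
      _ ≤ (∫⁻ τ in {τ | |τ| < R}ᶜ, rieszKernel τ ^ (4 : ℝ)) ^ (1 / 4 : ℝ) *
          (∫⁻ τ, w (t - τ) ^ (4 / 3 : ℝ)) ^ (1 / (4 / 3) : ℝ) := by
        gcongr
        exact Measure.restrict_le_self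
      _ = _ := by
        rw [lintegral_rieszKernel_pow_four_compl_ball hR,
          lintegral_sub_left_eq_self (fun s => w s ^ (4 / 3 : ℝ)) t]
        norm_num

/-- Truncated fractional integration at a single height. -/
theorem lintegral_rieszKernel_mul_min_le {w : ℝ → ℝ≥0∞} (hw : Measurable w)
    (hW : ∫⁻ s, w s ^ (4 / 3 : ℝ) ≠ ∞) {a : ℝ≥0∞} (ha : a ≠ ∞) (t : ℝ) :
    ∫⁻ s, rieszKernel (t - s) * min (w s) a ≤
      6 * (∫⁻ s, w s ^ (4 / 3 : ℝ)) ^ (1 / 2 : ℝ) * a ^ (1 / 3 : ℝ) := by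
  rcases eq_or_ne a 0 with rfl | ha0
  · simp
  rcases eq_or_ne (∫⁻ s, w s ^ (4 / 3 : ℝ)) 0 with h0 | h0
  · have hw0 : ∀ᵐ s, w s = 0 := by
      filter_upwards [(lintegral_eq_zero_iff (by fun_prop)).1 h0] with s hs
      exact (ENNReal.rpow_eq_zero_iff_of_pos (by norm_num)).1 hs
    have : ∫⁻ s, rieszKernel (t - s) * min (w s) a = 0 := by
      rw [lintegral_eq_zero_iff]
      · filter_upwards [hw0] with s hs
        simp [hs]
      · exact (measurable_rieszKernel.comp (by fun_prop)).mul (hw.min measurable_const)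
    rw [this]
    exact zero_le
  obtain ⟨W', hW'⟩ := WithTop.ne_top_iff_exists.1 hW
  change (W' : ℝ≥0∞) = _ at hW'
  lift a to ℝ≥0 using ha
  have hW0 : 0 < W' := pos_iff_ne_zero.2 fun h => h0 (by rw [← hW', h, ENNReal.coe_zero])
  have ha0 : 0 < a := pos_iff_ne_zero.2 (by simpa using ha0)
  -- This radius balances the near and far contributions: both become multiples of W^{1/2} a^{1/3},
  -- with constants 4 and 2.
  set R : ℝ≥0 := W' * a ^ (-(4 / 3) : ℝ) with hRdef
  have hR : 0 < R := by positivity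
  refine (lintegral_rieszKernel_mul_min_le_add hw a t (R := R) (by exact_mod_cast hR)).trans ?_
  have h1 : ENNReal.ofReal (4 * (R : ℝ) ^ (1 / 2 : ℝ)) =
      ((4 * (W' ^ (1 / 2 : ℝ) * a ^ (-(2 / 3) : ℝ)) : ℝ≥0) : ℝ≥0∞) := by
    rw [← ENNReal.ofReal_coe_nnreal]
    congr 1
    push_cast
    rw [hRdef]
    push_cast
    rw [Real.mul_rpow (by positivity) (by positivity), ← Real.rpow_mul (by positivity)]
    norm_num
  have h2 : ENNReal.ofReal (2 / (R : ℝ)) ^ (1 / 4 : ℝ) ≤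
      ((2 * (W' ^ (-(1 / 4) : ℝ) * a ^ (1 / 3 : ℝ)) : ℝ≥0) : ℝ≥0∞) := by
    rw [ENNReal.ofReal_rpow_of_nonneg (by positivity) (by norm_num), ← ENNReal.ofReal_coe_nnreal]
    apply ENNReal.ofReal_le_ofReal
    push_cast
    rw [hRdef]
    push_cast
    rw [div_eq_mul_inv, Real.mul_rpow (by positivity) (by positivity), mul_inv,
      Real.mul_rpow (by positivity) (by positivity), ← Real.rpow_neg (by positivity),
      Real.inv_rpow (by positivity), ← Real.rpow_neg (by positivity),
      ← Real.rpow_mul (by positivity)]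
    norm_num
    gcongr
    exact Real.rpow_le_self_of_one_le (by norm_num) (by norm_num)
  rw [h1, ← hW']
  refine (add_le_add_right (mul_le_mul_left h2 _) _).trans ?_
  rw [← ENNReal.coe_rpow_of_nonneg _ (by norm_num), ← ENNReal.coe_rpow_of_nonneg _ (by norm_num),
    ← ENNReal.coe_rpow_of_nonneg _ (by norm_num)]
  norm_cast
  have h3 : a ^ (-(2 / 3) : ℝ) * a = a ^ (1 / 3 : ℝ) := by
    nth_rw 2 [← NNReal.rpow_one a]
    rw [← NNReal.rpow_add ha0.ne']
    norm_num
  have h4 : W' ^ (-(1 / 4) : ℝ) * W' ^ (3 / 4 : ℝ) = W' ^ (1 / 2 : ℝ) := by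
    rw [← NNReal.rpow_add hW0.ne']
    norm_num
  apply le_of_eq
  calc _ = 4 * W' ^ (1 / 2 : ℝ) * (a ^ (-(2 / 3) : ℝ) * a) +
        2 * (W' ^ (-(1 / 4) : ℝ) * W' ^ (3 / 4 : ℝ)) * a ^ (1 / 3 : ℝ) := by ring
    _ = _ := by rw [h3, h4]; ring

/-- The diagonal case of the one-dimensional Hardy–Littlewood–Sobolev inequality of order `1/2`. -/
theorem lintegral_lintegral_rieszKernel_le {w : ℝ → ℝ≥0∞} (hw : Measurable w)
    (hw' : ∀ t, w t ≠ ∞) (hW : ∫⁻ s, w s ^ (4 / 3 : ℝ) ≠ ∞) :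
    ∫⁻ t, ∫⁻ s, w t * w s * rieszKernel (t - s) ≤
      12 * (∫⁻ s, w s ^ (4 / 3 : ℝ)) ^ (3 / 2 : ℝ) := by
  have hk := measurable_rieszKernel
  have key : ∫⁻ t, ∫⁻ s, w t * (rieszKernel (t - s) * min (w s) (w t)) ≤
      6 * (∫⁻ s, w s ^ (4 / 3 : ℝ)) ^ (3 / 2 : ℝ) := by
    calc _ ≤ ∫⁻ t, 6 * (∫⁻ s, w s ^ (4 / 3 : ℝ)) ^ (1 / 2 : ℝ) * w t ^ (4 / 3 : ℝ) := by
          refine lintegral_mono fun t => ?_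
          rw [lintegral_const_mul _ (show Measurable fun s => rieszKernel (t - s) * min (w s) (w t)
            from (hk.comp (by fun_prop)).mul (hw.min measurable_const))]
          refine (mul_le_mul_right (lintegral_rieszKernel_mul_min_le hw hW (hw' t) t) _).trans ?_
          rw [show (4 / 3 : ℝ) = 1 + 1 / 3 by norm_num,
            ENNReal.rpow_add_of_nonneg _ _ zero_le_one (by norm_num), ENNReal.rpow_one]
          apply le_of_eq; ring
      _ = _ := by
        rw [lintegral_const_mul _ (by fun_prop), mul_assoc, show (3 / 2 : ℝ) = 1 / 2 + 1 by norm_num,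
          ENNReal.rpow_add_of_nonneg _ _ (by norm_num) zero_le_one, ENNReal.rpow_one]
  have hm : Measurable (Function.uncurry fun t s => w t * (rieszKernel (t - s) * min (w s) (w t))) :=
    (hw.comp measurable_fst).mul ((hk.comp (measurable_fst.sub measurable_snd)).mul
      ((hw.comp measurable_snd).min (hw.comp measurable_fst)))
  -- A product is its larger factor times its smaller one. This truncates w at the height of the
  -- other point, where the single-height bound applies, and the two orderings are exchanged by
  -- symmetry.
  calc _ ≤ ∫⁻ t, ∫⁻ s, (w t * (rieszKernel (t - s) * min (w s) (w t)) +
          w s * (rieszKernel (s - t) * min (w t) (w s))) := by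
        refine lintegral_mono fun t => lintegral_mono fun s => ?_
        rw [show s - t = -(t - s) by ring, rieszKernel_neg]
        rcases le_total (w s) (w t) with h | h
        · rw [min_eq_left h]
          refine le_trans (le_of_eq ?_) le_self_add
          ring
        · rw [min_eq_left h]
          refine le_trans (le_of_eq ?_) le_add_self
          ring
    _ = (∫⁻ t, ∫⁻ s, w t * (rieszKernel (t - s) * min (w s) (w t))) +
        ∫⁻ t, ∫⁻ s, w s * (rieszKernel (s - t) * min (w t) (w s)) := by
      rw [← lintegral_add_left hm.lintegral_prod_right]
      refine lintegral_congr fun t => ?_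
      exact lintegral_add_left (hm.comp measurable_prodMk_left) _
    _ ≤ 6 * (∫⁻ s, w s ^ (4 / 3 : ℝ)) ^ (3 / 2 : ℝ) + 6 * (∫⁻ s, w s ^ (4 / 3 : ℝ)) ^ (3 / 2 : ℝ) := by
      refine add_le_add key (le_trans (le_of_eq ?_) key)
      exact lintegral_lintegral_swap (hm.comp measurable_swap).aemeasurable
    _ = _ := by ring

/-! ### The TT* argument for a maximal function -/

section

section Hilbert

variable {H : Type*} [NormedAddCommGroup H] [InnerProductSpace ℂ H] [CompleteSpace H]

/-- The squared norm is expanded into a double integral of inner products, which the diagonal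
fractional integration inequality controls. -/
theorem enorm_integral_sq_le {G : ℝ → H} (hG : Integrable G) {w : ℝ → ℝ≥0∞} (hw : Measurable w)
    (hw' : ∀ t, w t ≠ ∞) (hW : ∫⁻ s, w s ^ (4 / 3 : ℝ) ≠ ∞) {C : ℝ≥0∞}
    (hC : ∀ t s, t ≠ s → ‖inner ℂ (G t) (G s)‖ₑ ≤ C * (w t * w s * rieszKernel (t - s))) :
    ‖∫ t, G t‖ₑ ^ 2 ≤ C * (12 * (∫⁻ s, w s ^ (4 / 3 : ℝ)) ^ (3 / 2 : ℝ)) := by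
  have h1 : ∀ t, inner ℂ (G t) (∫ s, G s) = ∫ s, inner ℂ (G t) (G s) := fun t =>
    (integral_inner hG (G t)).symm
  have h2 : ‖∫ t, G t‖ₑ ^ 2 = ‖∫ t, inner ℂ (∫ s, G s) (G t)‖ₑ := by
    rw [integral_inner hG, inner_self_eq_norm_sq_to_K, ← ofReal_norm,
      ← ofReal_norm, ← ENNReal.ofReal_pow (norm_nonneg _)]
    simp
  have hm : Measurable (Function.uncurry fun t s => w t * w s * rieszKernel (t - s)) :=
    ((hw.comp measurable_fst).mul (hw.comp measurable_snd)).mul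
      (measurable_rieszKernel.comp (measurable_fst.sub measurable_snd))
  calc ‖∫ t, G t‖ₑ ^ 2 ≤ ∫⁻ t, ‖inner ℂ (∫ s, G s) (G t)‖ₑ := by
        rw [h2]; exact enorm_integral_le_lintegral_enorm _
    _ ≤ ∫⁻ t, ∫⁻ s, ‖inner ℂ (G t) (G s)‖ₑ := by
        refine lintegral_mono fun t => ?_
        rw [← inner_conj_symm, h1 t]
        refine le_trans (le_of_eq ?_) (enorm_integral_le_lintegral_enorm _)
        rw [← ofReal_norm, ← ofReal_norm, RCLike.norm_conj]
    _ ≤ ∫⁻ t, ∫⁻ s, C * (w t * w s * rieszKernel (t - s)) := by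
        refine lintegral_mono fun t => lintegral_mono_ae ?_
        -- `rieszKernel 0` is 0, by the convention for real powers at 0, so the kernel bound can
        -- only be asked off the diagonal, which is a null set for each t.
        filter_upwards [(measure_singleton (μ := (volume : Measure ℝ)) t : volume {t} = 0) |>
          measure_eq_zero_iff_ae_notMem.1] with s hs
        exact hC t s fun h => hs h.symm
    _ = C * ∫⁻ t, ∫⁻ s, w t * w s * rieszKernel (t - s) := by
        rw [← lintegral_const_mul _ hm.lintegral_prod_right]
        exact lintegral_congr fun t => lintegral_const_mul _ (hm.comp measurable_prodMk_left)
    _ ≤ _ := by gcongr; exact lintegral_lintegral_rieszKernel_le hw hw' hW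

/-- The maximum is linearised by a measurable choice of the maximising index. With X the integral to
be bounded, duality gives X ≤ ‖h‖‖∫G‖ and TT* gives ‖∫G‖² ≤ 12 C X^{3/2}, and X^{3/2} is then
cancelled. Restricting to finitely many functionals and a bounded time interval makes X finite, as
the cancellation requires. -/
theorem lintegral_sup_inner_pow_four_le (T : ℕ → ℝ → H) (hT : ∀ n, Continuous (T n)) {C : ℝ≥0∞}
    (hC : ∀ m n t s, t ≠ s → ‖inner ℂ (T m t) (T n s)‖ₑ ≤ C * rieszKernel (t - s)) (h : H)
    (N : ℕ) (hN : 0 < N) (R : ℝ) :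
    ∫⁻ t in Set.Icc (-R) R,
      (((Finset.range N).sup fun n => ‖inner ℂ (T n t) h‖₊ : ℝ≥0) : ℝ≥0∞) ^ 4 ≤
      (12 * C) ^ 2 * ‖h‖ₑ ^ 4 := by
  classical
  set A : ℝ → ℝ≥0 := fun t => (Finset.range N).sup fun n => ‖inner ℂ (T n t) h‖₊ with hA
  have hAc : Continuous A := by
    refine Continuous.finset_sup_apply fun n _ => ?_
    exact ((hT n).inner continuous_const).nnnorm
  have hex : ∀ t, ∃ n, n < N ∧ ‖inner ℂ (T n t) h‖₊ = A t := fun t => by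
    obtain ⟨n, hn, h'⟩ := Finset.exists_mem_eq_sup (Finset.range N)
      (Finset.nonempty_range_iff.2 hN.ne') fun n => ‖inner ℂ (T n t) h‖₊
    exact ⟨n, Finset.mem_range.1 hn, h'.symm⟩
  -- Taking the least maximiser makes the choice measurable in t.
  set ν : ℝ → ℕ := fun t => Nat.find (hex t) with hν
  have hνm : Measurable ν := by
    refine measurable_find hex fun k => ?_
    by_cases hk : k < N
    · simp only [hk, true_and]
      exact (isClosed_eq ((hT k).inner continuous_const).nnnorm hAc).measurableSet
    · simp [hk]
  have hνs : ∀ t, ‖inner ℂ (T (ν t) t) h‖₊ = A t := fun t => (Nat.find_spec (hex t)).2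
  have hνN : ∀ t, ν t < N := fun t => (Nat.find_spec (hex t)).1
  have hS : StronglyMeasurable fun t => T (ν t) t := by
    have : Continuous (Function.uncurry T) := continuous_prod_of_discrete_left.2 hT
    exact this.stronglyMeasurable.comp_measurable (hνm.prodMk measurable_id)
  -- The scalar is the dual function of the L⁴ norm. It has modulus A³, so its 4/3 power is A⁴, and
  -- the pairing of h with G is exactly A⁴.
  set G : ℝ → H := (Set.Icc (-R) R).indicator fun t =>
    (((A t : ℝ) : ℂ) ^ 2 * inner ℂ (T (ν t) t) h) • T (ν t) t with hG
  have hGm : StronglyMeasurable G := by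
    refine StronglyMeasurable.indicator ?_ measurableSet_Icc
    refine StronglyMeasurable.smul ?_ hS
    exact (by fun_prop : Continuous fun t => ((A t : ℝ) : ℂ) ^ 2).stronglyMeasurable.mul
      (hS.inner stronglyMeasurable_const)
  obtain ⟨B, hB⟩ : ∃ B : ℝ, ∀ t ∈ Set.Icc (-R) R, (A t : ℝ) ≤ B := by
    obtain ⟨B, hB⟩ := (isCompact_Icc (a := -R) (b := R)).bddAbove_image
      (f := fun t => (A t : ℝ)) (by fun_prop)
    exact ⟨B, fun t ht => hB ⟨t, ht, rfl⟩⟩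
  obtain ⟨K, hK⟩ : ∃ K : ℝ, ∀ n < N, ∀ t ∈ Set.Icc (-R) R, ‖T n t‖ ≤ K := by
    have : ∀ n, ∃ K : ℝ, ∀ t ∈ Set.Icc (-R) R, ‖T n t‖ ≤ K := fun n => by
      obtain ⟨B, hB⟩ := (isCompact_Icc (a := -R) (b := R)).bddAbove_image
        (f := fun t => ‖T n t‖) ((hT n).norm.continuousOn)
      exact ⟨B, fun t ht => hB ⟨t, ht, rfl⟩⟩
    choose K hK using this
    refine ⟨∑ n ∈ Finset.range N, |K n|, fun n hn t ht => (hK n t ht).trans ?_⟩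
    exact (le_abs_self _).trans
      (Finset.single_le_sum (f := fun n => |K n|) (fun _ _ => abs_nonneg _) (Finset.mem_range.2 hn))
  have hc : ∀ t, ‖((A t : ℝ) : ℂ) ^ 2 * inner ℂ (T (ν t) t) h‖ = (A t : ℝ) ^ 3 := fun t => by
    rw [norm_mul, norm_pow, Complex.norm_real, NNReal.norm_eq, ← coe_nnnorm, hνs t]
    ring
  have hGi : Integrable G := by
    have hGs : G = (Set.Icc (-R) R).indicator G := by
      rw [hG, Set.indicator_indicator, Set.inter_self]
    rw [hGs, integrable_indicator_iff measurableSet_Icc]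
    refine Measure.integrableOn_of_bounded (M := B ^ 3 * K) (by simp)
      hGm.aestronglyMeasurable ?_
    filter_upwards [ae_restrict_mem measurableSet_Icc] with t ht
    rw [hG, Set.indicator_of_mem ht, norm_smul, hc]
    have h1 := hB t ht
    have h2 := hK _ (hνN t) t ht
    have h3 : 0 ≤ B := (A t).2.trans h1
    gcongr
  set w : ℝ → ℝ≥0∞ := (Set.Icc (-R) R).indicator fun t => (A t : ℝ≥0∞) ^ 3 with hw
  have hwm : Measurable w :=
    Measurable.indicator (by fun_prop) measurableSet_Icc
  set X := ∫⁻ t in Set.Icc (-R) R, (A t : ℝ≥0∞) ^ 4 with hX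
  have hwX : ∫⁻ s, w s ^ (4 / 3 : ℝ) = X := by
    rw [hX, ← lintegral_indicator measurableSet_Icc]
    refine lintegral_congr fun t => ?_
    by_cases ht : t ∈ Set.Icc (-R) R
    · rw [hw, Set.indicator_of_mem ht, Set.indicator_of_mem ht, ← ENNReal.rpow_natCast,
        ← ENNReal.rpow_natCast, ← ENNReal.rpow_mul]
      norm_num
    · rw [hw, Set.indicator_of_notMem ht, Set.indicator_of_notMem ht,
        ENNReal.zero_rpow_of_pos (by norm_num)]
  have hXtop : X ≠ ∞ := by
    refine ne_of_lt (lt_of_le_of_lt (setLIntegral_mono (g := fun _ => ENNReal.ofReal (B ^ 4))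
      measurable_const fun t ht => ?_) ?_)
    · rw [← ENNReal.ofReal_coe_nnreal, ← ENNReal.ofReal_pow (by positivity)]
      have := hB t ht
      gcongr
    · simp [ENNReal.mul_lt_top]
  have hGG : ∀ t s, t ≠ s →
      ‖inner ℂ (G t) (G s)‖ₑ ≤ C * (w t * w s * rieszKernel (t - s)) := fun t s hts => by
    by_cases ht : t ∈ Set.Icc (-R) R
    swap; · simp [hG, ht]
    by_cases hs : s ∈ Set.Icc (-R) R
    swap; · simp [hG, hs]
    have hce : ∀ t, ‖((A t : ℝ) : ℂ) ^ 2 * inner ℂ (T (ν t) t) h‖ₑ = (A t : ℝ≥0∞) ^ 3 := fun t => by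
      rw [← ofReal_norm, hc, ENNReal.ofReal_pow (by positivity), ENNReal.ofReal_coe_nnreal]
    simp only [hG, hw, Set.indicator_of_mem ht, Set.indicator_of_mem hs]
    rw [inner_smul_left, inner_smul_right, enorm_mul, enorm_mul, hce, RCLike.enorm_conj, hce]
    refine (mul_le_mul_right (mul_le_mul_right (hC _ _ _ _ hts) _) _).trans (le_of_eq ?_)
    ring
  have hI : ‖∫ t, G t‖ₑ ^ 2 ≤ C * (12 * X ^ (3 / 2 : ℝ)) := by
    rw [← hwX]
    refine enorm_integral_sq_le hGi hwm (fun t => ?_) (by rwa [hwX]) hGG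
    by_cases ht : t ∈ Set.Icc (-R) R <;> simp [hw, ht]
  have hXG : X ≤ ‖h‖ₑ * ‖∫ t, G t‖ₑ := by
    have h1 : X = ‖∫ t, inner ℂ h (G t)‖ₑ := by
      have h2 : ∀ t, inner ℂ h (G t) =
          (((Set.Icc (-R) R).indicator (fun t => (A t : ℝ) ^ 4) t : ℝ) : ℂ) := fun t => by
        by_cases ht : t ∈ Set.Icc (-R) R
        · simp only [hG, Set.indicator_of_mem ht]
          rw [inner_smul_right, mul_assoc, ← inner_conj_symm h, RCLike.mul_conj, ← coe_nnnorm, hνs t]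
          simp only [Complex.coe_algebraMap]
          push_cast
          ring
        · simp [hG, ht]
      simp_rw [h2]
      rw [integral_complex_ofReal, integral_indicator measurableSet_Icc, ← ofReal_norm,
        Complex.norm_real, Real.norm_of_nonneg (integral_nonneg fun t => by positivity),
        ofReal_integral_eq_lintegral_ofReal]
      · simp [hX, ENNReal.ofReal_pow]
      · exact (by fun_prop : Continuous fun t => (A t : ℝ) ^ 4).integrableOn_Icc
      · exact Filter.Eventually.of_forall fun t => by positivity
    rw [h1, integral_inner hGi]
    rw [← ofReal_norm, ← ofReal_norm, ← ofReal_norm,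
      ← ENNReal.ofReal_mul (norm_nonneg _)]
    exact ENNReal.ofReal_le_ofReal (norm_inner_le_norm _ _)
  rcases eq_or_ne X 0 with h0 | h0
  · rw [h0]; exact zero_le
  have h3 : X ^ (1 / 2 : ℝ) ≤ 12 * C * ‖h‖ₑ ^ 2 := by
    have h4 : X ^ (3 / 2 : ℝ) * X ^ (1 / 2 : ℝ) ≤ X ^ (3 / 2 : ℝ) * (12 * C * ‖h‖ₑ ^ 2) := by
      calc _ = X ^ 2 := by
            rw [← ENNReal.rpow_add _ _ h0 hXtop, ← ENNReal.rpow_natCast]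
            norm_num
        _ ≤ (‖h‖ₑ * ‖∫ t, G t‖ₑ) ^ 2 := by gcongr
        _ = ‖h‖ₑ ^ 2 * ‖∫ t, G t‖ₑ ^ 2 := by ring
        _ ≤ ‖h‖ₑ ^ 2 * (C * (12 * X ^ (3 / 2 : ℝ))) := by gcongr
        _ = _ := by ring
    refine (ENNReal.mul_le_mul_iff_right ?_ ?_).1 h4
    · simp [h0, hXtop]
    · exact ENNReal.rpow_ne_top_of_nonneg (by norm_num) hXtop
  calc X = (X ^ (1 / 2 : ℝ)) ^ 2 := by
        rw [← ENNReal.rpow_natCast, ← ENNReal.rpow_mul]; norm_num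
    _ ≤ (12 * C * ‖h‖ₑ ^ 2) ^ 2 := by gcongr
    _ = _ := by ring

/-- The `TT*` method with a kernel decaying like `|t - s|^{-1/2}`, for a maximal function over
countably many functionals. -/
theorem lintegral_iSup_inner_pow_four_le (T : ℕ → ℝ → H) (hT : ∀ n, Continuous (T n)) {C : ℝ≥0∞}
    (hC : ∀ m n t s, t ≠ s → ‖inner ℂ (T m t) (T n s)‖ₑ ≤ C * rieszKernel (t - s)) (h : H) :
    ∫⁻ t, (⨆ n, ‖inner ℂ (T n t) h‖ₑ) ^ 4 ≤ (12 * C) ^ 2 * ‖h‖ₑ ^ 4 := by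
  set a : ℕ → ℝ → ℝ≥0∞ := fun N => (Set.Icc (-(N : ℝ)) N).indicator fun t =>
      (((Finset.range (N + 1)).sup fun n => ‖inner ℂ (T n t) h‖₊ : ℝ≥0) : ℝ≥0∞) ^ 4 with ha
  have ham : ∀ N, Measurable (a N) := fun N => by
    refine Measurable.indicator (Measurable.pow_const (Measurable.coe_nnreal_ennreal ?_) _)
      measurableSet_Icc
    refine (Continuous.finset_sup_apply fun n _ => ?_).measurable
    exact ((hT n).inner continuous_const).nnnorm
  have hmono : Monotone a := by
    intro N N' hNN t
    simp only [ha]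
    by_cases ht : t ∈ Set.Icc (-(N : ℝ)) N
    · have hN : (N : ℝ) ≤ N' := by exact_mod_cast hNN
      have ht' : t ∈ Set.Icc (-(N' : ℝ)) N' := ⟨by linarith [ht.1], by linarith [ht.2]⟩
      rw [Set.indicator_of_mem ht, Set.indicator_of_mem ht']
      gcongr
    · rw [Set.indicator_of_notMem ht]
      exact zero_le
  have hle : ∀ t, (⨆ n, ‖inner ℂ (T n t) h‖ₑ) ^ 4 ≤ ⨆ N, a N t := fun t => by
    rw [ENNReal.iSup_pow]
    refine iSup_le fun n => ?_
    obtain ⟨M, hM⟩ := exists_nat_ge |t|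
    refine le_trans ?_ (le_iSup _ (max n M))
    have ht : t ∈ Set.Icc (-((max n M : ℕ) : ℝ)) (max n M : ℕ) := by
      rw [Set.mem_Icc, ← abs_le]
      exact hM.trans (by exact_mod_cast le_max_right n M)
    simp only [ha, Set.indicator_of_mem ht]
    rw [enorm_eq_nnnorm]
    gcongr
    exact Finset.le_sup (f := fun n => ‖inner ℂ (T n t) h‖₊) (by simp)
  calc _ ≤ ∫⁻ t, ⨆ N, a N t := lintegral_mono hle
    _ = ⨆ N, ∫⁻ t, a N t := lintegral_iSup ham hmono
    _ ≤ _ := iSup_le fun N => by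
      rw [ha]
      simp only
      rw [lintegral_indicator measurableSet_Icc]
      exact lintegral_sup_inner_pow_four_le T hT hC h _ (by omega) _

end Hilbert

end

/-! ### Chaining: from fixed vectors to paths -/

section

theorem eLpNorm_four_eq {α : Type*} [MeasurableSpace α] {μ : Measure α} (g : α → ℝ≥0∞) :
    eLpNorm g 4 μ = (∫⁻ t, g t ^ 4 ∂μ) ^ (1 / 4 : ℝ) := by
  rw [eLpNorm_eq_lintegral_rpow_enorm_toReal (by norm_num) (by norm_num)]
  norm_num

theorem eLpNorm_four_le_iff {α : Type*} [MeasurableSpace α] {μ : Measure α} (g : α → ℝ≥0∞)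
    (c : ℝ≥0∞) : eLpNorm g 4 μ ≤ c ↔ ∫⁻ t, g t ^ 4 ∂μ ≤ c ^ 4 := by
  rw [eLpNorm_four_eq, one_div, ENNReal.rpow_inv_le_iff (by norm_num), ← ENNReal.rpow_natCast]
  norm_num

theorem eLpNorm_finset_sum_le_of_le {α : Type*} [MeasurableSpace α] {μ : Measure α}
    (a : ℕ → α → ℝ≥0∞) (ha : ∀ k, Measurable (a k)) (c : ℕ → ℝ≥0∞)
    (hc : ∀ k, eLpNorm (a k) 4 μ ≤ c k) (K : ℕ) :
    eLpNorm (fun t => ∑ k ∈ Finset.range K, a k t) 4 μ ≤ ∑ k ∈ Finset.range K, c k := by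
  induction K with
  | zero => simp
  | succ K ih =>
    simp only [Finset.sum_range_succ]
    refine (eLpNorm_add_le (f := fun t => ∑ k ∈ Finset.range K, a k t) (g := a K) ?_ ?_
      (by norm_num)).trans (add_le_add ih (hc K))
    · exact (Finset.measurable_fun_sum _ fun k _ => ha k).aestronglyMeasurable
    · exact (ha K).aestronglyMeasurable

theorem eLpNorm_iSup_sum_le_tsum {α : Type*} [MeasurableSpace α] {μ : Measure α}
    (a : ℕ → α → ℝ≥0∞) (ha : ∀ k, Measurable (a k)) (c : ℕ → ℝ≥0∞)
    (hc : ∀ k, eLpNorm (a k) 4 μ ≤ c k) :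
    eLpNorm (fun t => ⨆ K, ∑ k ∈ Finset.range K, a k t) 4 μ ≤ ∑' k, c k := by
  rw [eLpNorm_four_le_iff]
  simp_rw [ENNReal.iSup_pow]
  rw [lintegral_iSup (fun K => (Finset.measurable_fun_sum _ fun k _ => ha k).pow_const 4)]
  · refine iSup_le fun K => ?_
    rw [← eLpNorm_four_le_iff]
    exact (eLpNorm_finset_sum_le_of_le a ha c hc K).trans (ENNReal.sum_le_tsum _)
  · intro K K' h t
    simp only
    gcongr

section Hilbert

variable {H : Type*} [NormedAddCommGroup H] [InnerProductSpace ℂ H]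

theorem measurable_iSup_inner {T : ℕ → ℝ → H} (hT : ∀ n, Continuous (T n)) (h : H) :
    Measurable fun t => ⨆ n, ‖inner ℂ (T n t) h‖ₑ :=
  Measurable.iSup fun n => ((hT n).inner continuous_const).enorm.measurable

theorem iSup_inner_add_le (T : ℕ → H) (h h' : H) :
    ⨆ n, ‖inner ℂ (T n) (h + h')‖ₑ ≤ (⨆ n, ‖inner ℂ (T n) h‖ₑ) + ⨆ n, ‖inner ℂ (T n) h'‖ₑ := by
  refine iSup_le fun n => ?_
  rw [inner_add_right]
  exact (enorm_add_le _ _).trans (add_le_add (le_iSup (fun n => ‖inner ℂ (T n) h‖ₑ) n)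
    (le_iSup (fun n => ‖inner ℂ (T n) h'‖ₑ) n))

theorem measurable_iSup_inner_comp {T : ℕ → ℝ → H} (hT : ∀ n, Continuous (T n))
    {j : ℝ → ℕ} (hj : Measurable j) (d : ℕ → H) :
    Measurable fun t => ⨆ n, ‖inner ℂ (T n t) (d (j t))‖ₑ := by
  have : Measurable (Function.uncurry fun (k : ℕ) (t : ℝ) => ⨆ n, ‖inner ℂ (T n t) (d k)‖ₑ) :=
    measurable_from_prod_countable_right fun k => measurable_iSup_inner hT (d k)
  exact this.comp (hj.prodMk measurable_id)

/-- On each level set of j the vector is constant, so the bound for fixed vectors applies. The N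
level sets are disjoint and their fourth powers add, so the loss in L⁴ is only N^{1/4}. -/
theorem lintegral_iSup_inner_comp_le {T : ℕ → ℝ → H} (hT : ∀ n, Continuous (T n)) {B : ℝ≥0∞}
    (hB : ∀ h, ∫⁻ t, (⨆ n, ‖inner ℂ (T n t) h‖ₑ) ^ 4 ≤ (B * ‖h‖ₑ) ^ 4)
    {j : ℝ → ℕ} (hj : Measurable j) {N : ℕ} (hN : ∀ t, j t < N) (d : ℕ → H) {c : ℝ≥0∞}
    (hd : ∀ t, ‖d (j t)‖ₑ ≤ c) :
    ∫⁻ t, (⨆ n, ‖inner ℂ (T n t) (d (j t))‖ₑ) ^ 4 ≤ N * (B * c) ^ 4 := by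
  have hm : ∀ k, MeasurableSet (j ⁻¹' {k}) := fun k => hj (measurableSet_singleton k)
  have h1 : ∀ t, (⨆ n, ‖inner ℂ (T n t) (d (j t))‖ₑ) ^ 4 =
      ∑ k ∈ Finset.range N, (j ⁻¹' {k}).indicator
        (fun t => (⨆ n, ‖inner ℂ (T n t) (d k)‖ₑ) ^ 4) t := fun t => by
    rw [Finset.sum_eq_single (j t)]
    · rw [Set.indicator_of_mem (by simp)]
    · intro k _ hk
      exact Set.indicator_of_notMem (by simpa using hk.symm) _
    · intro h
      exact absurd (Finset.mem_range.2 (hN t)) h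
  simp_rw [h1]
  rw [lintegral_finsetSum _ fun k _ => ((measurable_iSup_inner hT (d k)).pow_const 4).indicator (hm k)]
  calc _ ≤ ∑ k ∈ Finset.range N, (B * c) ^ 4 := by
        refine Finset.sum_le_sum fun k _ => ?_
        by_cases hk : ∃ t, j t = k
        · obtain ⟨t, rfl⟩ := hk
          refine (lintegral_mono fun s => Set.indicator_le_self _ _ s).trans ((hB _).trans ?_)
          gcongr
          exact hd t
        · have : j ⁻¹' {k} = ∅ := by
            ext t
            simp only [Set.mem_preimage, Set.mem_singleton_iff, Set.mem_empty_iff_false, iff_false]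
            exact fun h => hk ⟨t, h⟩
          simp [this]
    _ = _ := by simp

/-- A path `D` whose increments are controlled by those of a bounded function to the power `3/4`
satisfies the same maximal `L⁴` bound as a constant vector. -/
theorem eLpNorm_iSup_inner_path_le {T : ℕ → ℝ → H} (hT : ∀ n, Continuous (T n)) {B : ℝ≥0∞}
    (hB : ∀ h, ∫⁻ t, (⨆ n, ‖inner ℂ (T n t) h‖ₑ) ^ 4 ≤ (B * ‖h‖ₑ) ^ 4)
    {D : ℝ → H} {F : ℝ → ℝ} (hF : Measurable F) {A M : ℝ} (hA : 0 ≤ A) (hM : 0 < M)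
    (hFM : ∀ t, |F t| ≤ M) (hD : ∀ t, ‖D t‖ ≤ A * M ^ (3 / 4 : ℝ))
    (hDD : ∀ t s, ‖D t - D s‖ ≤ A * |F t - F s| ^ (3 / 4 : ℝ)) :
    eLpNorm (fun t => ⨆ n, ‖inner ℂ (T n t) (D t)‖ₑ) 4 volume ≤
      26 * B * ENNReal.ofReal (A * M ^ (3 / 4 : ℝ)) := by
  classical
  set Y : ℝ → ℝ := fun t => (F t + M) / (2 * M) with hY
  have hY0 : ∀ t, 0 ≤ Y t := fun t =>
    div_nonneg (by linarith [(abs_le.1 (hFM t)).1]) (by linarith)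
  have hY1 : ∀ t, Y t ≤ 1 := fun t => by
    rw [hY, div_le_one (by linarith)]
    linarith [(abs_le.1 (hFM t)).2]
  -- Base 16 makes both relevant powers integers: the fourth root of the number of cells is about
  -- 2^k, and cell lengths to the power 3/4 are multiples of 8^{-k}.
  set j : ℕ → ℝ → ℕ := fun k t => ⌊Y t * 16 ^ k⌋₊ with hj
  have hjm : ∀ k, Measurable (j k) := fun k => by
    refine Nat.measurable_floor.comp ?_
    fun_prop
  -- The extra cell holds the times with Y = 1.
  have hjN : ∀ k t, j k t < 16 ^ k + 1 := fun k t => by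
    rw [Nat.lt_succ_iff]
    refine Nat.floor_le_of_le ?_
    push_cast
    exact mul_le_of_le_one_left (by positivity) (hY1 t)
  have hjj : ∀ k t, j (k + 1) t / 16 = j k t := fun k t => by
    simp only [hj]
    rw [← Nat.floor_div_ofNat]
    congr 1
    rw [pow_succ]
    ring
  have hFj : ∀ k t s, j k t = j k s → |F t - F s| ≤ 2 * M / 16 ^ k := fun k t s h => by
    have h16 : (0 : ℝ) < 16 ^ k := by positivity
    have h1 : |Y t * 16 ^ k - Y s * 16 ^ k| ≤ 1 := by
      have a1 := Nat.floor_le (show 0 ≤ Y t * 16 ^ k by have := hY0 t; positivity)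
      have a2 := Nat.lt_floor_add_one (Y t * 16 ^ k)
      have b1 := Nat.floor_le (show 0 ≤ Y s * 16 ^ k by have := hY0 s; positivity)
      have b2 := Nat.lt_floor_add_one (Y s * 16 ^ k)
      simp only [hj] at h
      rw [h] at a1 a2
      rw [abs_le]; constructor <;> linarith
    have h2 : F t - F s = (Y t * 16 ^ k - Y s * 16 ^ k) * (2 * M / 16 ^ k) := by
      simp only [hY]; field_simp; ring
    rw [h2, abs_mul, abs_of_pos (by positivity : 0 < 2 * M / 16 ^ k)]
    exact mul_le_of_le_one_left (by positivity) h1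
  set c : ℝ := A * M ^ (3 / 4 : ℝ) with hc
  have hc0 : 0 ≤ c := by positivity
  have hDj : ∀ k t s, j k t = j k s → ‖D t - D s‖ ≤ 2 * c * (1 / 8) ^ k := fun k t s h => by
    refine (hDD t s).trans ?_
    have h1 : |F t - F s| ^ (3 / 4 : ℝ) ≤ (2 * M / 16 ^ k) ^ (3 / 4 : ℝ) := by
      have := hFj k t s h
      gcongr
    have h2 : ((16 : ℝ) ^ k) ^ (3 / 4 : ℝ) = 8 ^ k := by
      rw [← Real.rpow_natCast, ← Real.rpow_mul (by norm_num), mul_comm,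
        Real.rpow_mul (by norm_num), Real.rpow_natCast]
      congr 1
      rw [show (16 : ℝ) = 2 ^ (4 : ℝ) by norm_num, ← Real.rpow_mul (by norm_num)]
      norm_num
    have h3 : (2 * M / 16 ^ k) ^ (3 / 4 : ℝ) ≤ 2 * M ^ (3 / 4 : ℝ) * (1 / 8) ^ k := by
      rw [Real.div_rpow (by positivity) (by positivity), Real.mul_rpow (by norm_num) hM.le, h2,
        div_eq_mul_one_div, ← one_div_pow]
      gcongr
      exact Real.rpow_le_self_of_one_le (by norm_num) (by norm_num)
    calc _ ≤ A * (2 * M ^ (3 / 4 : ℝ) * (1 / 8) ^ k) := by gcongr; exact h1.trans h3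
      _ = _ := by rw [hc]; ring
  -- One representative time is chosen in each nonempty cell. D is approximated by its value there.
  have hτ : ∃ τ : ℕ → ℕ → ℝ, ∀ k t, j k (τ k (j k t)) = j k t := by
    have : ∀ k i, ∃ s, ∀ t, j k t = i → j k s = i := fun k i => by
      by_cases h : ∃ t, j k t = i
      · exact ⟨h.choose, fun _ _ => h.choose_spec⟩
      · exact ⟨0, fun t ht => absurd ⟨t, ht⟩ h⟩
    choose τ hτ using this
    exact ⟨τ, fun k t => hτ k (j k t) t rfl⟩
  obtain ⟨τ, hτ⟩ := hτ
  -- Integer division by 16 gives the parent cell, so the correction from level k to level k + 1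
  -- depends on the finer cell alone.
  set δ : ℕ → ℕ → H := fun k i => D (τ (k + 1) i) - D (τ k (i / 16)) with hδ
  set a : ℕ → ℝ → ℝ≥0∞ := fun k => Nat.casesOn k
    (fun t => ⨆ n, ‖inner ℂ (T n t) (D (τ 0 (j 0 t)))‖ₑ)
    (fun k t => ⨆ n, ‖inner ℂ (T n t) (δ k (j (k + 1) t))‖ₑ) with ha
  have ham : ∀ k, Measurable (a k) := by
    rintro (_ | k)
    · exact measurable_iSup_inner_comp hT (hjm 0) fun i => D (τ 0 i)
    · exact measurable_iSup_inner_comp hT (hjm (k + 1)) (δ k)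
  -- Level 0 has at most 2 cells. The later corrections are at most 4c·8^{-k} on at most 16^{k+1} +
  -- 1 ≤ (3·2^k)⁴ cells, which gives 12Bc·4^{-k} in L⁴.
  set e : ℕ → ℝ≥0∞ := fun k => Nat.casesOn k (2 * B * ENNReal.ofReal c)
    (fun k => 12 * B * ENNReal.ofReal c * (1 / 4) ^ k) with he
  have hae : ∀ k, eLpNorm (a k) 4 volume ≤ e k := by
    rintro (_ | k)
    · rw [eLpNorm_four_le_iff]
      refine (lintegral_iSup_inner_comp_le hT hB (hjm 0) (hjN 0) (fun i => D (τ 0 i))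
        (c := ENNReal.ofReal c) fun t => ?_).trans ?_
      · rw [← ofReal_norm]
        exact ENNReal.ofReal_le_ofReal (hD _)
      · change _ ≤ (2 * B * ENNReal.ofReal c) ^ 4
        rw [mul_assoc, mul_pow 2]
        gcongr
        norm_num
    · rw [eLpNorm_four_le_iff]
      refine (lintegral_iSup_inner_comp_le hT hB (hjm (k + 1)) (hjN (k + 1)) (δ k)
        (c := ENNReal.ofReal (4 * c * (1 / 8) ^ k)) fun t => ?_).trans ?_
      · rw [← ofReal_norm]
        refine ENNReal.ofReal_le_ofReal ?_
        have h1 := hDj (k + 1) _ t (hτ (k + 1) t)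
        have h2 := hDj k _ t (hτ k t)
        rw [← hjj k t, ← norm_neg, neg_sub] at h2
        simp only [hδ]
        calc _ = ‖(D (τ (k + 1) (j (k + 1) t)) - D t) + (D t - D (τ k (j (k + 1) t / 16)))‖ := by
              congr 1; abel
          _ ≤ 2 * c * (1 / 8) ^ (k + 1) + 2 * c * (1 / 8) ^ k := norm_add_le_of_le h1 h2
          _ ≤ 2 * c * (1 / 8) ^ k + 2 * c * (1 / 8) ^ k := by
              gcongr 2 * c * ?_ + _
              exact pow_le_pow_of_le_one (by norm_num) (by norm_num) (Nat.le_succ k)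
          _ = _ := by ring
      · simp only [he]
        have h8 : ENNReal.ofReal (4 * c * (1 / 8) ^ k) = 4 * ENNReal.ofReal c * (1 / 8) ^ k := by
          rw [ENNReal.ofReal_mul (by positivity), ENNReal.ofReal_mul (by positivity),
            ENNReal.ofReal_pow (by norm_num), ENNReal.ofReal_div_of_pos (by norm_num)]
          norm_num
        have hcount : (((16 ^ (k + 1) + 1 : ℕ)) : ℝ≥0∞) ≤ (3 * 2 ^ k) ^ 4 := by
          have : 16 ^ (k + 1) + 1 ≤ (3 * 2 ^ k) ^ 4 := by
            have : (2 ^ k) ^ 4 = 16 ^ k := by rw [← pow_mul, mul_comm, pow_mul]; norm_num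
            rw [mul_pow, this, pow_succ]
            have : 1 ≤ 16 ^ k := Nat.one_le_pow _ _ (by norm_num)
            omega
          exact_mod_cast this
        have h28 : (2 : ℝ≥0∞) ^ k * (1 / 8) ^ k = (1 / 4) ^ k := by
          rw [← mul_pow]
          congr 1
          rw [show (8 : ℝ≥0∞) = 2 * 4 by norm_num, one_div, one_div,
            ENNReal.mul_inv (by simp) (by simp), ← mul_assoc,
            ENNReal.mul_inv_cancel (by simp) (by simp), one_mul]
        rw [h8]
        calc _ ≤ (3 * 2 ^ k) ^ 4 * (B * (4 * ENNReal.ofReal c * (1 / 8) ^ k)) ^ 4 := by gcongr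
          _ = (12 * B * ENNReal.ofReal c * ((2 : ℝ≥0∞) ^ k * (1 / 8) ^ k)) ^ 4 := by ring
          _ = _ := by rw [h28]
  have hlim : ∀ t, Filter.Tendsto (fun k => D (τ k (j k t))) Filter.atTop (nhds (D t)) := fun t => by
    rw [tendsto_iff_norm_sub_tendsto_zero]
    refine squeeze_zero (fun k => norm_nonneg _) (fun k => hDj k _ t (hτ k t)) ?_
    simpa using (tendsto_pow_atTop_nhds_zero_of_lt_one (r := (1 / 8 : ℝ)) (by norm_num)
      (by norm_num)).const_mul (2 * c)
  have hsum : ∀ K t, (⨆ n, ‖inner ℂ (T n t) (D (τ K (j K t)))‖ₑ) ≤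
      ∑ k ∈ Finset.range (K + 1), a k t := fun K t => by
    induction K with
    | zero => simp [ha]
    | succ K ih =>
      rw [Finset.sum_range_succ]
      refine le_trans ?_ (add_le_add_left ih _)
      have : D (τ (K + 1) (j (K + 1) t)) = D (τ K (j K t)) + δ K (j (K + 1) t) := by
        simp only [hδ, hjj]; abel
      rw [this]
      exact iSup_inner_add_le (fun n => T n t) _ _
  calc _ ≤ eLpNorm (fun t => ⨆ K, ∑ k ∈ Finset.range K, a k t) 4 volume := by
        refine eLpNorm_mono_enorm fun t => ?_
        simp only [enorm_eq_self]
        refine iSup_le fun n => ?_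
        have hl : Filter.Tendsto (fun k => ‖inner ℂ (T n t) (D (τ k (j k t)))‖ₑ) Filter.atTop
            (nhds ‖inner ℂ (T n t) (D t)‖ₑ) :=
          ((tendsto_const_nhds (x := T n t)).inner (hlim t)).enorm
        refine le_of_tendsto' hl fun k => ?_
        refine (le_iSup (fun n => ‖inner ℂ (T n t) (D (τ k (j k t)))‖ₑ) n).trans ?_
        exact (hsum k t).trans (le_iSup (fun K => ∑ k ∈ Finset.range K, a k t) (k + 1))
    _ ≤ ∑' k, e k := eLpNorm_iSup_sum_le_tsum a ham e hae
    _ = 2 * B * ENNReal.ofReal c + ∑' k, 12 * B * ENNReal.ofReal c * (1 / 4 : ℝ≥0∞) ^ k := by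
        rw [tsum_eq_zero_add' ENNReal.summable]; rfl
    -- The geometric sum 4/3 is rounded up to 2, whence 2 + 24 = 26.
    _ ≤ 2 * B * ENNReal.ofReal c + 12 * B * ENNReal.ofReal c * 2 := by
        rw [ENNReal.tsum_mul_left, ENNReal.tsum_geometric]
        gcongr
        refine ENNReal.inv_le_iff_inv_le.2 (ENNReal.le_sub_of_add_le_left (by simp) ?_)
        rw [one_div, ← ENNReal.inv_two_add_inv_two]
        gcongr
        norm_num
    _ = _ := by ring

end Hilbert

end

/-! ### Schur's test and polar coordinates -/

section

section Schur

variable {X Y : Type*} [MeasurableSpace X] [MeasurableSpace Y] {μ : Measure X} {ν : Measure Y}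
  [SFinite μ] [SFinite ν]

/-- Schur's test for the oscillatory integral operator with phase `p`, in the `L²` norm with
weight `ω`. -/
theorem lintegral_oscillatory_sq_le {p : X → Y → ℝ} (hp : Measurable (Function.uncurry p))
    {ω : Y → ℝ} (hω : Integrable ω ν) (hω0 : ∀ y, 0 ≤ ω y) {G : X → ℂ} (hG : Integrable G μ)
    {κ : X → X → ℝ≥0∞} (hκm : Measurable (Function.uncurry κ))
    (hκ : ∀ x x', ‖∫ y, Complex.exp (Complex.I * ((p x y - p x' y : ℝ) : ℂ)) * (ω y : ℂ) ∂ν‖ₑ ≤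
      κ x x') (hκs : ∀ x x', κ x x' = κ x' x) {c : ℝ≥0∞} (hc : ∀ x, ∫⁻ x', κ x x' ∂μ ≤ c) :
    ∫⁻ y, ‖∫ x, Complex.exp (Complex.I * (p x y : ℂ)) * G x ∂μ‖ₑ ^ 2 * ENNReal.ofReal (ω y) ∂ν ≤
      2 * c * ∫⁻ x, ‖G x‖ₑ ^ 2 ∂μ := by
  set V : Y → ℂ := fun y => ∫ x, Complex.exp (Complex.I * (p x y : ℂ)) * G x ∂μ with hV
  have hpc : Measurable fun z : X × Y => (p z.1 z.2 : ℂ) := Complex.measurable_ofReal.comp hp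
  set Φ : Y × (X × X) → ℂ := fun z =>
    Complex.exp (Complex.I * ((p z.2.1 z.1 - p z.2.2 z.1 : ℝ) : ℂ)) * (ω z.1 : ℂ) *
      (G z.2.1 * starRingEnd ℂ (G z.2.2)) with hΦ
  have hGG : Integrable (fun z : X × X => G z.1 * starRingEnd ℂ (G z.2)) (μ.prod μ) :=
    hG.mul_prod (Complex.conjLIE.toContinuousLinearEquiv.toContinuousLinearMap.integrable_comp hG)
  have hexpm : Measurable fun z : Y × (X × X) =>
      Complex.exp (Complex.I * ((p z.2.1 z.1 - p z.2.2 z.1 : ℝ) : ℂ)) := by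
    refine Complex.measurable_exp.comp (measurable_const.mul (Complex.measurable_ofReal.comp ?_))
    exact (hp.comp (by fun_prop : Measurable fun z : Y × (X × X) => (z.2.1, z.1))).sub
      (hp.comp (by fun_prop : Measurable fun z : Y × (X × X) => (z.2.2, z.1)))
  have hnorm : ∀ r : ℝ, ‖Complex.exp (Complex.I * (r : ℂ))‖ = 1 := fun r => by
    rw [mul_comm, Complex.norm_exp_ofReal_mul_I]
  have hΦi : Integrable Φ (ν.prod (μ.prod μ)) := by
    have h1 : Integrable (fun z : Y × (X × X) => (ω z.1 : ℂ) * (G z.2.1 * starRingEnd ℂ (G z.2.2)))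
        (ν.prod (μ.prod μ)) := hω.ofReal.mul_prod hGG
    have := h1.bdd_mul (c := 1) hexpm.aestronglyMeasurable
      (Filter.Eventually.of_forall fun z => (hnorm _).le)
    simpa only [hΦ, mul_assoc] using this
  have hVV : ∀ y, (V y * starRingEnd ℂ (V y)) * (ω y : ℂ) = ∫ z, Φ (y, z) ∂(μ.prod μ) := fun y => by
    rw [hV]
    simp only
    rw [← integral_conj, ← integral_prod_mul, ← integral_mul_const]
    refine integral_congr_ae (Filter.Eventually.of_forall fun z => ?_)
    simp only [hΦ, map_mul, ← Complex.exp_conj, Complex.conj_I, Complex.conj_ofReal]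
    have : Complex.exp (Complex.I * ((p z.1 y - p z.2 y : ℝ) : ℂ)) =
        Complex.exp (Complex.I * (p z.1 y : ℂ)) * Complex.exp (-Complex.I * (p z.2 y : ℂ)) := by
      rw [← Complex.exp_add]; congr 1; push_cast; ring
    rw [this]
    ring
  have hreal : ∀ y, (V y * starRingEnd ℂ (V y)) * (ω y : ℂ) = ((‖V y‖ ^ 2 * ω y : ℝ) : ℂ) := fun y => by
    rw [RCLike.mul_conj]; simp
  have hint : Integrable (fun y => ‖V y‖ ^ 2 * ω y) ν := by
    have := hΦi.integral_prod_left
    simp_rw [← hVV, hreal] at this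
    exact this.re
  calc ∫⁻ y, ‖V y‖ₑ ^ 2 * ENNReal.ofReal (ω y) ∂ν
      = ‖∫ y, (((‖V y‖ ^ 2 * ω y : ℝ)) : ℂ) ∂ν‖ₑ := by
        rw [integral_complex_ofReal, ← ofReal_norm, Complex.norm_real, Real.norm_of_nonneg
          (integral_nonneg fun y => mul_nonneg (by positivity) (hω0 y)),
          ofReal_integral_eq_lintegral_ofReal hint
          (Filter.Eventually.of_forall fun y => mul_nonneg (by positivity) (hω0 y))]
        refine lintegral_congr fun y => ?_
        rw [ENNReal.ofReal_mul (by positivity), ENNReal.ofReal_pow (norm_nonneg _), ofReal_norm]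
    -- The weight and G being integrable, Fubini lets y be integrated first. This produces the
    -- oscillatory integral bounded by κ.
    _ = ‖∫ z, ∫ y, Φ (y, z) ∂ν ∂(μ.prod μ)‖ₑ := by
        simp_rw [← hreal, hVV]
        rw [integral_integral_swap (f := fun y z => Φ (y, z)) hΦi]
    _ ≤ ∫⁻ z, ‖∫ y, Φ (y, z) ∂ν‖ₑ ∂(μ.prod μ) := enorm_integral_le_lintegral_enorm _
    _ ≤ ∫⁻ z, (κ z.1 z.2 * ‖G z.1‖ₑ ^ 2 + κ z.1 z.2 * ‖G z.2‖ₑ ^ 2) ∂(μ.prod μ) := by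
        refine lintegral_mono fun z => ?_
        simp only [hΦ]
        rw [integral_mul_const, enorm_mul, enorm_mul, RCLike.enorm_conj, ← mul_add]
        refine mul_le_mul' (hκ _ _) ?_
        rcases le_total ‖G z.1‖ₑ ‖G z.2‖ₑ with h | h
        · refine le_trans ?_ le_add_self
          rw [sq]; gcongr
        · refine le_trans ?_ le_self_add
          rw [sq]; gcongr
    _ ≤ c * (∫⁻ x, ‖G x‖ₑ ^ 2 ∂μ) + c * ∫⁻ x, ‖G x‖ₑ ^ 2 ∂μ := by
        have hGe : AEMeasurable (fun x => ‖G x‖ₑ ^ 2) μ := hG.aestronglyMeasurable.enorm.pow_const 2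
        have hm1 : AEMeasurable (fun z : X × X => κ z.1 z.2 * ‖G z.1‖ₑ ^ 2) (μ.prod μ) :=
          hκm.aemeasurable.mul (hGe.comp_fst)
        have hm2 : AEMeasurable (fun z : X × X => κ z.1 z.2 * ‖G z.2‖ₑ ^ 2) (μ.prod μ) :=
          hκm.aemeasurable.mul (hGe.comp_snd)
        rw [lintegral_add_left' hm1]
        refine add_le_add ?_ ?_
        · rw [lintegral_prod _ hm1, ← lintegral_const_mul'' _ hGe]
          refine lintegral_mono fun x => ?_
          simp only
          rw [lintegral_mul_const _ (show Measurable fun x' => κ x x' from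
            hκm.comp measurable_prodMk_left)]
          gcongr
          exact hc x
        · rw [lintegral_prod_symm _ hm2, ← lintegral_const_mul'' _ hGe]
          refine lintegral_mono fun x => ?_
          simp only
          rw [lintegral_mul_const _ (show Measurable fun x' => κ x' x from
            hκm.comp measurable_prodMk_right)]
          gcongr
          simp_rw [hκs _ x]
          exact hc x
    _ = _ := by ring

end Schur

theorem integrable_comp_norm_sq {h : ℝ → ℝ} (hh : Integrable h) :
    Integrable fun z : Plane => h (‖z‖ ^ 2) := by
  have := integrable_fun_norm_addHaar (volume : Measure Plane) (f := fun r => h (r ^ 2))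
  rw [this]
  have h2 := (integrableOn_Ioi_comp_rpow_iff' h (p := 2) (by norm_num)).2 hh.integrableOn
  refine h2.congr_fun (fun y hy => ?_) measurableSet_Ioi
  norm_num

/-- In the plane the area element is π dρ in the variable ρ = |z|². This is what makes the resonance
integral below uniformly bounded. -/
theorem integral_comp_norm_sq (h : ℝ → ℝ) :
    ∫ z : Plane, h (‖z‖ ^ 2) = Real.pi * ∫ ρ in Set.Ioi 0, h ρ := by
  have h1 := integral_fun_norm_addHaar (volume : Measure Plane) (fun r => h (r ^ 2))
  rw [h1, ← integral_comp_rpow_Ioi h (p := 2) (by norm_num), Measure.real,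
    EuclideanSpace.volume_ball_fin_two]
  norm_num
  rw [← integral_const_mul, ← integral_const_mul, ← integral_const_mul]
  refine setIntegral_congr_fun measurableSet_Ioi fun y hy => ?_
  rw [ENNReal.toReal_ofReal Real.pi_pos.le]
  ring

end

/-! ### The unweighted L⁴ Strichartz estimate -/

theorem enorm_integral_gaussian_time_le {ε : ℝ} (hε : 0 < ε) (a : ℝ) :
    ‖∫ t : ℝ, Complex.exp (Complex.I * ((t * a : ℝ) : ℂ)) * (Real.exp (-ε * t ^ 2) : ℂ)‖ₑ ≤
      ENNReal.ofReal (√(Real.pi / ε) * Real.exp (-a ^ 2 / (4 * ε))) := by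
  have h := fourierIntegral_gaussian (b := ε) (by simpa using hε) (a : ℂ)
  have h1 : ∫ t : ℝ, Complex.exp (Complex.I * ((t * a : ℝ) : ℂ)) * (Real.exp (-ε * t ^ 2) : ℂ) =
      ((Real.pi / ε : ℝ) : ℂ) ^ (1 / 2 : ℂ) * ((Real.exp (-a ^ 2 / (4 * ε)) : ℝ) : ℂ) := by
    push_cast
    rw [← h]
    congr 1 with t
    ring_nf
  rw [h1, ← ofReal_norm, norm_mul, Complex.norm_real, Real.norm_of_nonneg (Real.exp_pos _).le,
    Complex.norm_cpow_eq_rpow_re_of_pos (by positivity), Real.sqrt_eq_rpow]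
  norm_num

theorem enorm_integral_gaussian_plane_le {ε : ℝ} (hε : 0 < ε) (b : Plane) :
    ‖∫ x : Plane, Complex.exp (Complex.I * ((inner ℝ x b : ℝ) : ℂ)) *
      (Real.exp (-ε * ‖x‖ ^ 2) : ℂ)‖ₑ ≤
      ENNReal.ofReal (Real.pi / ε * Real.exp (-‖b‖ ^ 2 / (4 * ε))) := by
  have h := GaussianFourier.integral_cexp_neg_mul_sq_norm_add (b := ε) (by simpa using hε)
    Complex.I b
  have h1 : ∫ x : Plane, Complex.exp (Complex.I * ((inner ℝ x b : ℝ) : ℂ)) *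
      (Real.exp (-ε * ‖x‖ ^ 2) : ℂ) =
      ((Real.pi / ε * Real.exp (-‖b‖ ^ 2 / (4 * ε)) : ℝ) : ℂ) := by
    have h2 : ((Module.finrank ℝ Plane : ℕ) : ℂ) / 2 = 1 := by simp
    rw [h2, Complex.cpow_one] at h
    push_cast
    rw [Complex.I_sq, neg_one_mul] at h
    rw [← h]
    congr 1 with x
    rw [← Complex.exp_add, real_inner_comm, add_comm]
  rw [h1, ← ofReal_norm, Complex.norm_real, Real.norm_of_nonneg (by positivity)]

theorem lintegral_comp_sub_two_mul_norm_sq_le {h : ℝ → ℝ} (hh : Integrable h) (h0 : ∀ q, 0 ≤ h q)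
    (c : ℝ) : ∫⁻ z : Plane, ENNReal.ofReal (h (c - 2 * ‖z‖ ^ 2)) ≤
      ENNReal.ofReal (Real.pi / 2 * ∫ q, h q) := by
  have hi : Integrable fun ρ => h (c - 2 * ρ) := (hh.comp_sub_left c).comp_mul_left' (by norm_num)
  rw [← ofReal_integral_eq_lintegral_ofReal (integrable_comp_norm_sq hi)
    (Filter.Eventually.of_forall fun z => h0 _), integral_comp_norm_sq fun ρ => h (c - 2 * ρ)]
  refine ENNReal.ofReal_le_ofReal ?_
  rw [div_eq_mul_inv, mul_assoc]
  gcongr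
  calc _ ≤ ∫ ρ, h (c - 2 * ρ) :=
        setIntegral_le_integral hi (Filter.Eventually.of_forall fun ρ => h0 _)
    _ = _ := by
        rw [Measure.integral_comp_mul_left (fun ρ => h (c - ρ)) 2, integral_sub_left_eq_self]
        norm_num [abs_of_pos]

/-- In the variables η = z₁ + z₂ and y = z₂ one has |η - y|² + |y|² = |η|²/2 + 2|y - η/2|². For
fixed η the integral in y is thus a radial one about η/2, bounded independently of η and c, and the
integral of k factors out. -/
theorem lintegral_resonance_le {h : ℝ → ℝ} (hh : Integrable h) (hhm : Measurable h)
    (h0 : ∀ q, 0 ≤ h q) {k : Plane → ℝ≥0∞} (hk : Measurable k) (c : ℝ) (η₀ : Plane) :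
    ∫⁻ z : Plane × Plane, ENNReal.ofReal (h (c - (‖z.1‖ ^ 2 + ‖z.2‖ ^ 2))) *
      k (η₀ - (z.1 + z.2)) ≤ ENNReal.ofReal (Real.pi / 2 * ∫ q, h q) * ∫⁻ η, k η := by
  have hm : Measurable fun z : Plane × Plane =>
      ENNReal.ofReal (h (c - (‖z.1‖ ^ 2 + ‖z.2‖ ^ 2))) * k (η₀ - (z.1 + z.2)) :=
    (ENNReal.measurable_ofReal.comp (hhm.comp (by fun_prop))).mul (hk.comp (by fun_prop))
  have hm2 : Measurable (Function.uncurry fun (y η : Plane) =>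
      ENNReal.ofReal (h (c - (‖η - y‖ ^ 2 + ‖y‖ ^ 2))) * k (η₀ - η)) :=
    (ENNReal.measurable_ofReal.comp (hhm.comp (by fun_prop))).mul (hk.comp (by fun_prop))
  calc _ = ∫⁻ y : Plane, ∫⁻ x : Plane, ENNReal.ofReal (h (c - (‖x‖ ^ 2 + ‖y‖ ^ 2))) *
          k (η₀ - (x + y)) := lintegral_prod_symm _ hm.aemeasurable
    _ = ∫⁻ y : Plane, ∫⁻ η : Plane, ENNReal.ofReal (h (c - (‖η - y‖ ^ 2 + ‖y‖ ^ 2))) *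
          k (η₀ - η) := by
        refine lintegral_congr fun y => ?_
        rw [← lintegral_sub_right_eq_self _ y]
        simp
    _ = ∫⁻ η : Plane, ∫⁻ y : Plane, ENNReal.ofReal (h (c - (‖η - y‖ ^ 2 + ‖y‖ ^ 2))) *
          k (η₀ - η) := lintegral_lintegral_swap hm2.aemeasurable
    _ ≤ ∫⁻ η : Plane, ENNReal.ofReal (Real.pi / 2 * ∫ q, h q) * k (η₀ - η) := by
        refine lintegral_mono fun η => ?_
        rw [lintegral_mul_const _ (by fun_prop)]
        gcongr
        refine le_trans (le_of_eq ?_)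
          (lintegral_comp_sub_two_mul_norm_sq_le hh h0 (c - ‖η‖ ^ 2 / 2))
        rw [← lintegral_add_right_eq_self _ ((1 / 2 : ℝ) • η)]
        refine lintegral_congr fun z => ?_
        congr 2
        have h1 : η - (z + (1 / 2 : ℝ) • η) = (1 / 2 : ℝ) • η - z := by module
        rw [h1, norm_sub_sq_real, norm_add_sq_real, norm_smul, real_inner_comm]
        norm_num
        ring
    _ = _ := by
        rw [lintegral_const_mul _ (show Measurable fun η => k (η₀ - η) from hk.comp (by fun_prop)),
          lintegral_sub_left_eq_self]

/-- The free Schrödinger wave with frequency profile `g`. -/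
def freeWave (g : Plane → ℂ) (t : ℝ) (x : Plane) : ℂ :=
  ∫ ξ, Complex.exp (Complex.I *
    ((-(2 * Real.pi * inner ℝ x ξ + t * (2 * Real.pi * ‖ξ‖) ^ 2) : ℝ) : ℂ)) * g ξ

theorem continuous_freeWave {g : Plane → ℂ} (hg : Integrable g) :
    Continuous fun y : ℝ × Plane => freeWave g y.1 y.2 := by
  refine continuous_of_dominated (bound := fun ξ => ‖g ξ‖) (fun y => ?_) (fun y => ?_) hg.norm ?_
  · exact (by fun_prop : Continuous fun ξ : Plane => Complex.exp (Complex.I *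
      ((-(2 * Real.pi * inner ℝ y.2 ξ + y.1 * (2 * Real.pi * ‖ξ‖) ^ 2) : ℝ) : ℂ))).aestronglyMeasurable.mul
        hg.aestronglyMeasurable
  · refine Filter.Eventually.of_forall fun ξ => ?_
    rw [norm_mul, mul_comm Complex.I, Complex.norm_exp_ofReal_mul_I, one_mul]
  · exact Filter.Eventually.of_forall fun ξ => by fun_prop

/-- The square of the wave is an oscillatory integral over pairs of frequencies, with amplitude g ⊗
g, so its weighted L² norm falls under Schur's test. The Gaussian weight makes space-time
integrable. Its transform is a product of Gaussians in the differences of energies and of momenta,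
whose integrals do not depend on ε, so the bound is uniform in ε. -/
theorem lintegral_freeWave_mul_gaussian_le {g : Plane → ℂ} (hg : Integrable g) {ε : ℝ} (hε : 0 < ε) :
    ∫⁻ y : ℝ × Plane, ‖freeWave g y.1 y.2‖ₑ ^ 4 *
      ENNReal.ofReal (Real.exp (-ε * y.1 ^ 2) * Real.exp (-ε * ‖y.2‖ ^ 2)) ≤
      2 * (∫⁻ ξ, ‖g ξ‖ₑ ^ 2) ^ 2 := by
  set p : Plane × Plane → ℝ × Plane → ℝ := fun z y =>
    -(2 * Real.pi * inner ℝ y.2 (z.1 + z.2) + y.1 * (2 * Real.pi) ^ 2 * (‖z.1‖ ^ 2 + ‖z.2‖ ^ 2))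
    with hp
  set ω : ℝ × Plane → ℝ := fun y => Real.exp (-ε * y.1 ^ 2) * Real.exp (-ε * ‖y.2‖ ^ 2) with hω
  set h : ℝ → ℝ := fun q => √(Real.pi / ε) * Real.exp (-((2 * Real.pi) ^ 2 * q) ^ 2 / (4 * ε))
    with hh
  set k : Plane → ℝ≥0∞ := fun η =>
    ENNReal.ofReal (Real.pi / ε * Real.exp (-(2 * Real.pi * ‖η‖) ^ 2 / (4 * ε))) with hk
  set κ : Plane × Plane → Plane × Plane → ℝ≥0∞ := fun z z' =>
    ENNReal.ofReal (h (‖z.1‖ ^ 2 + ‖z.2‖ ^ 2 - (‖z'.1‖ ^ 2 + ‖z'.2‖ ^ 2))) *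
      k (z.1 + z.2 - (z'.1 + z'.2)) with hκ
  have hsq : ∀ y, freeWave g y.1 y.2 ^ 2 =
      ∫ z : Plane × Plane, Complex.exp (Complex.I * (p z y : ℂ)) * (g z.1 * g z.2) := fun y => by
    rw [sq, freeWave, ← integral_prod_mul]
    refine integral_congr_ae (Filter.Eventually.of_forall fun z => ?_)
    simp only
    rw [mul_mul_mul_comm, ← Complex.exp_add]
    congr 2
    simp only [hp, inner_add_right]
    push_cast
    ring
  have hωi : Integrable ω (volume : Measure (ℝ × Plane)) := by
    refine Integrable.mul_prod (f := fun t : ℝ => Real.exp (-ε * t ^ 2))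
      (g := fun x : Plane => Real.exp (-ε * ‖x‖ ^ 2)) (integrable_exp_neg_mul_sq hε) ?_
    have := GaussianFourier.integrable_cexp_neg_mul_sq_norm_add (b := ε) (by simpa using hε) 0 (0 : Plane)
    refine this.re.congr (Filter.Eventually.of_forall fun x => ?_)
    simp only [zero_mul, add_zero]
    rw [← Complex.exp_ofReal_re]
    simp
  have hA : (0 : ℝ) < (2 * Real.pi) ^ 4 / (4 * ε) := by positivity
  have hh' : h = fun q => √(Real.pi / ε) * Real.exp (-((2 * Real.pi) ^ 4 / (4 * ε)) * q ^ 2) := by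
    ext q; simp only [hh]; congr 2; ring
  have hhi : Integrable h := by
    rw [hh']; exact (integrable_exp_neg_mul_sq hA).const_mul _
  have hhI : ∫ q, h q = 1 / (2 * Real.pi) := by
    rw [hh', integral_const_mul, integral_gaussian, ← Real.sqrt_mul (by positivity)]
    rw [show Real.pi / ε * (Real.pi / ((2 * Real.pi) ^ 4 / (4 * ε))) = (1 / (2 * Real.pi)) ^ 2 by
      field_simp; ring]
    exact Real.sqrt_sq (by positivity)
  have hkI : ∫⁻ η, k η = 1 := by
    have hB : (0 : ℝ) < (2 * Real.pi) ^ 2 / (4 * ε) := by positivity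
    have hk' : k = fun η => ENNReal.ofReal (Real.pi / ε * Real.exp (-((2 * Real.pi) ^ 2 / (4 * ε)) * ‖η‖ ^ 2)) := by
      ext q; simp only [hk]; congr 3; ring
    have hi : Integrable fun η : Plane => Real.exp (-((2 * Real.pi) ^ 2 / (4 * ε)) * ‖η‖ ^ 2) := by
      have := GaussianFourier.integrable_cexp_neg_mul_sq_norm_add (b := (((2 * Real.pi) ^ 2 / (4 * ε) : ℝ) : ℂ))
        (by rwa [Complex.ofReal_re]) 0 (0 : Plane)
      refine this.re.congr (Filter.Eventually.of_forall fun x => ?_)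
      simp only [zero_mul, add_zero]
      rw [← Complex.exp_ofReal_re]
      simp
    rw [hk', ← ofReal_integral_eq_lintegral_ofReal (hi.const_mul _)
      (Filter.Eventually.of_forall fun η => by positivity), integral_const_mul,
      GaussianFourier.integral_rexp_neg_mul_sq_norm hB]
    rw [← ENNReal.ofReal_one]
    congr 1
    norm_num
    field_simp
    ring
  have key := lintegral_oscillatory_sq_le (μ := (volume : Measure (Plane × Plane)))
    (ν := (volume : Measure (ℝ × Plane))) (p := p) (by simp only [hp, Function.uncurry_def]; fun_prop) hωi
    (fun y => by positivity) (G := fun z => g z.1 * g z.2) (hg.mul_prod hg) (κ := κ)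
    (by simp only [hκ, hh, hk, Function.uncurry_def]; fun_prop) ?_ ?_ (c := 1) ?_
  · have hG : ∫⁻ z : Plane × Plane, ‖g z.1 * g z.2‖ₑ ^ 2 = (∫⁻ ξ, ‖g ξ‖ₑ ^ 2) ^ 2 := by
      simp_rw [enorm_mul, mul_pow]
      have := lintegral_prod_mul (μ := (volume : Measure Plane)) (ν := (volume : Measure Plane))
        (f := fun ξ => ‖g ξ‖ₑ ^ 2) (g := fun ξ => ‖g ξ‖ₑ ^ 2)
        (hg.aestronglyMeasurable.enorm.pow_const 2) (hg.aestronglyMeasurable.enorm.pow_const 2)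
      rw [sq, ← this]
      rfl
    rw [hG, mul_one] at key
    refine le_trans (le_of_eq (lintegral_congr fun y => ?_)) key
    rw [← hsq, enorm_pow, ← pow_mul]
  · intro z z'
    have h1 : ∫ y, Complex.exp (Complex.I * ((p z y - p z' y : ℝ) : ℂ)) * (ω y : ℂ) =
        (∫ t : ℝ, Complex.exp (Complex.I * ((t * ((2 * Real.pi) ^ 2 *
          (‖z'.1‖ ^ 2 + ‖z'.2‖ ^ 2 - (‖z.1‖ ^ 2 + ‖z.2‖ ^ 2))) : ℝ) : ℂ)) *
            (Real.exp (-ε * t ^ 2) : ℂ)) *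
        ∫ x : Plane, Complex.exp (Complex.I *
          ((inner ℝ x ((2 * Real.pi) • (z'.1 + z'.2 - (z.1 + z.2))) : ℝ) : ℂ)) *
            (Real.exp (-ε * ‖x‖ ^ 2) : ℂ) := by
      rw [← integral_prod_mul]
      refine integral_congr_ae (Filter.Eventually.of_forall fun y => ?_)
      simp only
      rw [mul_mul_mul_comm, ← Complex.exp_add]
      congr 2
      · simp only [hp, inner_add_right, inner_smul_right, inner_sub_right]
        push_cast
        ring
      · simp [hω]
    rw [h1, enorm_mul]
    refine (mul_le_mul' (enorm_integral_gaussian_time_le hε _)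
      (enorm_integral_gaussian_plane_le hε _)).trans (le_of_eq ?_)
    simp only [hκ, hh, hk]
    congr 4
    · ring
    · rw [norm_smul, norm_sub_rev, Real.norm_of_nonneg (by positivity)]
  · intro z z'
    simp only [hκ, hh, hk]
    rw [norm_sub_rev]
    congr 4
    ring
  · intro z
    -- The value is (π/2)·(1/(2π)) = 1/4, below the Schur constant 1.
    refine (lintegral_resonance_le hhi (by simp only [hh]; fun_prop) (fun q => by positivity)
      (by simp only [hk]; fun_prop) _ _).trans ?_
    rw [hkI, hhI, mul_one]
    rw [← ENNReal.ofReal_one]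
    refine ENNReal.ofReal_le_ofReal ?_
    field_simp
    norm_num

/-- The `L⁴` Strichartz estimate for free Schrödinger waves in the plane. -/
theorem lintegral_freeWave_pow_four_le {g : Plane → ℂ} (hg : Integrable g) :
    ∫⁻ y : ℝ × Plane, ‖freeWave g y.1 y.2‖ₑ ^ 4 ≤ 2 * (∫⁻ ξ, ‖g ξ‖ₑ ^ 2) ^ 2 := by
  -- The weights tend to 1 along this sequence, and Fatou's lemma removes them.
  set ε : ℕ → ℝ := fun n => 1 / ((n : ℝ) + 1) with hε
  have hε0 : Filter.Tendsto ε Filter.atTop (nhds 0) := tendsto_one_div_add_atTop_nhds_zero_nat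
  have hc := continuous_freeWave hg
  have hlim : ∀ y : ℝ × Plane, Filter.Tendsto (fun n => ‖freeWave g y.1 y.2‖ₑ ^ 4 *
      ENNReal.ofReal (Real.exp (-ε n * y.1 ^ 2) * Real.exp (-ε n * ‖y.2‖ ^ 2))) Filter.atTop
      (nhds (‖freeWave g y.1 y.2‖ₑ ^ 4)) := fun y => by
    have h1 : Filter.Tendsto (fun n => Real.exp (-ε n * y.1 ^ 2) * Real.exp (-ε n * ‖y.2‖ ^ 2))
        Filter.atTop (nhds 1) := by
      have h2 : Continuous fun e : ℝ => Real.exp (-e * y.1 ^ 2) * Real.exp (-e * ‖y.2‖ ^ 2) := by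
        fun_prop
      simpa [Function.comp_def] using (h2.tendsto 0).comp hε0
    have h3 := ENNReal.Tendsto.const_mul (a := ‖freeWave g y.1 y.2‖ₑ ^ 4)
      (ENNReal.tendsto_ofReal h1) (Or.inr (by simp))
    simpa using h3
  calc _ = ∫⁻ y : ℝ × Plane, Filter.liminf (fun n => ‖freeWave g y.1 y.2‖ₑ ^ 4 *
        ENNReal.ofReal (Real.exp (-ε n * y.1 ^ 2) * Real.exp (-ε n * ‖y.2‖ ^ 2))) Filter.atTop :=
        lintegral_congr fun y => (hlim y).liminf_eq.symm
    _ ≤ Filter.liminf (fun n => ∫⁻ y : ℝ × Plane, ‖freeWave g y.1 y.2‖ₑ ^ 4 *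
        ENNReal.ofReal (Real.exp (-ε n * y.1 ^ 2) * Real.exp (-ε n * ‖y.2‖ ^ 2))) Filter.atTop := by
        refine lintegral_liminf_le fun n => (hc.enorm.measurable.pow_const 4).mul ?_
        fun_prop
    _ ≤ _ := by
        refine Filter.liminf_le_of_le (by isBoundedDefault) fun b hb => ?_
        obtain ⟨n, hn⟩ := hb.exists
        exact hn.trans (lintegral_freeWave_mul_gaussian_le hg (by positivity))

/-! ### Decay of the Bessel integral, and rotations -/

theorem norm_exp_I_mul_ofReal (r : ℝ) : ‖Complex.exp (Complex.I * (r : ℂ))‖ = 1 := by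
  rw [mul_comm, Complex.norm_exp_ofReal_mul_I]

/-- On a quarter period the only stationary point is θ = 0. The interval [0, δ] with δ = |z|^{-1/2}
is estimated trivially. On the rest one integrates by parts: 1/sin θ is monotone, so the boundary
terms and the remaining integral together are at most 2/(|z| sin δ) ≤ 4δ. -/
theorem norm_integral_exp_cos_quarter_le {δ z : ℝ} (hδ : 0 < δ) (hz : |z| * δ ^ 2 = 1) :
    ‖∫ θ in 0..(Real.pi / 2), Complex.exp (Complex.I * ((z * Real.cos θ : ℝ) : ℂ))‖ ≤ 5 * δ := by
  have hcont : Continuous fun θ : ℝ => Complex.exp (Complex.I * ((z * Real.cos θ : ℝ) : ℂ)) := by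
    fun_prop
  rcases le_total (Real.pi / 2) δ with h | h
  · refine (intervalIntegral.norm_integral_le_of_norm_le_const (C := 1)
      fun θ _ => (norm_exp_I_mul_ofReal _).le).trans ?_
    rw [sub_zero, abs_of_pos (by positivity)]
    linarith
  have hz0 : z ≠ 0 := by
    rintro rfl
    simp at hz
  rw [← intervalIntegral.integral_add_adjacent_intervals (b := δ)
    (hcont.intervalIntegrable _ _) (hcont.intervalIntegrable _ _)]
  have h1 : ‖∫ θ in 0..δ, Complex.exp (Complex.I * ((z * Real.cos θ : ℝ) : ℂ))‖ ≤ δ := by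
    refine (intervalIntegral.norm_integral_le_of_norm_le_const (C := 1)
      fun θ _ => (norm_exp_I_mul_ofReal _).le).trans ?_
    rw [sub_zero, abs_of_pos hδ, one_mul]
  have hsin : ∀ θ ∈ Set.uIcc δ (Real.pi / 2), 0 < Real.sin θ := fun θ hθ => by
    rw [Set.uIcc_of_le h] at hθ
    exact Real.sin_pos_of_pos_of_lt_pi (by linarith [hθ.1]) (by linarith [hθ.2, Real.pi_pos])
  -- This is the reciprocal of the derivative of the exponent, so that u v' = v.
  set u : ℝ → ℂ := fun θ => Complex.I / z * (((Real.sin θ)⁻¹ : ℝ) : ℂ) with hu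
  set u' : ℝ → ℂ := fun θ => Complex.I / z * ((-Real.cos θ / Real.sin θ ^ 2 : ℝ) : ℂ) with hu'
  set v : ℝ → ℂ := fun θ => Complex.exp (Complex.I * ((z * Real.cos θ : ℝ) : ℂ)) with hv
  set v' : ℝ → ℂ := fun θ => v θ * (Complex.I * ((z * -Real.sin θ : ℝ) : ℂ)) with hv'
  have hud : ∀ θ ∈ Set.uIcc δ (Real.pi / 2), HasDerivAt u (u' θ) θ := fun θ hθ =>
    (((Real.hasDerivAt_sin θ).inv (hsin θ hθ).ne').ofReal_comp).const_mul _
  have hvd : ∀ θ ∈ Set.uIcc δ (Real.pi / 2), HasDerivAt v (v' θ) θ := fun θ _ =>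
    (((((Real.hasDerivAt_cos θ).const_mul z).ofReal_comp).const_mul Complex.I).cexp)
  have hu'c : ContinuousOn u' (Set.uIcc δ (Real.pi / 2)) := by
    refine continuousOn_const.mul (Complex.continuous_ofReal.comp_continuousOn ?_)
    refine ContinuousOn.div (by fun_prop) (by fun_prop) fun θ hθ => ?_
    exact pow_ne_zero _ (hsin θ hθ).ne'
  have hparts := intervalIntegral.integral_mul_deriv_eq_deriv_mul hud hvd
    hu'c.intervalIntegrable ((by simp only [hv', hv]; fun_prop : Continuous v').intervalIntegrable _ _)
  have huv : ∀ θ ∈ Set.uIcc δ (Real.pi / 2), u θ * v' θ = v θ := fun θ hθ => by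
    have := (hsin θ hθ).ne'
    have hs : ((Real.sin θ : ℝ) : ℂ) ≠ 0 := by exact_mod_cast this
    have hzc : (z : ℂ) ≠ 0 := by exact_mod_cast hz0
    simp only [hu, hv']
    rw [Complex.ofReal_inv, Complex.ofReal_mul, Complex.ofReal_neg]
    field_simp
    rw [Complex.I_sq]
    ring
  rw [intervalIntegral.integral_congr huv] at hparts
  have hnv : ∀ θ, ‖v θ‖ = 1 := fun θ => norm_exp_I_mul_ofReal _
  have hcz : ‖Complex.I / (z : ℂ)‖ = 1 / |z| := by simp
  have hnu : ∀ θ ∈ Set.uIcc δ (Real.pi / 2), ‖u θ‖ = 1 / |z| * (Real.sin θ)⁻¹ := fun θ hθ => by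
    simp only [hu]
    rw [norm_mul, hcz, Complex.norm_real, Real.norm_of_nonneg (by have := hsin θ hθ; positivity)]
  have hI : ‖∫ θ in δ..(Real.pi / 2), u' θ * v θ‖ ≤
      1 / |z| * (Real.sin δ)⁻¹ - 1 / |z| * (Real.sin (Real.pi / 2))⁻¹ := by
    refine (intervalIntegral.norm_integral_le_integral_norm h).trans (le_of_eq ?_)
    have : ∀ θ ∈ Set.uIcc δ (Real.pi / 2), ‖u' θ * v θ‖ =
        -(1 / |z| * (-Real.cos θ / Real.sin θ ^ 2)) := fun θ hθ => by
      rw [norm_mul, hnv, mul_one]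
      simp only [hu']
      rw [norm_mul, hcz, Complex.norm_real, neg_div, norm_neg, Real.norm_of_nonneg]
      · ring
      · rw [Set.uIcc_of_le h] at hθ
        exact div_nonneg (Real.cos_nonneg_of_neg_pi_div_two_le_of_le (by linarith [hθ.1, Real.pi_pos])
          hθ.2) (by positivity)
    rw [intervalIntegral.integral_congr this, intervalIntegral.integral_neg,
      intervalIntegral.integral_eq_sub_of_hasDerivAt (f := fun θ => 1 / |z| * (Real.sin θ)⁻¹)]
    · ring
    · exact fun θ hθ => ((Real.hasDerivAt_sin θ).inv (hsin θ hθ).ne').const_mul _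
    · refine ContinuousOn.intervalIntegrable ?_
      refine continuousOn_const.mul (ContinuousOn.div (by fun_prop) (by fun_prop) fun θ hθ => ?_)
      exact pow_ne_zero _ (hsin θ hθ).ne'
  have h2 : ‖∫ θ in δ..(Real.pi / 2), v θ‖ ≤ 2 * (1 / |z| * (Real.sin δ)⁻¹) := by
    rw [hparts]
    refine (norm_sub_le_of_le (norm_sub_le _ _) hI).trans ?_
    rw [norm_mul (u _) (v _), norm_mul (u _) (v _), hnv, hnv, hnu _ Set.right_mem_uIcc,
      hnu _ Set.left_mem_uIcc]
    linarith
  have h3 : 1 / |z| * (Real.sin δ)⁻¹ ≤ 2 * δ := by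
    have hs : 2 / Real.pi * δ ≤ Real.sin δ := Real.mul_le_sin hδ.le h
    have hzpos : 0 < |z| := abs_pos.2 hz0
    have h4 : 1 / |z| = δ ^ 2 := by
      field_simp
      linarith
    have h5 : (Real.sin δ)⁻¹ ≤ (2 / Real.pi * δ)⁻¹ := by
      gcongr
    rw [h4]
    calc _ ≤ δ ^ 2 * (2 / Real.pi * δ)⁻¹ := by gcongr
      _ = Real.pi / 2 * δ := by field_simp
      _ ≤ 2 * δ := by gcongr; linarith [Real.pi_le_four]
  calc _ ≤ δ + 2 * (2 * δ) := norm_add_le_of_le h1 (h2.trans (by gcongr))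
    _ = _ := by ring

/-- Decay of the Bessel integral `∫ e^{i z cos θ} dθ`. -/
theorem sqrt_mul_norm_integral_exp_cos_le (z α : ℝ) :
    √|z| * ‖∫ θ in 0..(2 * Real.pi), Complex.exp (Complex.I * ((z * Real.cos (θ + α) : ℝ) : ℂ))‖ ≤
      20 := by
  rcases eq_or_ne z 0 with rfl | hz0
  · simp
  set q : ℝ → ℝ → ℂ := fun z θ => Complex.exp (Complex.I * ((z * Real.cos θ : ℝ) : ℂ)) with hq
  have hqc : ∀ z, Continuous (q z) := fun z => by simp only [hq]; fun_prop
  have hi : ∀ z a b, IntervalIntegrable (q z) volume a b := fun z a b => (hqc z).intervalIntegrable a b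
  have hper : Function.Periodic (q z) (2 * Real.pi) := fun θ => by
    simp only [hq, Real.cos_add_two_pi]
  have h1 : ∫ θ in 0..(2 * Real.pi), q z (θ + α) = ∫ θ in 0..(2 * Real.pi), q z θ := by
    rw [intervalIntegral.integral_comp_add_right, zero_add, add_comm (2 * Real.pi) α,
      hper.intervalIntegral_add_eq α 0, zero_add]
  have h2 : ∀ z, ∫ θ in (Real.pi / 2)..Real.pi, q z θ = ∫ θ in 0..(Real.pi / 2), q (-z) θ := fun z => by
    have := intervalIntegral.integral_comp_sub_left (a := 0) (b := Real.pi / 2) (q z) Real.pi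
    rw [sub_zero, show Real.pi - Real.pi / 2 = Real.pi / 2 by ring] at this
    rw [← this]
    refine intervalIntegral.integral_congr fun θ _ => ?_
    simp only [hq, Real.cos_pi_sub, mul_neg, neg_mul]
  have h3 : ∫ θ in Real.pi..(2 * Real.pi), q z θ = ∫ θ in 0..Real.pi, q z θ := by
    have := intervalIntegral.integral_comp_sub_left (a := 0) (b := Real.pi) (q z) (2 * Real.pi)
    rw [sub_zero, show 2 * Real.pi - Real.pi = Real.pi by ring] at this
    rw [← this]
    refine intervalIntegral.integral_congr fun θ _ => ?_
    simp only [hq, Real.cos_two_pi_sub]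
  -- The reflections θ ↦ π - θ and θ ↦ 2π - θ reduce the full period to four quarters, with z or -z.
  -- Each is at most 5|z|^{-1/2}, hence the 20.
  have h4 : ∫ θ in 0..(2 * Real.pi), q z θ =
      2 * ((∫ θ in 0..(Real.pi / 2), q z θ) + ∫ θ in 0..(Real.pi / 2), q (-z) θ) := by
    rw [← intervalIntegral.integral_add_adjacent_intervals (hi z 0 Real.pi) (hi z _ _), h3,
      ← intervalIntegral.integral_add_adjacent_intervals (hi z 0 (Real.pi / 2)) (hi z _ _), h2]
    ring
  have hzpos : 0 < √|z| := Real.sqrt_pos.2 (abs_pos.2 hz0)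
  have hδ : |z| * (√|z|)⁻¹ ^ 2 = 1 := by
    rw [inv_pow, Real.sq_sqrt (abs_nonneg z)]
    exact mul_inv_cancel₀ (abs_pos.2 hz0).ne'
  have h5 := norm_integral_exp_cos_quarter_le (z := z) (inv_pos.2 hzpos) hδ
  have h6 := norm_integral_exp_cos_quarter_le (z := -z) (inv_pos.2 hzpos) (by rwa [abs_neg])
  change √|z| * ‖∫ θ in 0..(2 * Real.pi), q z (θ + α)‖ ≤ 20
  rw [h1, h4, norm_mul]
  have h7 := norm_add_le_of_le h5 h6
  calc _ ≤ √|z| * (‖(2 : ℂ)‖ * (5 * (√|z|)⁻¹ + 5 * (√|z|)⁻¹)) := by gcongr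
    _ = 20 := by
      simp only [Complex.norm_ofNat]
      field_simp
      norm_num

/-- The rotation of the plane by the angle `θ`. -/
def rot (θ : ℝ) : Plane ≃ₗᵢ[ℝ] Plane :=
  Complex.orthonormalBasisOneI.repr.symm.trans
    ((rotation (Circle.exp θ)).trans Complex.orthonormalBasisOneI.repr)

theorem continuous_rot : Continuous fun p : ℝ × Plane => rot p.1 p.2 := by
  simp only [rot, LinearIsometryEquiv.trans_apply, rotation_apply]
  refine Complex.orthonormalBasisOneI.repr.continuous.comp ?_
  exact (Continuous.subtype_val (Circle.exp.continuous.comp continuous_fst)).mul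
    (Complex.orthonormalBasisOneI.repr.symm.continuous.comp continuous_snd)

theorem exists_inner_rot_eq (x y : Plane) :
    ∃ α : ℝ, ∀ θ, inner ℝ (rot θ x) y = ‖x‖ * ‖y‖ * Real.cos (θ + α) := by
  set a := Complex.orthonormalBasisOneI.repr.symm x with ha
  set b := Complex.orthonormalBasisOneI.repr.symm y with hb
  refine ⟨a.arg - b.arg, fun θ => ?_⟩
  have h1 : inner ℝ (rot θ x) y = inner ℝ ((Circle.exp θ : ℂ) * a) b := by
    rw [← Complex.orthonormalBasisOneI.repr.symm.inner_map_map]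
    simp [rot, ha, hb, rotation_apply]
  have hna : ‖x‖ = ‖a‖ := (LinearIsometryEquiv.norm_map _ x).symm
  have hnb : ‖y‖ = ‖b‖ := (LinearIsometryEquiv.norm_map _ y).symm
  rw [h1, hna, hnb, Complex.inner]
  conv_lhs => rw [← Complex.norm_mul_exp_arg_mul_I a, ← Complex.norm_mul_exp_arg_mul_I b]
  have : starRingEnd ℂ ((Circle.exp θ : ℂ) * (‖a‖ * Complex.exp (a.arg * Complex.I))) *
      (‖b‖ * Complex.exp (b.arg * Complex.I)) =
      ((‖a‖ * ‖b‖ : ℝ) : ℂ) * Complex.exp (((-(θ + (a.arg - b.arg)) : ℝ) : ℂ) * Complex.I) := by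
    simp only [Circle.coe_exp, map_mul, ← Complex.exp_conj, Complex.conj_ofReal, Complex.conj_I]
    push_cast
    rw [show -((θ : ℂ) + (a.arg - b.arg)) * Complex.I =
      θ * -Complex.I + a.arg * -Complex.I + b.arg * Complex.I by ring, Complex.exp_add, Complex.exp_add]
    ring
  rw [mul_comm, this, Complex.re_ofReal_mul, Complex.exp_ofReal_mul_I_re, Real.cos_neg]

/-! ### The kernel of the Schrödinger propagator -/

/-- The Fourier transform of the Gaussian `e^{-b|ξ|²}` on the plane. -/
def gaussianKernel (b : ℂ) (v : Plane) : ℂ :=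
  Real.pi / b * Complex.exp (-Real.pi ^ 2 * ‖v‖ ^ 2 / b)

theorem norm_gaussianKernel_le {b : ℂ} (hb : 0 ≤ b.re) (v : Plane) :
    ‖gaussianKernel b v‖ ≤ Real.pi / ‖b‖ := by
  rw [gaussianKernel, norm_mul, norm_div, Complex.norm_real, Real.norm_of_nonneg Real.pi_pos.le]
  refine mul_le_of_le_one_right (by positivity) ?_
  rw [Complex.norm_exp, Real.exp_le_one_iff]
  have : -(Real.pi : ℂ) ^ 2 * (‖v‖ : ℂ) ^ 2 / b = ((-(Real.pi ^ 2 * ‖v‖ ^ 2) : ℝ) : ℂ) * b⁻¹ := by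
    push_cast; rw [div_eq_mul_inv]; ring
  rw [this, Complex.re_ofReal_mul, Complex.inv_re]
  have h1 : 0 ≤ b.re / Complex.normSq b := div_nonneg hb (Complex.normSq_nonneg _)
  have h2 : 0 ≤ Real.pi ^ 2 * ‖v‖ ^ 2 := by positivity
  nlinarith

theorem continuous_gaussianKernel (b : ℂ) : Continuous (gaussianKernel b) := by
  unfold gaussianKernel
  simp only [div_eq_mul_inv]
  fun_prop

theorem fourier_mul_conj_fourier_eq (ψ φ : Plane → ℂ) (ξ : Plane) :
    𝓕 ψ ξ * starRingEnd ℂ (𝓕 φ ξ) = ∫ z : Plane × Plane,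
      Complex.exp (Complex.I * ((2 * Real.pi * inner ℝ (z.1 - z.2) ξ : ℝ) : ℂ)) *
        (starRingEnd ℂ (φ z.1) * ψ z.2) := by
  rw [Real.fourier_eq', Real.fourier_eq', ← integral_conj, mul_comm, ← integral_prod_mul]
  refine integral_congr_ae (Filter.Eventually.of_forall fun z => ?_)
  simp only [smul_eq_mul, map_mul, ← Complex.exp_conj, Complex.conj_I, Complex.conj_ofReal]
  rw [mul_mul_mul_comm, ← Complex.exp_add]
  congr 2
  rw [inner_sub_left]
  push_cast
  ring

theorem integral_gaussian_mul_fourier_eq {ψ φ : Plane → ℂ} (hψ : Integrable ψ) (hφ : Integrable φ)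
    {b : ℂ} (hb : 0 < b.re) :
    ∫ ξ : Plane, Complex.exp (-b * ‖ξ‖ ^ 2) * (𝓕 ψ ξ * starRingEnd ℂ (𝓕 φ ξ)) =
      ∫ z : Plane × Plane, gaussianKernel b (z.1 - z.2) * (starRingEnd ℂ (φ z.1) * ψ z.2) := by
  have hφψ : Integrable (fun z : Plane × Plane => starRingEnd ℂ (φ z.1) * ψ z.2) :=
    (Complex.conjLIE.toContinuousLinearEquiv.toContinuousLinearMap.integrable_comp hφ).mul_prod hψ
  have hgi : Integrable fun ξ : Plane => Complex.exp (-b * ‖ξ‖ ^ 2) := by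
    simpa using GaussianFourier.integrable_cexp_neg_mul_sq_norm_add hb 0 (0 : Plane)
  have hi : Integrable (fun p : Plane × (Plane × Plane) => Complex.exp (-b * ‖p.1‖ ^ 2) *
      (Complex.exp (Complex.I * ((2 * Real.pi * inner ℝ (p.2.1 - p.2.2) p.1 : ℝ) : ℂ)) *
        (starRingEnd ℂ (φ p.2.1) * ψ p.2.2))) (volume.prod volume) := by
    have h1 := hgi.mul_prod hφψ
    have h2 := h1.bdd_mul (c := 1) (f := fun p : Plane × (Plane × Plane) =>
      Complex.exp (Complex.I * ((2 * Real.pi * inner ℝ (p.2.1 - p.2.2) p.1 : ℝ) : ℂ)))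
      (by fun_prop : Continuous fun p : Plane × (Plane × Plane) => Complex.exp (Complex.I *
        ((2 * Real.pi * inner ℝ (p.2.1 - p.2.2) p.1 : ℝ) : ℂ))).aestronglyMeasurable
      (Filter.Eventually.of_forall fun p => (norm_exp_I_mul_ofReal _).le)
    refine h2.congr (Filter.Eventually.of_forall fun p => ?_)
    simp only
    ring
  simp_rw [fourier_mul_conj_fourier_eq, ← integral_const_mul]
  rw [integral_integral_swap (f := fun (ξ : Plane) (z : Plane × Plane) =>
    Complex.exp (-b * ‖ξ‖ ^ 2) *
      (Complex.exp (Complex.I * ((2 * Real.pi * inner ℝ (z.1 - z.2) ξ : ℝ) : ℂ)) *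
        (starRingEnd ℂ (φ z.1) * ψ z.2))) hi]
  refine integral_congr_ae (Filter.Eventually.of_forall fun z => ?_)
  simp only [← mul_assoc, ← Complex.exp_add]
  rw [integral_mul_const, integral_mul_const]
  congr 2
  have h := GaussianFourier.integral_cexp_neg_mul_sq_norm_add hb (2 * Real.pi * Complex.I)
    (z.1 - z.2)
  have h2 : ((Module.finrank ℝ Plane : ℕ) : ℂ) / 2 = 1 := by simp
  rw [h2, Complex.cpow_one] at h
  rw [gaussianKernel]
  have h3 : (2 * Real.pi * Complex.I) ^ 2 * (‖z.1 - z.2‖ : ℂ) ^ 2 / (4 * b) =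
      -Real.pi ^ 2 * (‖z.1 - z.2‖ : ℂ) ^ 2 / b := by
    rw [mul_pow, Complex.I_sq]
    rw [show (2 * (Real.pi : ℂ)) ^ 2 * -1 * (‖z.1 - z.2‖ : ℂ) ^ 2 =
      4 * (-Real.pi ^ 2 * (‖z.1 - z.2‖ : ℂ) ^ 2) by ring, mul_div_mul_left _ _ (by norm_num)]
  rw [← h3, ← h]
  congr 1 with ξ
  congr 2
  push_cast
  ring

/-- The symbol is the boundary value at b = 4π²it of the Gaussians e^{-b|ξ|²} with Re b > 0, for
which the identity is Fubini. As Re b decreases to 0, convergence is dominated on both sides: the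
Gaussian is at most 1 in modulus, and the kernel at most π/|Im b|. -/
theorem integral_schrodingerSymbol_mul_fourier_eq {ψ φ : Plane → ℂ} (hψ : Integrable ψ)
    (hφ : Integrable φ) (hi : Integrable fun ξ => 𝓕 ψ ξ * starRingEnd ℂ (𝓕 φ ξ))
    {t : ℝ} (ht : t ≠ 0) :
    ∫ ξ : Plane, schrodingerSymbol t ξ * (𝓕 ψ ξ * starRingEnd ℂ (𝓕 φ ξ)) =
      ∫ z : Plane × Plane, gaussianKernel (Complex.I * ((4 * Real.pi ^ 2 * t : ℝ) : ℂ)) (z.1 - z.2) *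
        (starRingEnd ℂ (φ z.1) * ψ z.2) := by
  set c : ℝ := 4 * Real.pi ^ 2 * t with hc
  have hc0 : c ≠ 0 := by positivity
  set b : ℝ → ℂ := fun ε => (ε : ℂ) + Complex.I * (c : ℂ) with hb
  have hbre : ∀ ε, (b ε).re = ε := fun ε => by simp [hb]
  have hbim : ∀ ε, (b ε).im = c := fun ε => by simp [hb]
  have hb0 : b 0 = Complex.I * (c : ℂ) := by simp [hb]
  have hbne : b 0 ≠ 0 := by rw [hb0]; simp [hc0]
  have hbc : Filter.Tendsto b (nhdsWithin 0 (Set.Ioi 0)) (nhds (b 0)) :=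
    ((by fun_prop : Continuous b).tendsto 0).mono_left nhdsWithin_le_nhds
  have hφψ : Integrable (fun z : Plane × Plane => starRingEnd ℂ (φ z.1) * ψ z.2) :=
    (Complex.conjLIE.toContinuousLinearEquiv.toContinuousLinearMap.integrable_comp hφ).mul_prod hψ
  have h1 : Filter.Tendsto (fun ε => ∫ ξ : Plane, Complex.exp (-b ε * ‖ξ‖ ^ 2) *
      (𝓕 ψ ξ * starRingEnd ℂ (𝓕 φ ξ))) (nhdsWithin 0 (Set.Ioi 0))
      (nhds (∫ ξ : Plane, schrodingerSymbol t ξ * (𝓕 ψ ξ * starRingEnd ℂ (𝓕 φ ξ)))) := by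
    refine tendsto_integral_filter_of_dominated_convergence
      (fun ξ => ‖𝓕 ψ ξ * starRingEnd ℂ (𝓕 φ ξ)‖) ?_ ?_ hi.norm ?_
    · exact Filter.Eventually.of_forall fun ε =>
        (by fun_prop : Continuous fun ξ : Plane => Complex.exp (-b ε * ‖ξ‖ ^ 2)).aestronglyMeasurable.mul
          hi.aestronglyMeasurable
    · filter_upwards [self_mem_nhdsWithin] with ε hε
      refine Filter.Eventually.of_forall fun ξ => ?_
      rw [norm_mul]
      refine mul_le_of_le_one_left (norm_nonneg _) ?_
      rw [Complex.norm_exp, Real.exp_le_one_iff, ← Complex.ofReal_pow, Complex.re_mul_ofReal,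
        Complex.neg_re, hbre]
      have : 0 ≤ ε * ‖ξ‖ ^ 2 := mul_nonneg (le_of_lt hε) (by positivity)
      linarith
    · refine Filter.Eventually.of_forall fun ξ => Filter.Tendsto.mul_const _ ?_
      have h2 : schrodingerSymbol t ξ = Complex.exp (-b 0 * ‖ξ‖ ^ 2) := by
        rw [schrodingerSymbol, hb0, hc]
        congr 1
        push_cast
        ring
      rw [h2]
      exact ((hbc.neg).mul_const _).cexp
  have h2 : Filter.Tendsto (fun ε => ∫ z : Plane × Plane, gaussianKernel (b ε) (z.1 - z.2) *
      (starRingEnd ℂ (φ z.1) * ψ z.2)) (nhdsWithin 0 (Set.Ioi 0))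
      (nhds (∫ z : Plane × Plane, gaussianKernel (b 0) (z.1 - z.2) *
        (starRingEnd ℂ (φ z.1) * ψ z.2))) := by
    refine tendsto_integral_filter_of_dominated_convergence
      (fun z => Real.pi / |c| * ‖starRingEnd ℂ (φ z.1) * ψ z.2‖) ?_ ?_ (hφψ.norm.const_mul _) ?_
    · exact Filter.Eventually.of_forall fun ε =>
        ((continuous_gaussianKernel _).comp (by fun_prop)).aestronglyMeasurable.mul
          hφψ.aestronglyMeasurable
    · filter_upwards [self_mem_nhdsWithin] with ε hε
      refine Filter.Eventually.of_forall fun z => ?_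
      rw [norm_mul]
      gcongr
      refine (norm_gaussianKernel_le (by rw [hbre]; exact le_of_lt hε) _).trans ?_
      have h3 : |c| ≤ ‖b ε‖ := by
        rw [← hbim ε]; exact Complex.abs_im_le_norm _
      have : 0 < |c| := abs_pos.2 hc0
      gcongr
    · refine Filter.Eventually.of_forall fun z => Filter.Tendsto.mul_const _ ?_
      unfold gaussianKernel
      exact (tendsto_const_nhds.div hbc hbne).mul (tendsto_const_nhds.div hbc hbne).cexp
  rw [← hb0]
  refine tendsto_nhds_unique h1 (h2.congr' ?_)
  filter_upwards [self_mem_nhdsWithin] with ε hε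
  exact (integral_gaussian_mul_fourier_eq hψ hφ (by rw [hbre]; exact hε)).symm

/-! ### Radial averaging and the weighted dispersive estimate -/

/-- The average of `ρ` over the rotations of the plane. -/
def radialMean (ρ : Plane → ℝ) (x : Plane) : ℝ :=
  (2 * Real.pi)⁻¹ * ∫ θ in 0..(2 * Real.pi), ρ (rot θ x)

theorem continuous_rot_symm : Continuous fun p : ℝ × Plane => (rot p.1).symm p.2 := by
  have h : ∀ p : ℝ × Plane, (rot p.1).symm p.2 = rot (-p.1) p.2 := fun p => by
    rw [LinearIsometryEquiv.symm_apply_eq]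
    simp only [rot, LinearIsometryEquiv.trans_apply, rotation_apply,
      LinearIsometryEquiv.symm_apply_apply]
    rw [← mul_assoc, ← Circle.coe_mul, ← Circle.exp_add, add_neg_cancel, Circle.exp_zero,
      Circle.coe_one, one_mul, LinearIsometryEquiv.apply_symm_apply]
  simp_rw [h]
  exact Continuous.comp (g := fun p : ℝ × Plane => rot p.1 p.2)
    (f := fun p : ℝ × Plane => (-p.1, p.2)) continuous_rot (by fun_prop)

theorem integrable_mul_comp_rot {ρ : Plane → ℝ} (hρ : Measurable ρ) {c R : ℝ}
    (hc : ∀ x, |ρ x| ≤ c) (hR : ∀ x, R < ‖x‖ → ρ x = 0) {F : Plane → ℂ} (hFm : AEStronglyMeasurable F)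
    (hF : IntegrableOn F (Metric.closedBall 0 R)) :
    Integrable (fun p : ℝ × Plane => F p.2 * ((√‖p.2‖ * ρ (rot p.1 p.2) : ℝ) : ℂ))
      ((volume.restrict (Set.Ioc 0 (2 * Real.pi))).prod volume) := by
  have h1 : Integrable fun y => √R * c * ‖(Metric.closedBall (0 : Plane) R).indicator F y‖ :=
    ((integrable_indicator_iff Metric.isClosed_closedBall.measurableSet).2 hF).norm.const_mul _
  refine (h1.comp_snd (volume.restrict (Set.Ioc 0 (2 * Real.pi)))).mono' ?_ ?_
  · refine hFm.comp_snd.mul (Measurable.aestronglyMeasurable ?_)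
    refine Complex.measurable_ofReal.comp (Measurable.mul (by fun_prop) ?_)
    exact hρ.comp continuous_rot.measurable
  · refine Filter.Eventually.of_forall fun p => ?_
    rw [norm_mul, Complex.norm_real, norm_mul, Real.norm_of_nonneg (Real.sqrt_nonneg _)]
    have hc0 : 0 ≤ c := (abs_nonneg _).trans (hc 0)
    by_cases hp : ‖p.2‖ ≤ R
    · rw [Set.indicator_of_mem (by simpa using hp), mul_comm]
      have := hc (rot p.1 p.2)
      rw [Real.norm_eq_abs]
      gcongr
    · rw [hR (rot p.1 p.2) (by rw [LinearIsometryEquiv.norm_map]; exact not_le.1 hp)]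
      simp only [norm_zero, mul_zero]
      positivity

/-- Averaging over rotations is self-adjoint and commutes with the radial weight, so it can be moved
from the density to the function F. -/
theorem integral_mul_radialMean {ρ : Plane → ℝ} (hρ : Measurable ρ) {c R : ℝ}
    (hc : ∀ x, |ρ x| ≤ c) (hR : ∀ x, R < ‖x‖ → ρ x = 0) {F : Plane → ℂ} (hFm : AEStronglyMeasurable F)
    (hF : IntegrableOn F (Metric.closedBall 0 R)) :
    ∫ y, F y * ((√‖y‖ * radialMean ρ y : ℝ) : ℂ) =
      ((2 * Real.pi)⁻¹ : ℝ) * ∫ θ in 0..(2 * Real.pi), ∫ y,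
        F ((rot θ).symm y) * ((√‖y‖ * ρ y : ℝ) : ℂ) := by
  have h1 : ∀ y, F y * ((√‖y‖ * radialMean ρ y : ℝ) : ℂ) = ((2 * Real.pi)⁻¹ : ℝ) *
      ∫ θ in Set.Ioc 0 (2 * Real.pi), F y * ((√‖y‖ * ρ (rot θ y) : ℝ) : ℂ) := fun y => by
    rw [radialMean, intervalIntegral.integral_of_le (by positivity)]
    simp_rw [Complex.ofReal_mul]
    rw [← integral_complex_ofReal, integral_const_mul, integral_const_mul]
    ring
  simp_rw [h1]
  rw [integral_const_mul, intervalIntegral.integral_of_le (by positivity)]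
  congr 1
  rw [← integral_integral_swap (f := fun (θ : ℝ) (y : Plane) =>
    F y * ((√‖y‖ * ρ (rot θ y) : ℝ) : ℂ)) (integrable_mul_comp_rot hρ hc hR hFm hF)]
  refine integral_congr_ae (Filter.Eventually.of_forall fun θ => ?_)
  simp only
  rw [← (rot θ).symm.measurePreserving.integral_comp
    (rot θ).symm.toHomeomorph.measurableEmbedding]
  simp

theorem integrable_sqrt_norm_mul {ρ : Plane → ℝ} (hρ : Measurable ρ) {c R : ℝ}
    (hc : ∀ x, |ρ x| ≤ c) (hR : ∀ x, R < ‖x‖ → ρ x = 0) : Integrable fun y => √‖y‖ * ρ y := by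
  have h1 : Integrable fun y : Plane => (Metric.closedBall (0 : Plane) R).indicator (fun _ => √R * c) y :=
    (integrable_indicator_iff Metric.isClosed_closedBall.measurableSet).2
      (integrableOn_const measure_closedBall_lt_top.ne)
  refine h1.mono' ((by fun_prop : Measurable fun y : Plane => √‖y‖).mul hρ).aestronglyMeasurable
    (Filter.Eventually.of_forall fun y => ?_)
  rw [norm_mul, Real.norm_of_nonneg (Real.sqrt_nonneg _), Real.norm_eq_abs]
  by_cases hp : ‖y‖ ≤ R
  · rw [Set.indicator_of_mem (by simpa using hp)]
    have := hc y
    gcongr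
  · rw [hR y (not_le.1 hp), Set.indicator_of_notMem (by simpa using hp)]
    simp

theorem integrable_of_bdd_of_supp {ρ : Plane → ℝ} (hρ : Measurable ρ) {c R : ℝ}
    (hc : ∀ x, |ρ x| ≤ c) (hR : ∀ x, R < ‖x‖ → ρ x = 0) : Integrable ρ := by
  have h1 : Integrable fun y : Plane => (Metric.closedBall (0 : Plane) R).indicator (fun _ => c) y :=
    (integrable_indicator_iff Metric.isClosed_closedBall.measurableSet).2
      (integrableOn_const measure_closedBall_lt_top.ne)
  refine h1.mono' hρ.aestronglyMeasurable (Filter.Eventually.of_forall fun y => ?_)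
  rw [Real.norm_eq_abs]
  by_cases hp : ‖y‖ ≤ R
  · rw [Set.indicator_of_mem (by simpa using hp)]
    exact hc y
  · rw [hR y (not_le.1 hp), Set.indicator_of_notMem (by simpa using hp)]
    simp

/-- The angular dependence of |x - y|² is |x||y| times a cosine, so the rotation average is a Bessel
integral at z = -|x||y|/(2t). The weights equal √2 |t|^{1/2} |z|^{1/2}. The last factor is absorbed
by the Bessel decay, and the first turns 1/|t| into |t|^{-1/2}. -/
theorem norm_integral_kernel_rot_le {t : ℝ} (ht : t ≠ 0) (x y : Plane) :
    √‖x‖ * √‖y‖ * ‖∫ θ in 0..(2 * Real.pi),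
      gaussianKernel (Complex.I * ((4 * Real.pi ^ 2 * t : ℝ) : ℂ)) (x - (rot θ).symm y)‖ ≤
      20 * √2 / (4 * Real.pi) * |t| ^ (-(1 / 2) : ℝ) := by
  obtain ⟨α, hα⟩ := exists_inner_rot_eq x y
  set b : ℂ := Complex.I * ((4 * Real.pi ^ 2 * t : ℝ) : ℂ) with hb
  set z : ℝ := -(‖x‖ * ‖y‖ / (2 * t)) with hz
  have htc : (t : ℂ) ≠ 0 := by exact_mod_cast ht
  have hpc : (Real.pi : ℂ) ≠ 0 := by exact_mod_cast Real.pi_ne_zero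
  have h1 : ∀ θ, gaussianKernel b (x - (rot θ).symm y) =
      (Real.pi / b * Complex.exp (Complex.I * (((‖x‖ ^ 2 + ‖y‖ ^ 2) / (4 * t) : ℝ) : ℂ))) *
        Complex.exp (Complex.I * ((z * Real.cos (θ + α) : ℝ) : ℂ)) := fun θ => by
    have h2 : ‖x - (rot θ).symm y‖ ^ 2 =
        ‖x‖ ^ 2 + ‖y‖ ^ 2 - 2 * (‖x‖ * ‖y‖ * Real.cos (θ + α)) := by
      rw [norm_sub_sq_real, ← hα θ, LinearIsometryEquiv.norm_map,
        ← (rot θ).inner_map_map x, LinearIsometryEquiv.apply_symm_apply]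
      ring
    rw [gaussianKernel, ← Complex.ofReal_pow ‖_‖ 2, h2, mul_assoc (_ / _), ← Complex.exp_add]
    congr 2
    simp only [hb, hz]
    push_cast
    field_simp
    rw [Complex.I_sq]
    ring
  simp_rw [h1]
  rw [intervalIntegral.integral_const_mul, norm_mul, norm_mul, norm_exp_I_mul_ofReal, mul_one]
  have h3 : ‖(Real.pi : ℂ) / b‖ = 1 / (4 * Real.pi * |t|) := by
    rw [hb, norm_div, norm_mul, Complex.norm_I, Complex.norm_real, Complex.norm_real, one_mul,
      Real.norm_eq_abs, Real.norm_eq_abs, abs_mul, abs_of_pos Real.pi_pos, abs_of_pos (by positivity)]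
    have := abs_pos.2 ht
    field_simp
  have h4 : √‖x‖ * √‖y‖ = √2 * √|t| * √|z| := by
    rw [← Real.sqrt_mul (norm_nonneg _), ← Real.sqrt_mul (by norm_num), ← Real.sqrt_mul (by positivity)]
    congr 1
    rw [hz, abs_neg, abs_div, abs_mul 2, abs_of_nonneg (by positivity : 0 ≤ ‖x‖ * ‖y‖)]
    have := abs_pos.2 ht
    rw [abs_of_pos (by norm_num : (0 : ℝ) < 2)]
    field_simp
  have h5 := sqrt_mul_norm_integral_exp_cos_le z α
  have h6 : √|t| / |t| = |t| ^ (-(1 / 2) : ℝ) := by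
    rw [Real.sqrt_div_self', Real.sqrt_eq_rpow, Real.rpow_neg (abs_nonneg t), one_div]
  rw [h3, h4]
  set J := ‖∫ θ in 0..(2 * Real.pi), Complex.exp (Complex.I * ((z * Real.cos (θ + α) : ℝ) : ℂ))‖
  calc _ = √2 / (4 * Real.pi) * (√|t| / |t|) * (√|z| * J) := by
        have := abs_pos.2 ht
        field_simp
    _ ≤ √2 / (4 * Real.pi) * (√|t| / |t|) * 20 := by gcongr
    _ = _ := by rw [h6]; ring

/-- The dispersive estimate for radial data, with the weight `|x|^{1/2}` on both sides. -/
theorem norm_integral_gaussianKernel_radialMean_le {ρ : Plane → ℝ} (hρ : Measurable ρ) {c R : ℝ}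
    (hc : ∀ x, |ρ x| ≤ c) (hR : ∀ x, R < ‖x‖ → ρ x = 0) {t : ℝ} (ht : t ≠ 0) (x : Plane) :
    √‖x‖ * ‖∫ y, gaussianKernel (Complex.I * ((4 * Real.pi ^ 2 * t : ℝ) : ℂ)) (x - y) *
      ((√‖y‖ * radialMean ρ y : ℝ) : ℂ)‖ ≤ |t| ^ (-(1 / 2) : ℝ) * ∫ y, |ρ y| := by
  set b : ℂ := Complex.I * ((4 * Real.pi ^ 2 * t : ℝ) : ℂ) with hb
  have hKc : Continuous fun y => gaussianKernel b (x - y) :=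
    (continuous_gaussianKernel b).comp (by fun_prop)
  have hi := integrable_sqrt_norm_mul hρ hc hR
  have hρi := integrable_of_bdd_of_supp hρ hc hR
  have hbre : 0 ≤ b.re := by rw [hb, mul_comm, Complex.re_ofReal_mul]; simp
  rw [integral_mul_radialMean hρ hc hR hKc.aestronglyMeasurable
    (hKc.continuousOn.integrableOn_compact (isCompact_closedBall _ _)),
    intervalIntegral.integral_of_le (by positivity)]
  have hi2 : Integrable (fun p : ℝ × Plane =>
      gaussianKernel b (x - (rot p.1).symm p.2) * ((√‖p.2‖ * ρ p.2 : ℝ) : ℂ))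
      ((volume.restrict (Set.Ioc 0 (2 * Real.pi))).prod volume) := by
    refine ((hi.ofReal (𝕜 := ℂ)).comp_snd
      (volume.restrict (Set.Ioc 0 (2 * Real.pi)))).bdd_mul (c := Real.pi / ‖b‖) ?_ ?_
    · exact ((continuous_gaussianKernel b).comp
        (continuous_const.sub continuous_rot_symm)).aestronglyMeasurable
    · exact Filter.Eventually.of_forall fun p => norm_gaussianKernel_le hbre _
  rw [integral_integral_swap (f := fun (θ : ℝ) (y : Plane) =>
    gaussianKernel b (x - (rot θ).symm y) * ((√‖y‖ * ρ y : ℝ) : ℂ)) hi2, norm_mul,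
    Complex.norm_real, Real.norm_of_nonneg (by positivity)]
  simp_rw [integral_mul_const, ← intervalIntegral.integral_of_le (show 0 ≤ 2 * Real.pi by positivity)]
  set J : Plane → ℂ := fun y => ∫ θ in 0..(2 * Real.pi), gaussianKernel b (x - (rot θ).symm y) with hJ
  have h20 : (2 * Real.pi)⁻¹ * (20 * √2 / (4 * Real.pi)) ≤ 1 := by
    have h2 : √2 ≤ 1.5 := by
      rw [Real.sqrt_le_left (by norm_num)]
      norm_num
    have h3 := Real.pi_gt_three
    rw [← div_eq_inv_mul, div_div, div_le_one (by positivity)]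
    nlinarith
  calc _ ≤ √‖x‖ * ((2 * Real.pi)⁻¹ * ∫ y, ‖J y * ((√‖y‖ * ρ y : ℝ) : ℂ)‖) := by
        gcongr; exact norm_integral_le_integral_norm _
    _ = (2 * Real.pi)⁻¹ * ∫ y, √‖x‖ * ‖J y * ((√‖y‖ * ρ y : ℝ) : ℂ)‖ := by
        rw [integral_const_mul]; ring
    _ ≤ (2 * Real.pi)⁻¹ * ∫ y, 20 * √2 / (4 * Real.pi) * |t| ^ (-(1 / 2) : ℝ) * |ρ y| := by
        refine mul_le_mul_of_nonneg_left ?_ (by positivity)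
        refine integral_mono_of_nonneg ?_ (hρi.abs.const_mul _)
          (Filter.Eventually.of_forall fun y => ?_)
        · exact Filter.Eventually.of_forall fun y => mul_nonneg (Real.sqrt_nonneg _) (norm_nonneg _)
        simp only
        rw [norm_mul, Complex.norm_real, norm_mul, Real.norm_of_nonneg (Real.sqrt_nonneg _),
          Real.norm_eq_abs]
        calc _ = √‖x‖ * √‖y‖ * ‖J y‖ * |ρ y| := by ring
          _ ≤ _ := mul_le_mul_of_nonneg_right (norm_integral_kernel_rot_le ht x y) (abs_nonneg _)
    _ = (2 * Real.pi)⁻¹ * (20 * √2 / (4 * Real.pi)) * (|t| ^ (-(1 / 2) : ℝ) * ∫ y, |ρ y|) := by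
        rw [integral_const_mul]; ring
    _ ≤ _ := mul_le_of_le_one_left (mul_nonneg (by positivity) (integral_nonneg fun y => abs_nonneg _)) h20

/-! ### The propagator on L² -/

/-- Square integrable functions on the plane. -/
abbrev L2 : Type := Lp ℂ 2 (volume : Measure Plane)

theorem norm_schrodingerSymbol (t : ℝ) (ξ : Plane) : ‖schrodingerSymbol t ξ‖ = 1 := by
  rw [schrodingerSymbol, ← mul_neg, ← Complex.ofReal_neg, norm_exp_I_mul_ofReal]

theorem continuous_schrodingerSymbol : Continuous fun p : ℝ × Plane => schrodingerSymbol p.1 p.2 := by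
  unfold schrodingerSymbol
  fun_prop

theorem schrodingerSymbol_add (s t : ℝ) (ξ : Plane) :
    schrodingerSymbol (s + t) ξ = schrodingerSymbol s ξ * schrodingerSymbol t ξ := by
  rw [schrodingerSymbol, schrodingerSymbol, schrodingerSymbol, ← Complex.exp_add]
  congr 1
  push_cast
  ring

theorem schrodingerSymbol_zero (ξ : Plane) : schrodingerSymbol 0 ξ = 1 := by
  simp [schrodingerSymbol]

theorem conj_schrodingerSymbol (t : ℝ) (ξ : Plane) :
    starRingEnd ℂ (schrodingerSymbol t ξ) = schrodingerSymbol (-t) ξ := by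
  rw [schrodingerSymbol, schrodingerSymbol, ← Complex.exp_conj]
  congr 1
  simp only [map_neg, map_mul, Complex.conj_I, Complex.conj_ofReal]
  push_cast
  ring

theorem memLp_schrodingerSymbol (t : ℝ) :
    MemLp (schrodingerSymbol t) ∞ (volume : Measure Plane) :=
  memLp_top_of_bound (continuous_schrodingerSymbol.comp
    (by fun_prop : Continuous fun ξ : Plane => (t, ξ))).aestronglyMeasurable 1
    (Filter.Eventually.of_forall fun ξ => (norm_schrodingerSymbol t ξ).le)

/-- The free Schrödinger propagator on `L²`. -/
def propagatorL2 (t : ℝ) (g : L2) : L2 :=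
  𝓕⁻ ((memLp_schrodingerSymbol t).toLp _ • 𝓕 g : L2)

theorem toTemperedDistribution_injective {g h : L2}
    (H : ∀ φ : 𝓢(Plane, ℂ), Lp.toTemperedDistribution g φ = Lp.toTemperedDistribution h φ) :
    g = h := by
  have hker := Lp.ker_toTemperedDistributionCLM_eq_bot (F := ℂ) (μ := (volume : Measure Plane)) (p := 2)
  have := LinearMap.ker_eq_bot.1 hker
  refine this ?_
  ext φ
  exact H φ

/-- This identifies the Plancherel definition with the distributional propagator of the theorem. It
depends on the symbol having temperate growth. -/
theorem toTemperedDistribution_propagatorL2 (t : ℝ) (g : L2) :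
    Lp.toTemperedDistribution (propagatorL2 t g) = propagator t (Lp.toTemperedDistribution g) := by
  rw [propagatorL2, ← Lp.fourierInv_toTemperedDistribution_eq,
    Lp.toTemperedDistribution_smul_eq (schrodingerSymbol_hasTemperateGrowth t),
    ← Lp.fourier_toTemperedDistribution_eq]
  rfl

theorem fourier_propagatorL2 (t : ℝ) (g : L2) :
    (𝓕 (propagatorL2 t g) : L2) =ᵐ[volume] fun ξ => schrodingerSymbol t ξ * (𝓕 g : L2) ξ := by
  rw [propagatorL2, fourier_fourierInv_eq]
  filter_upwards [Lp.coeFn_lpSMul (r := 2) ((memLp_schrodingerSymbol t).toLp _) (𝓕 g : L2),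
    (memLp_schrodingerSymbol t).coeFn_toLp] with ξ h1 h2
  rw [h1, Pi.smul_apply', h2, smul_eq_mul]

theorem inner_propagatorL2 (t : ℝ) (g h : L2) :
    inner ℂ h (propagatorL2 t g) =
      ∫ ξ, schrodingerSymbol t ξ * ((𝓕 g : L2) ξ * starRingEnd ℂ ((𝓕 h : L2) ξ)) := by
  rw [← Lp.inner_fourier_eq, L2.inner_def]
  refine integral_congr_ae ?_
  filter_upwards [fourier_propagatorL2 t g] with ξ h1
  rw [h1, RCLike.inner_apply]
  ring

theorem norm_propagatorL2 (t : ℝ) (g : L2) : ‖propagatorL2 t g‖ = ‖g‖ := by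
  rw [← Lp.norm_fourier_eq, ← Lp.norm_fourier_eq g, Lp.norm_def, Lp.norm_def]
  congr 1
  refine eLpNorm_congr_norm_ae ?_
  filter_upwards [fourier_propagatorL2 t g] with ξ h1
  rw [h1, norm_mul, norm_schrodingerSymbol, one_mul]

theorem propagatorL2_add (t : ℝ) (g h : L2) :
    propagatorL2 t (g + h) = propagatorL2 t g + propagatorL2 t h := by
  have : (𝓕 (propagatorL2 t (g + h)) : L2) = 𝓕 (propagatorL2 t g + propagatorL2 t h) := by
    rw [FourierTransform.fourier_add]
    ext1
    have h4 : (𝓕 (g + h) : L2) = 𝓕 g + 𝓕 h := FourierTransform.fourier_add g h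
    filter_upwards [fourier_propagatorL2 t g, fourier_propagatorL2 t h,
      fourier_propagatorL2 t (g + h), Lp.coeFn_add (𝓕 (propagatorL2 t g) : L2)
      (𝓕 (propagatorL2 t h) : L2), Lp.coeFn_add (𝓕 g : L2) (𝓕 h : L2)] with ξ h1 h2 h3 h5 h6
    rw [h3, h4, h6, h5, Pi.add_apply, Pi.add_apply, h1, h2]
    ring
  exact (Lp.fourierTransformₗᵢ Plane ℂ).injective this

theorem propagatorL2_smul (t : ℝ) (c : ℂ) (g : L2) :
    propagatorL2 t (c • g) = c • propagatorL2 t g := by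
  have : (𝓕 (propagatorL2 t (c • g)) : L2) = 𝓕 (c • propagatorL2 t g) := by
    rw [FourierTransform.fourier_smul]
    ext1
    have h4 : (𝓕 (c • g) : L2) = c • 𝓕 g := FourierTransform.fourier_smul c g
    filter_upwards [fourier_propagatorL2 t g, fourier_propagatorL2 t (c • g),
      Lp.coeFn_smul c (𝓕 (propagatorL2 t g) : L2), Lp.coeFn_smul c (𝓕 g : L2)] with ξ h1 h2 h3 h5
    rw [h2, h3, h4, h5, Pi.smul_apply, Pi.smul_apply, h1, smul_eq_mul, smul_eq_mul]
    ring
  exact (Lp.fourierTransformₗᵢ Plane ℂ).injective this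

theorem propagatorL2_sub (t : ℝ) (g h : L2) :
    propagatorL2 t (g - h) = propagatorL2 t g - propagatorL2 t h := by
  rw [sub_eq_add_neg, ← neg_one_smul ℂ h, propagatorL2_add, propagatorL2_smul, neg_one_smul,
    ← sub_eq_add_neg]

theorem propagatorL2_propagatorL2 (s t : ℝ) (g : L2) :
    propagatorL2 s (propagatorL2 t g) = propagatorL2 (s + t) g := by
  have : (𝓕 (propagatorL2 s (propagatorL2 t g)) : L2) = 𝓕 (propagatorL2 (s + t) g) := by
    ext1
    filter_upwards [fourier_propagatorL2 s (propagatorL2 t g), fourier_propagatorL2 t g,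
      fourier_propagatorL2 (s + t) g] with ξ h1 h2 h3
    rw [h1, h2, h3, schrodingerSymbol_add, mul_assoc]
  exact (Lp.fourierTransformₗᵢ Plane ℂ).injective this

theorem propagatorL2_zero (g : L2) : propagatorL2 0 g = g := by
  have : (𝓕 (propagatorL2 0 g) : L2) = 𝓕 g := by
    ext1
    filter_upwards [fourier_propagatorL2 0 g] with ξ h1
    rw [h1, schrodingerSymbol_zero, one_mul]
  exact (Lp.fourierTransformₗᵢ Plane ℂ).injective this

theorem inner_propagatorL2_left (t : ℝ) (g h : L2) :
    inner ℂ (propagatorL2 t h) g = inner ℂ h (propagatorL2 (-t) g) := by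
  rw [← inner_conj_symm, inner_propagatorL2, inner_propagatorL2, ← integral_conj]
  refine integral_congr_ae (Filter.Eventually.of_forall fun ξ => ?_)
  simp only [map_mul, conj_schrodingerSymbol, Complex.conj_conj]
  ring

theorem integrable_mul_conj (g h : L2) : Integrable fun ξ => g ξ * starRingEnd ℂ (h ξ) := by
  have := L2.integrable_inner (𝕜 := ℂ) h g
  refine this.congr (Filter.Eventually.of_forall fun ξ => ?_)
  simp only [RCLike.inner_apply]

theorem continuous_inner_propagatorL2 (g h : L2) :
    Continuous fun t => inner ℂ h (propagatorL2 t g) := by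
  simp_rw [inner_propagatorL2]
  have hi := integrable_mul_conj (𝓕 g : L2) (𝓕 h : L2)
  have hc := continuous_schrodingerSymbol
  refine continuous_of_dominated (fun t => ?_) (fun t => ?_) hi.norm ?_
  · exact (hc.comp (by fun_prop : Continuous fun ξ : Plane => (t, ξ))).aestronglyMeasurable.mul
      hi.aestronglyMeasurable
  · exact Filter.Eventually.of_forall fun ξ => by rw [norm_mul, norm_schrodingerSymbol, one_mul]
  · exact Filter.Eventually.of_forall fun ξ =>
      (hc.comp (by fun_prop : Continuous fun t : ℝ => (t, ξ))).mul continuous_const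

/-- Weak continuity and constancy of the norm give strong continuity, by expanding the square of the
difference. -/
theorem continuous_propagatorL2 (g : L2) : Continuous fun t => propagatorL2 t g := by
  rw [continuous_iff_continuousAt]
  intro s
  rw [ContinuousAt, tendsto_iff_norm_sub_tendsto_zero]
  have h1 : ∀ t, ‖propagatorL2 t g - propagatorL2 s g‖ ^ 2 =
      2 * ‖g‖ ^ 2 - 2 * (inner ℂ g (propagatorL2 (s - t) g)).re := fun t => by
    rw [@norm_sub_sq ℂ, norm_propagatorL2, norm_propagatorL2, inner_propagatorL2_left,
      propagatorL2_propagatorL2, neg_add_eq_sub]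
    simp only [RCLike.re_to_complex]
    ring
  have h2 : Filter.Tendsto (fun t => ‖propagatorL2 t g - propagatorL2 s g‖ ^ 2) (nhds s) (nhds 0) := by
    simp_rw [h1]
    have hc : Continuous fun t => 2 * ‖g‖ ^ 2 - 2 * (inner ℂ g (propagatorL2 (s - t) g)).re :=
      continuous_const.sub (continuous_const.mul (Complex.continuous_re.comp
        ((continuous_inner_propagatorL2 g g).comp (by fun_prop))))
    have := hc.tendsto s
    simp only [sub_self, propagatorL2_zero] at this
    rw [inner_self_eq_norm_sq_to_K] at this
    convert this using 2
    rw [RCLike.ofReal_eq_complex_ofReal, ← Complex.ofReal_pow, Complex.ofReal_re, sub_self]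
  have := h2.sqrt
  simpa using this

/-- On `L¹ ∩ L²`, the Fourier transform is given by the Fourier integral. -/
theorem fourier_toLp_ae_eq {g : Plane → ℂ} (h1 : Integrable g) (h2 : MemLp g 2) :
    (𝓕 (h2.toLp g) : L2) =ᵐ[volume] 𝓕 g := by
  have hc : Continuous (𝓕 g) := VectorFourier.fourierIntegral_continuous
    Real.continuous_fourierChar (L := innerₗ Plane) continuous_inner h1
  refine ae_eq_of_integral_contDiff_smul_eq ((Lp.memLp _).locallyIntegrable (by norm_num))
    hc.locallyIntegrable fun χ hχ hχc => ?_
  have hχ₁ : HasCompactSupport (Complex.ofRealCLM ∘ χ) := hχc.comp_left rfl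
  have hχ₂ : ContDiff ℝ (⊤ : ℕ∞) (Complex.ofRealCLM ∘ χ) := Complex.ofRealCLM.contDiff.comp hχ
  set X : 𝓢(Plane, ℂ) := hχ₁.toSchwartzMap hχ₂ with hX
  have hXa : ∀ ξ, X ξ = (χ ξ : ℂ) := fun ξ => rfl
  have e1 : Lp.toTemperedDistribution (𝓕 (h2.toLp g) : L2) X =
      Lp.toTemperedDistribution (h2.toLp g) (𝓕 X) := by
    rw [← Lp.fourier_toTemperedDistribution_eq]
    rfl
  rw [Lp.toTemperedDistribution_apply, Lp.toTemperedDistribution_apply] at e1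
  have e2 : ∫ ξ, (𝓕 X) ξ • (h2.toLp g) ξ = ∫ ξ, (𝓕 (X : Plane → ℂ)) ξ • g ξ := by
    refine integral_congr_ae ?_
    filter_upwards [h2.coeFn_toLp] with ξ hξ
    rw [hξ, SchwartzMap.fourier_coe]
  have e3 : ∫ ξ, (𝓕 (X : Plane → ℂ)) ξ • g ξ = ∫ ξ, X ξ • 𝓕 g ξ := by
    have := VectorFourier.integral_fourierIntegral_smul_eq_flip (L := innerₗ Plane)
      (μ := volume) (ν := volume) Real.continuous_fourierChar continuous_inner X.integrable h1
    rw [flip_innerₗ] at this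
    exact this
  simp only [hXa, Complex.coe_smul] at e1 e3
  rw [e1, e2, e3]

/-! ### Pairings of weighted radial averages -/

theorem measurable_rot_swap : Measurable fun p : Plane × ℝ => rot p.2 p.1 :=
  (Continuous.comp (g := fun p : ℝ × Plane => rot p.1 p.2) (f := fun p : Plane × ℝ => (p.2, p.1))
    continuous_rot (by fun_prop)).measurable

theorem measurable_radialMean {ρ : Plane → ℝ} (hρ : Measurable ρ) : Measurable (radialMean ρ) := by
  have h1 : StronglyMeasurable fun p : Plane × ℝ => ρ (rot p.2 p.1) :=
    (hρ.comp measurable_rot_swap).stronglyMeasurable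
  have h2 := (h1.integral_prod_right' (ν := volume.restrict (Set.Ioc 0 (2 * Real.pi)))).measurable
  unfold radialMean
  simp_rw [intervalIntegral.integral_of_le (show 0 ≤ 2 * Real.pi by positivity)]
  exact h2.const_mul _

theorem abs_radialMean_le {ρ : Plane → ℝ} {c : ℝ} (hc : ∀ x, |ρ x| ≤ c) (x : Plane) :
    |radialMean ρ x| ≤ c := by
  rw [radialMean, abs_mul, abs_of_pos (by positivity), inv_mul_le_iff₀ (by positivity)]
  have := intervalIntegral.norm_integral_le_of_norm_le_const (a := 0) (b := 2 * Real.pi)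
    (f := fun θ => ρ (rot θ x)) (C := c) fun θ _ => hc _
  rw [sub_zero, abs_of_pos (by positivity)] at this
  rwa [mul_comm _ c]

theorem radialMean_eq_zero {ρ : Plane → ℝ} {R : ℝ} (hR : ∀ x, R < ‖x‖ → ρ x = 0) (x : Plane)
    (hx : R < ‖x‖) : radialMean ρ x = 0 := by
  have : ∀ θ, ρ (rot θ x) = 0 := fun θ => hR _ (by rwa [LinearIsometryEquiv.norm_map])
  simp [radialMean, this]

theorem lintegral_radialMean_le {ρ : Plane → ℝ} (hρ : Measurable ρ) :
    ∫⁻ x, ‖radialMean ρ x‖ₑ ≤ ∫⁻ x, ‖ρ x‖ₑ := by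
  have hm : Measurable fun p : Plane × ℝ => ‖ρ (rot p.2 p.1)‖ₑ :=
    (hρ.comp measurable_rot_swap).enorm
  have h2 : ENNReal.ofReal (2 * Real.pi)⁻¹ * ENNReal.ofReal (2 * Real.pi) = 1 := by
    rw [← ENNReal.ofReal_mul (by positivity), inv_mul_cancel₀ (by positivity), ENNReal.ofReal_one]
  calc ∫⁻ x, ‖radialMean ρ x‖ₑ
      ≤ ∫⁻ x, ENNReal.ofReal (2 * Real.pi)⁻¹ *
          ∫⁻ θ in Set.Ioc 0 (2 * Real.pi), ‖ρ (rot θ x)‖ₑ := by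
        refine lintegral_mono fun x => ?_
        rw [radialMean, enorm_mul, Real.enorm_of_nonneg (by positivity),
          intervalIntegral.integral_of_le (by positivity)]
        gcongr
        exact enorm_integral_le_lintegral_enorm _
    _ = ENNReal.ofReal (2 * Real.pi)⁻¹ *
          ∫⁻ θ in Set.Ioc 0 (2 * Real.pi), ∫⁻ x, ‖ρ (rot θ x)‖ₑ := by
        rw [lintegral_const_mul _ hm.lintegral_prod_right', lintegral_lintegral_swap]
        exact hm.aemeasurable
    _ = ENNReal.ofReal (2 * Real.pi)⁻¹ *
          ∫⁻ θ in Set.Ioc 0 (2 * Real.pi), ∫⁻ x, ‖ρ x‖ₑ := by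
        congr 2
        ext θ
        exact (rot θ).measurePreserving.lintegral_comp hρ.enorm
    _ = ∫⁻ x, ‖ρ x‖ₑ := by
        rw [setLIntegral_const, Real.volume_Ioc, sub_zero, mul_comm (∫⁻ x, ‖ρ x‖ₑ), ← mul_assoc, h2,
          one_mul]

theorem memLp_sqrt_norm_mul {ρ : Plane → ℝ} (hρ : Measurable ρ) {c R : ℝ}
    (hc : ∀ x, |ρ x| ≤ c) (hR : ∀ x, R < ‖x‖ → ρ x = 0) :
    MemLp (fun y => ((√‖y‖ * ρ y : ℝ) : ℂ)) 2 := by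
  have hs : Measurable fun y : Plane => √‖y‖ := by fun_prop
  have hm : Measurable fun y => ((√‖y‖ * ρ y : ℝ) : ℂ) :=
    Complex.measurable_ofReal.comp (hs.mul hρ)
  rw [memLp_two_iff_integrable_sq_norm hm.aestronglyMeasurable]
  have := integrable_sqrt_norm_mul (ρ := fun y => √‖y‖ * ρ y ^ 2) (hs.mul (hρ.pow_const 2))
    (c := √R * c ^ 2) (R := R) (fun x => ?_) (fun x hx => by rw [hR x hx]; simp)
  · refine this.congr (Filter.Eventually.of_forall fun y => ?_)
    simp only [Complex.norm_real, Real.norm_eq_abs, sq_abs]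
    ring
  · rw [abs_mul, abs_of_nonneg (Real.sqrt_nonneg _), abs_of_nonneg (sq_nonneg _)]
    by_cases hp : ‖x‖ ≤ R
    · have : ρ x ^ 2 ≤ c ^ 2 := sq_le_sq' (neg_le_of_abs_le (hc x)) (le_of_abs_le (hc x))
      gcongr
    · rw [hR x (not_le.1 hp)]
      simp only [ne_eq, OfNat.ofNat_ne_zero, not_false_eq_true, zero_pow, mul_zero]
      positivity

/-- The bilinear dispersive estimate between radially averaged weighted densities. -/
theorem enorm_inner_propagatorL2_radialMean_le {ρ σ : Plane → ℝ} (hρ : Measurable ρ)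
    (hσ : Measurable σ) {c d R S : ℝ} (hc : ∀ x, |ρ x| ≤ c) (hR : ∀ x, R < ‖x‖ → ρ x = 0)
    (hd : ∀ x, |σ x| ≤ d) (hS : ∀ x, S < ‖x‖ → σ x = 0)
    (hρ1 : ∫⁻ x, ‖ρ x‖ₑ ≤ 1) (hσ1 : ∫⁻ x, ‖σ x‖ₑ ≤ 1)
    (h2ρ : MemLp (fun y => ((√‖y‖ * radialMean ρ y : ℝ) : ℂ)) 2)
    (h2σ : MemLp (fun y => ((√‖y‖ * radialMean σ y : ℝ) : ℂ)) 2) {t : ℝ} (ht : t ≠ 0) :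
    ‖inner ℂ (h2ρ.toLp _) (propagatorL2 t (h2σ.toLp _))‖ₑ ≤ rieszKernel t := by
  set φ : Plane → ℂ := fun y => ((√‖y‖ * radialMean ρ y : ℝ) : ℂ) with hφ
  set ψ : Plane → ℂ := fun y => ((√‖y‖ * radialMean σ y : ℝ) : ℂ) with hψ
  have hφi : Integrable φ := (integrable_sqrt_norm_mul (measurable_radialMean hρ)
    (abs_radialMean_le hc) (radialMean_eq_zero hR)).ofReal
  have hψi : Integrable ψ := (integrable_sqrt_norm_mul (measurable_radialMean hσ)
    (abs_radialMean_le hd) (radialMean_eq_zero hS)).ofReal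
  have hρi := integrable_of_bdd_of_supp (measurable_radialMean hρ)
    (abs_radialMean_le hc) (radialMean_eq_zero hR)
  have e1 := fourier_toLp_ae_eq hφi h2ρ
  have e2 := fourier_toLp_ae_eq hψi h2σ
  have hint : Integrable fun ξ => 𝓕 ψ ξ * starRingEnd ℂ (𝓕 φ ξ) := by
    refine (integrable_mul_conj (𝓕 (h2σ.toLp ψ) : L2) (𝓕 (h2ρ.toLp φ) : L2)).congr ?_
    filter_upwards [e1, e2] with ξ h1 h2
    rw [h1, h2]
  set b : ℂ := Complex.I * ((4 * Real.pi ^ 2 * t : ℝ) : ℂ) with hb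
  have hbre : 0 ≤ b.re := by rw [hb, mul_comm, Complex.re_ofReal_mul]; simp
  -- Being both integrable and square integrable, the test functions allow the inner product to be
  -- written with the explicit kernel. The dispersive estimate then bounds the inner integral, and
  -- its weight √|x| is the one carried by φ.
  have h3 : inner ℂ (h2ρ.toLp φ) (propagatorL2 t (h2σ.toLp ψ)) =
      ∫ x, φ x * ∫ y, gaussianKernel b (x - y) * ψ y := by
    rw [inner_propagatorL2]
    have : ∫ ξ, schrodingerSymbol t ξ * ((𝓕 (h2σ.toLp ψ) : L2) ξ *
        starRingEnd ℂ ((𝓕 (h2ρ.toLp φ) : L2) ξ)) =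
        ∫ ξ, schrodingerSymbol t ξ * (𝓕 ψ ξ * starRingEnd ℂ (𝓕 φ ξ)) := by
      refine integral_congr_ae ?_
      filter_upwards [e1, e2] with ξ h1 h2
      rw [h1, h2]
    rw [this, integral_schrodingerSymbol_mul_fourier_eq hψi hφi hint ht]
    have hcφ : ∀ x, starRingEnd ℂ (φ x) = φ x := fun x => Complex.conj_ofReal _
    simp_rw [hcφ]
    have hpi : Integrable (fun z : Plane × Plane =>
        gaussianKernel b (z.1 - z.2) * (φ z.1 * ψ z.2)) := by
      refine (hφi.mul_prod hψi).bdd_mul (c := Real.pi / ‖b‖) ?_ ?_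
      · exact ((continuous_gaussianKernel b).comp
          (continuous_fst.sub continuous_snd)).aestronglyMeasurable
      · exact Filter.Eventually.of_forall fun p => norm_gaussianKernel_le hbre _
    rw [Measure.volume_eq_prod, integral_prod _ hpi]
    refine integral_congr_ae (Filter.Eventually.of_forall fun x => ?_)
    simp only
    rw [← integral_const_mul]
    refine integral_congr_ae (Filter.Eventually.of_forall fun y => ?_)
    simp only
    ring
  have hσ2 : ∫ y, |σ y| ≤ 1 := by
    have hσi := integrable_of_bdd_of_supp hσ hd hS
    have := ofReal_integral_norm_eq_lintegral_enorm hσi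
    rw [← this, ENNReal.ofReal_le_one] at hσ1
    exact hσ1
  have hρ2 : ∫ y, |radialMean ρ y| ≤ 1 := by
    have := ofReal_integral_norm_eq_lintegral_enorm hρi
    have h := (lintegral_radialMean_le hρ).trans hρ1
    rw [← this, ENNReal.ofReal_le_one] at h
    exact h
  rw [h3, rieszKernel, ← ofReal_norm]
  refine ENNReal.ofReal_le_ofReal ?_
  calc _ ≤ ∫ x, ‖φ x * ∫ y, gaussianKernel b (x - y) * ψ y‖ := norm_integral_le_integral_norm _
    _ ≤ ∫ x, |t| ^ (-(1 / 2) : ℝ) * |radialMean ρ x| := by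
        refine integral_mono_of_nonneg (Filter.Eventually.of_forall fun x => norm_nonneg _)
          (hρi.abs.const_mul _) (Filter.Eventually.of_forall fun x => ?_)
        have h4 := norm_integral_gaussianKernel_radialMean_le hσ hd hS ht x
        simp only
        rw [norm_mul, Complex.norm_real, norm_mul, Real.norm_of_nonneg (Real.sqrt_nonneg _),
          Real.norm_eq_abs, mul_right_comm]
        refine mul_le_mul_of_nonneg_right (h4.trans ?_) (abs_nonneg _)
        exact mul_le_of_le_one_right (by positivity) hσ2
    _ ≤ _ := by
        rw [integral_const_mul]
        exact mul_le_of_le_one_right (by positivity) hρ2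

/-! ### The weighted sup norm as a countable supremum -/

/-- The center of the `n`-th ball of a countable family of small balls. -/
def ballCenter (n : ℕ) : Plane := TopologicalSpace.denseSeq Plane n.unpair.1

/-- The radius of the `n`-th ball of a countable family of small balls. -/
def ballRadius (n : ℕ) : ℝ := 1 / ((n.unpair.2 : ℝ) + 1)

/-- The normalized indicator function of the `n`-th ball. -/
def ballDensity (n : ℕ) : Plane → ℝ :=
  (Metric.closedBall (ballCenter n) (ballRadius n)).indicator
    fun _ => (volume.real (Metric.closedBall (ballCenter n) (ballRadius n)))⁻¹

theorem ballRadius_pos (n : ℕ) : 0 < ballRadius n := by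
  unfold ballRadius
  positivity

theorem measurable_ballDensity (n : ℕ) : Measurable (ballDensity n) :=
  measurable_const.indicator Metric.isClosed_closedBall.measurableSet

theorem abs_ballDensity_le (n : ℕ) (x : Plane) :
    |ballDensity n x| ≤ (volume.real (Metric.closedBall (ballCenter n) (ballRadius n)))⁻¹ := by
  have := norm_indicator_le_norm_self (s := Metric.closedBall (ballCenter n) (ballRadius n))
    (f := fun _ => (volume.real (Metric.closedBall (ballCenter n) (ballRadius n)))⁻¹) (a := x)
  rwa [Real.norm_of_nonneg (inv_nonneg.2 measureReal_nonneg)] at this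

theorem ballDensity_eq_zero (n : ℕ) (x : Plane) (hx : ‖ballCenter n‖ + ballRadius n < ‖x‖) :
    ballDensity n x = 0 := by
  refine Set.indicator_of_notMem (fun h => ?_) _
  rw [mem_closedBall_iff_norm] at h
  have := norm_sub_norm_le x (ballCenter n)
  linarith

theorem lintegral_ballDensity (n : ℕ) : ∫⁻ x, ‖ballDensity n x‖ₑ = 1 := by
  have h0 := (Metric.measure_closedBall_pos volume (ballCenter n) (ballRadius_pos n)).ne'
  have h1 : volume (Metric.closedBall (ballCenter n) (ballRadius n)) ≠ ∞ :=
    measure_closedBall_lt_top.ne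
  simp_rw [ballDensity, enorm_indicator_eq_indicator_enorm]
  rw [lintegral_indicator Metric.isClosed_closedBall.measurableSet, setLIntegral_const,
    Real.enorm_of_nonneg (by positivity), Measure.real, ENNReal.ofReal_inv_of_pos
      (ENNReal.toReal_pos h0 h1), ENNReal.ofReal_toReal h1, ENNReal.inv_mul_cancel h0 h1]

theorem integral_mul_ballDensity (w : Plane → ℂ) (n : ℕ) :
    ∫ y, w y * (ballDensity n y : ℂ) = ⨍ y in Metric.closedBall (ballCenter n) (ballRadius n), w y := by
  rw [setAverage_eq, ← integral_indicator Metric.isClosed_closedBall.measurableSet, ← integral_smul]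
  refine integral_congr_ae (Filter.Eventually.of_forall fun y => ?_)
  simp only [ballDensity]
  by_cases h : y ∈ Metric.closedBall (ballCenter n) (ballRadius n)
  · rw [Set.indicator_of_mem h, Set.indicator_of_mem h, Complex.real_smul, mul_comm]
  · rw [Set.indicator_of_notMem h, Set.indicator_of_notMem h]
    simp

/-- Averages never exceed the essential supremum. Conversely, almost every point is the limit of
averages over balls that contain it, without being centred at it, so centres from a dense sequence
and radii 1/(j+1) suffice. -/
theorem eLpNorm_top_eq_iSup_ballDensity {w : Plane → ℂ} (hw : LocallyIntegrable w) :
    eLpNorm w ⊤ volume = ⨆ n, ‖∫ y, w y * (ballDensity n y : ℂ)‖ₑ := by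
  refine le_antisymm ?_ (iSup_le fun n => ?_)
  · rw [eLpNorm_exponent_top]
    refine eLpNormEssSup_le_of_ae_enorm_bound ?_
    filter_upwards [IsUnifLocDoublingMeasure.ae_tendsto_average volume hw 1] with x hx
    have hk : ∀ j : ℕ, ∃ k, dist x (TopologicalSpace.denseSeq Plane k) < 1 / ((j : ℝ) + 1) := fun j =>
      (TopologicalSpace.denseRange_denseSeq Plane).exists_dist_lt x (by positivity)
    choose k hk using hk
    have := hx (l := Filter.atTop) (fun j : ℕ => ballCenter (Nat.pair (k j) j))
      (fun j => ballRadius (Nat.pair (k j) j)) ?_ ?_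
    · refine le_of_tendsto this.enorm (Filter.Eventually.of_forall fun j => ?_)
      rw [← integral_mul_ballDensity]
      exact le_iSup (fun n => ‖∫ y, w y * (ballDensity n y : ℂ)‖ₑ) _
    · refine tendsto_nhdsWithin_iff.2 ⟨?_, Filter.Eventually.of_forall fun j => ballRadius_pos _⟩
      simp only [ballRadius, Nat.unpair_pair]
      exact tendsto_one_div_add_atTop_nhds_zero_nat
    · refine Filter.Eventually.of_forall fun j => ?_
      simp only [ballRadius, ballCenter, Nat.unpair_pair, one_mul, Metric.mem_closedBall]
      exact (hk j).le
  · calc ‖∫ y, w y * (ballDensity n y : ℂ)‖ₑ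
        ≤ ∫⁻ y, ‖w y * (ballDensity n y : ℂ)‖ₑ := enorm_integral_le_lintegral_enorm _
      _ ≤ ∫⁻ y, eLpNorm w ⊤ volume * ‖ballDensity n y‖ₑ := by
          refine lintegral_mono_ae ?_
          rw [eLpNorm_exponent_top]
          filter_upwards [enorm_ae_le_eLpNormEssSup w volume] with y hy
          rw [enorm_mul, ← ofReal_norm (ballDensity n y : ℂ), Complex.norm_real, ofReal_norm]
          gcongr
      _ = eLpNorm w ⊤ volume := by
          rw [lintegral_const_mul _ (measurable_ballDensity n).enorm, lintegral_ballDensity, mul_one]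

/-- Invariance of a function, defined up to null sets, under all rotations. -/
def IsRotInvariant (g : Plane → ℂ) : Prop :=
  ∀ θ, (fun x => g ((rot θ).symm x)) =ᵐ[volume] g

theorem IsRadial.isRotInvariant {g : Plane → ℂ} (hg : IsRadial g) : IsRotInvariant g := by
  obtain ⟨h, hh⟩ := hg
  intro θ
  have h1 := (rot θ).symm.measurePreserving.quasiMeasurePreserving.ae_eq_comp hh
  filter_upwards [h1, hh] with x h2 h3
  simp only [Function.comp_apply, LinearIsometryEquiv.norm_map] at h2
  rw [h2, h3]

theorem memLp_radialMean_ballDensity (n : ℕ) :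
    MemLp (fun y => ((√‖y‖ * radialMean (ballDensity n) y : ℝ) : ℂ)) 2 :=
  memLp_sqrt_norm_mul (measurable_radialMean (measurable_ballDensity n))
    (abs_radialMean_le (abs_ballDensity_le n)) (radialMean_eq_zero (ballDensity_eq_zero n))

/-- The radial averages of the weighted normalized indicator functions of small balls. -/
def testL2 (n : ℕ) : L2 := (memLp_radialMean_ballDensity n).toLp _

theorem enorm_inner_testL2_propagatorL2_le (m n : ℕ) {t : ℝ} (ht : t ≠ 0) :
    ‖inner ℂ (testL2 m) (propagatorL2 t (testL2 n))‖ₑ ≤ rieszKernel t :=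
  enorm_inner_propagatorL2_radialMean_le (measurable_ballDensity m) (measurable_ballDensity n)
    (abs_ballDensity_le m) (ballDensity_eq_zero m) (abs_ballDensity_le n) (ballDensity_eq_zero n)
    (lintegral_ballDensity m).le (lintegral_ballDensity n).le _ _ ht

/-- The weighted supremum norm of a rotation invariant function in `L²` is a countable supremum of
inner products. -/
theorem eLpNorm_top_sqrt_norm_mul_eq {g : L2} (hg : IsRotInvariant g) :
    eLpNorm (fun x => ((√‖x‖ : ℝ) : ℂ) * g x) ⊤ volume = ⨆ n, ‖inner ℂ (testL2 n) g‖ₑ := by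
  have hgl : LocallyIntegrable g volume := (Lp.memLp g).locallyIntegrable (by norm_num)
  have hw : LocallyIntegrable (fun x => ((√‖x‖ : ℝ) : ℂ) * g x) := by
    rw [← locallyIntegrableOn_univ] at hgl ⊢
    exact hgl.continuousOn_mul (by fun_prop) isOpen_univ.isLocallyClosed
  rw [eLpNorm_top_eq_iSup_ballDensity hw]
  congr 1
  ext n
  congr 1
  -- Moving the average onto g changes nothing, since g is rotation invariant. The radial test
  -- function therefore sees the same value as the ball itself.
  have h1 := integral_mul_radialMean (measurable_ballDensity n) (abs_ballDensity_le n)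
    (ballDensity_eq_zero n) (Lp.aestronglyMeasurable g)
    (hgl.integrableOn_isCompact (isCompact_closedBall _ _))
  have h2 : inner ℂ (testL2 n) g = ∫ y, g y * ((√‖y‖ * radialMean (ballDensity n) y : ℝ) : ℂ) := by
    rw [L2.inner_def]
    refine integral_congr_ae ?_
    filter_upwards [(memLp_radialMean_ballDensity n).coeFn_toLp] with y hy
    rw [testL2, hy, RCLike.inner_apply, Complex.conj_ofReal]
  have h3 : ∀ θ, ∫ y, g ((rot θ).symm y) * ((√‖y‖ * ballDensity n y : ℝ) : ℂ) =
      ∫ y, ((√‖y‖ : ℝ) : ℂ) * g y * (ballDensity n y : ℂ) := fun θ => by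
    refine integral_congr_ae ?_
    filter_upwards [hg θ] with y hy
    rw [hy]
    push_cast
    ring
  rw [h2, h1]
  simp_rw [h3]
  rw [intervalIntegral.integral_const, sub_zero, Complex.real_smul, ← mul_assoc,
    ← Complex.ofReal_mul, inv_mul_cancel₀ (by positivity), Complex.ofReal_one, one_mul]

/-! ### Rotation invariance and the homogeneous estimate -/

/-- Rotation of a function in `L²`. -/
def rotL2 (θ : ℝ) (g : L2) : L2 :=
  Lp.compMeasurePreserving _ (rot θ).symm.measurePreserving g

theorem rotL2_ae_eq (θ : ℝ) (g : L2) : rotL2 θ g =ᵐ[volume] fun x => g ((rot θ).symm x) :=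
  Lp.coeFn_compMeasurePreserving g _

theorem continuous_rotL2 (θ : ℝ) : Continuous (rotL2 θ) :=
  (Lp.isometry_compMeasurePreserving (rot θ).symm.measurePreserving).continuous

theorem isRotInvariant_iff (g : L2) : IsRotInvariant g ↔ ∀ θ, rotL2 θ g = g := by
  refine forall_congr' fun θ => ?_
  rw [Lp.ext_iff]
  exact ⟨fun h => (rotL2_ae_eq θ g).trans h, fun h => (rotL2_ae_eq θ g).symm.trans h⟩

/-- Both sides are continuous in g, so it suffices to treat Schwartz functions, where the Fourier
integral commutes with isometries. -/
theorem fourier_rotL2 (θ : ℝ) (g : L2) : (𝓕 (rotL2 θ g) : L2) = rotL2 θ (𝓕 g) := by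
  have hF : Continuous fun g : L2 => (𝓕 g : L2) := (Lp.fourierTransformₗᵢ Plane ℂ).continuous
  have hd : DenseRange (SchwartzMap.toLpCLM ℝ (E := Plane) ℂ 2 volume) :=
    SchwartzMap.denseRange_toLpCLM ENNReal.ofNat_ne_top
  refine hd.induction_on (p := fun g : L2 => (𝓕 (rotL2 θ g) : L2) = rotL2 θ (𝓕 g)) g
    (isClosed_eq (hF.comp (continuous_rotL2 θ)) ((continuous_rotL2 θ).comp hF)) fun φ => ?_
  have hφ2 : MemLp φ 2 (volume : Measure Plane) := φ.memLp 2 volume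
  have e0 : SchwartzMap.toLpCLM ℝ (E := Plane) ℂ 2 volume φ = hφ2.toLp φ := rfl
  have hmp := (rot θ).symm.measurePreserving
  have hr1 : Integrable fun x => φ ((rot θ).symm x) := hmp.integrable_comp_of_integrable φ.integrable
  have hr2 : MemLp (fun x => φ ((rot θ).symm x)) 2 := hφ2.comp_measurePreserving hmp
  have e1 : rotL2 θ (hφ2.toLp φ) = hr2.toLp _ := by
    ext1
    filter_upwards [rotL2_ae_eq θ (hφ2.toLp φ), hr2.coeFn_toLp,
      hmp.quasiMeasurePreserving.ae_eq_comp hφ2.coeFn_toLp] with x h1 h2 h3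
    rw [h1, h2]
    exact h3
  rw [e0, e1]
  ext1
  filter_upwards [fourier_toLp_ae_eq hr1 hr2, rotL2_ae_eq θ (𝓕 (hφ2.toLp φ) : L2),
    hmp.quasiMeasurePreserving.ae_eq_comp (fourier_toLp_ae_eq φ.integrable hφ2)] with x h1 h2 h3
  rw [h1, h2]
  simp only [Function.comp_apply] at h3
  rw [h3]
  exact Real.fourier_comp_linearIsometry (rot θ).symm φ x

theorem rotL2_propagatorL2 (θ t : ℝ) (g : L2) :
    rotL2 θ (propagatorL2 t g) = propagatorL2 t (rotL2 θ g) := by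
  have : (𝓕 (rotL2 θ (propagatorL2 t g)) : L2) = 𝓕 (propagatorL2 t (rotL2 θ g)) := by
    rw [fourier_rotL2]
    ext1
    filter_upwards [rotL2_ae_eq θ (𝓕 (propagatorL2 t g) : L2), fourier_propagatorL2 t (rotL2 θ g),
      rotL2_ae_eq θ (𝓕 g : L2), (rot θ).symm.measurePreserving.quasiMeasurePreserving.ae_eq_comp
        (fourier_propagatorL2 t g)] with x h1 h2 h3 h4
    simp only [Function.comp_apply] at h4
    rw [h1, h2, h4, fourier_rotL2, h3, schrodingerSymbol, schrodingerSymbol,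
      LinearIsometryEquiv.norm_map]
  exact (Lp.fourierTransformₗᵢ Plane ℂ).injective this

theorem IsRotInvariant.propagatorL2 {g : L2} (hg : IsRotInvariant g) (t : ℝ) :
    IsRotInvariant (propagatorL2 t g) := by
  rw [isRotInvariant_iff] at hg ⊢
  intro θ
  rw [rotL2_propagatorL2, hg]

theorem IsRotInvariant.sub {g h : L2} (hg : IsRotInvariant g) (hh : IsRotInvariant h) :
    IsRotInvariant (g - h : L2) := by
  rw [isRotInvariant_iff] at *
  intro θ
  rw [rotL2, map_sub]
  exact congrArg₂ _ (hg θ) (hh θ)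

theorem IsRotInvariant.const_smul {g : L2} (hg : IsRotInvariant g) (c : ℂ) :
    IsRotInvariant (c • g : L2) := by
  intro θ
  filter_upwards [hg θ, Lp.coeFn_smul c g, (rot θ).symm.measurePreserving.quasiMeasurePreserving.ae_eq_comp
        (Lp.coeFn_smul c g)] with x h1 h2 h3
  simp only [Function.comp_apply, Pi.smul_apply] at h3
  rw [h2, h3, Pi.smul_apply, h1]

theorem continuous_propagatorL2_neg_testL2 (n : ℕ) :
    Continuous fun t => propagatorL2 (-t) (testL2 n) :=
  (continuous_propagatorL2 (testL2 n)).comp continuous_neg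

/-- The homogeneous weighted estimate, as a maximal inequality. -/
theorem lintegral_iSup_inner_testL2_le (h : L2) :
    ∫⁻ t, (⨆ n, ‖inner ℂ (propagatorL2 (-t) (testL2 n)) h‖ₑ) ^ 4 ≤ (4 * ‖h‖ₑ) ^ 4 := by
  refine (lintegral_iSup_inner_pow_four_le (fun n t => propagatorL2 (-t) (testL2 n))
    continuous_propagatorL2_neg_testL2 (C := 1) (fun m n t s hts => ?_) h).trans ?_
  · rw [inner_propagatorL2_left, propagatorL2_propagatorL2, neg_neg, one_mul, ← sub_eq_add_neg]
    exact enorm_inner_testL2_propagatorL2_le m n (sub_ne_zero.2 hts)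
  -- TT* with constant 1 gives 12² = 144, rounded up to 4⁴ = 256.
  · rw [mul_pow (4 : ℝ≥0∞)]
    exact mul_le_mul' (by norm_num) le_rfl

/-! ### The forcing term in L², by duality -/

/-- A functional on Schwartz functions that is bounded in the `L²` norm is given by an element
of `L²`. -/
theorem exists_toTemperedDistribution_eq (Λ : 𝓢(Plane, ℂ) →ₗ[ℂ] ℂ) {K : ℝ} (hK : 0 ≤ K)
    (hΛ : ∀ φ, ‖Λ φ‖ ≤ K * ‖φ.toLp 2 volume‖) :
    ∃ d : L2, ‖d‖ ≤ K ∧ ∀ φ, Lp.toTemperedDistribution d φ = Λ φ := by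
  have hd : DenseRange (SchwartzMap.toLpCLM ℂ (E := Plane) ℂ 2 volume) :=
    SchwartzMap.denseRange_toLpCLM ENNReal.ofNat_ne_top
  set e : 𝓢(Plane, ℂ) →ₗ[ℂ] L2 := (SchwartzMap.toLpCLM ℂ (E := Plane) ℂ 2 volume).toLinearMap
  have hex : ∀ φ, Λ.extendOfNorm e (e φ) = Λ φ := LinearMap.extendOfNorm_eq hd ⟨K, hΛ⟩
  have hn : ‖Λ.extendOfNorm e‖ ≤ K := LinearMap.opNorm_extendOfNorm_le hd hK hΛ
  set d := (InnerProductSpace.toDual ℂ L2).symm (Λ.extendOfNorm e) with hdd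
  -- The L² inner product is conjugate linear in its first slot, whereas the pairing with a
  -- distribution is bilinear, hence the conjugate of the Riesz representative.
  refine ⟨star d, ?_, fun φ => ?_⟩
  · have : ‖star d‖ = ‖d‖ := by
      rw [Lp.norm_def, Lp.norm_def]
      congr 1
      refine eLpNorm_congr_norm_ae ?_
      filter_upwards [Lp.coeFn_star d] with x hx
      rw [hx, Pi.star_apply, norm_star]
    rw [this, hdd, LinearIsometryEquiv.norm_map]
    exact hn
  · rw [← hex, ← InnerProductSpace.toDual_symm_apply, ← hdd, L2.inner_def,
      Lp.toTemperedDistribution_apply]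
    refine integral_congr_ae ?_
    filter_upwards [Lp.coeFn_star d, φ.coeFn_toLp 2 volume] with x h1 h2
    rw [h1, RCLike.inner_apply]
    simp only [e, ContinuousLinearMap.coe_coe, SchwartzMap.toLpCLM_apply]
    rw [h2, Pi.star_apply, smul_eq_mul]
    rfl

/-- The free Schrödinger propagator on Schwartz functions. -/
def propagatorS (t : ℝ) (φ : 𝓢(Plane, ℂ)) : 𝓢(Plane, ℂ) :=
  𝓕 (SchwartzMap.smulLeftCLM ℂ (schrodingerSymbol t) (𝓕⁻ φ))

theorem propagator_apply (t : ℝ) (T : 𝓢'(Plane, ℂ)) (φ : 𝓢(Plane, ℂ)) :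
    propagator t T φ = T (propagatorS t φ) := rfl

theorem fourierInv_propagatorS (t : ℝ) (φ : 𝓢(Plane, ℂ)) (ξ : Plane) :
    (𝓕⁻ (propagatorS t φ)) ξ = schrodingerSymbol t ξ * (𝓕⁻ φ) ξ := by
  rw [propagatorS, fourierInv_fourier_eq,
    SchwartzMap.smulLeftCLM_apply_apply (schrodingerSymbol_hasTemperateGrowth t), smul_eq_mul]

/-- `propagatorS` is the transpose of the distributional multiplier, a forward transform of an
inverse one. This is why `freeWave` has the kernel e^{-2πi⟨x,ξ⟩} and the profile is the inverse
transform of φ. -/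
theorem propagatorS_apply (t : ℝ) (φ : 𝓢(Plane, ℂ)) (x : Plane) :
    propagatorS t φ x = freeWave (𝓕⁻ φ : 𝓢(Plane, ℂ)) t x := by
  rw [propagatorS, SchwartzMap.fourier_coe, Real.fourier_eq', freeWave]
  refine integral_congr_ae (Filter.Eventually.of_forall fun ξ => ?_)
  simp only
  rw [SchwartzMap.smulLeftCLM_apply_apply (schrodingerSymbol_hasTemperateGrowth t), smul_eq_mul,
    smul_eq_mul, ← mul_assoc, schrodingerSymbol, ← Complex.exp_add, real_inner_comm]
  congr 2
  push_cast
  ring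

theorem freeWave_fourierInv_propagatorS (s t : ℝ) (φ : 𝓢(Plane, ℂ)) (x : Plane) :
    freeWave (𝓕⁻ (propagatorS t φ) : 𝓢(Plane, ℂ)) s x = freeWave (𝓕⁻ φ : 𝓢(Plane, ℂ)) (t + s) x := by
  rw [freeWave, freeWave]
  refine integral_congr_ae (Filter.Eventually.of_forall fun ξ => ?_)
  simp only
  rw [fourierInv_propagatorS, ← mul_assoc, schrodingerSymbol, ← Complex.exp_add]
  congr 2
  push_cast
  ring

theorem lintegral_fourierInv_enorm_sq (φ : 𝓢(Plane, ℂ)) :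
    ∫⁻ ξ, ‖(𝓕⁻ φ : 𝓢(Plane, ℂ)) ξ‖ₑ ^ 2 = ‖φ.toLp 2 volume‖ₑ ^ 2 := by
  have h1 : ‖φ.toLp 2 volume‖ = ‖(𝓕⁻ φ : 𝓢(Plane, ℂ)).toLp 2 volume‖ := by
    rw [← SchwartzMap.toLp_fourierInv_eq, ← Lp.norm_fourier_eq (𝓕⁻ (φ.toLp 2 volume) : L2),
      fourier_fourierInv_eq]
  rw [← ofReal_norm (φ.toLp 2 volume), h1, ofReal_norm, Lp.enorm_def,
    eLpNorm_congr_ae ((𝓕⁻ φ : 𝓢(Plane, ℂ)).coeFn_toLp 2 volume),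
    eLpNorm_eq_lintegral_rpow_enorm_toReal (by norm_num) (by norm_num), ← ENNReal.rpow_natCast,
    ← ENNReal.rpow_mul]
  norm_num

theorem lintegral_freeWave_neg_pow_four_le (φ : 𝓢(Plane, ℂ)) :
    ∫⁻ y : ℝ × Plane, ‖freeWave (𝓕⁻ φ : 𝓢(Plane, ℂ)) (-y.1) y.2‖ₑ ^ 4 ≤
      2 * ‖φ.toLp 2 volume‖ₑ ^ 4 := by
  have hc := continuous_freeWave (𝓕⁻ φ : 𝓢(Plane, ℂ)).integrable
  have hmp : MeasurePreserving (fun y : ℝ × Plane => (-y.1, y.2)) volume volume :=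
    (Measure.measurePreserving_neg (volume : Measure ℝ)).prod
      (MeasurePreserving.id (volume : Measure Plane))
  have := hmp.lintegral_comp (f := fun y : ℝ × Plane =>
    ‖freeWave (𝓕⁻ φ : 𝓢(Plane, ℂ)) y.1 y.2‖ₑ ^ 4) (hc.enorm.measurable.pow_const 4)
  simp only at this
  rw [this]
  refine (lintegral_freeWave_pow_four_le (𝓕⁻ φ : 𝓢(Plane, ℂ)).integrable).trans_eq ?_
  rw [lintegral_fourierInv_enorm_sq, ← pow_mul]

theorem continuous_freeWave_neg (φ : 𝓢(Plane, ℂ)) :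
    Continuous fun y : ℝ × Plane => freeWave (𝓕⁻ φ : 𝓢(Plane, ℂ)) (-y.1) y.2 :=
  Continuous.comp (g := fun y : ℝ × Plane => freeWave (𝓕⁻ φ : 𝓢(Plane, ℂ)) y.1 y.2)
    (f := fun y : ℝ × Plane => (-y.1, y.2))
    (continuous_freeWave (𝓕⁻ φ : 𝓢(Plane, ℂ)).integrable) (by fun_prop)

/-- Hölder's inequality together with the Strichartz estimate. -/
theorem lintegral_mul_freeWave_le {G : ℝ × Plane → ℂ} {μ : Measure (ℝ × Plane)} (hμ : μ ≤ volume)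
    (hG : AEStronglyMeasurable G μ) (φ : 𝓢(Plane, ℂ)) :
    ∫⁻ y, ‖G y * freeWave (𝓕⁻ φ : 𝓢(Plane, ℂ)) (-y.1) y.2‖ₑ ∂μ ≤
      (∫⁻ y, ‖G y‖ₑ ^ (4 / 3 : ℝ) ∂μ) ^ (3 / 4 : ℝ) * (2 * ‖φ.toLp 2 volume‖ₑ) := by
  have hc := continuous_freeWave_neg φ
  have hpq : (4 / 3 : ℝ).HolderConjugate 4 := by
    rw [Real.holderConjugate_iff]
    norm_num
  have h1 := ENNReal.lintegral_mul_le_Lp_mul_Lq μ hpq hG.enorm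
    hc.enorm.measurable.aemeasurable
  simp only [Pi.mul_apply, ← enorm_mul] at h1
  refine h1.trans ?_
  have h2 : (1 / (4 / 3) : ℝ) = 3 / 4 := by norm_num
  rw [h2]
  gcongr
  rw [one_div, ENNReal.rpow_inv_le_iff (by norm_num)]
  have h4 : ∀ a : ℝ≥0∞, a ^ (4 : ℝ) = a ^ 4 := fun a => by
    rw [← ENNReal.rpow_natCast]
    norm_num
  simp_rw [h4]
  refine (lintegral_mono' hμ le_rfl).trans ((lintegral_freeWave_neg_pow_four_le φ).trans ?_)
  rw [mul_pow]
  gcongr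
  norm_num

theorem restrict_prod_volume (I : Set ℝ) :
    (volume.restrict I).prod (volume : Measure Plane) = volume.restrict (I ×ˢ Set.univ) := by
  rw [Measure.volume_eq_prod, ← Measure.prod_restrict, Measure.restrict_univ]

theorem lintegral_enorm_rpow_ne_top {G : ℝ × Plane → ℂ} (hG : MemLp G (4 / 3) volume) :
    ∫⁻ y, ‖G y‖ₑ ^ (4 / 3 : ℝ) ≠ ∞ := by
  have := lintegral_rpow_enorm_lt_top_of_eLpNorm_lt_top (by simp)
    (ENNReal.div_lt_top (by simp) (by simp)).ne hG.2
  simpa [ENNReal.toReal_div] using this.ne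

/-- The integral of `|G(s)|^{4/3}` over space. -/
def sliceMass (G : ℝ × Plane → ℂ) (s : ℝ) : ℝ≥0∞ := ∫⁻ x, ‖G (s, x)‖ₑ ^ (4 / 3 : ℝ)

theorem aemeasurable_sliceMass {G : ℝ × Plane → ℂ} (hG : MemLp G (4 / 3) volume) :
    AEMeasurable (sliceMass G) :=
  (hG.1.enorm.pow_const _).lintegral_prod_right'

theorem lintegral_sliceMass {G : ℝ × Plane → ℂ} (hG : MemLp G (4 / 3) volume) :
    ∫⁻ s, sliceMass G s = ∫⁻ y, ‖G y‖ₑ ^ (4 / 3 : ℝ) :=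
  (lintegral_prod _ (hG.1.enorm.pow_const _)).symm

theorem lintegral_sliceMass_ne_top {G : ℝ × Plane → ℂ} (hG : MemLp G (4 / 3) volume) :
    ∫⁻ s, sliceMass G s ≠ ∞ := by
  rw [lintegral_sliceMass hG]
  exact lintegral_enorm_rpow_ne_top hG

theorem integrable_sliceMass {G : ℝ × Plane → ℂ} (hG : MemLp G (4 / 3) volume) :
    Integrable fun s => (sliceMass G s).toReal :=
  integrable_toReal_of_lintegral_ne_top (aemeasurable_sliceMass hG) (lintegral_sliceMass_ne_top hG)

/-- The integral of `|G|^{4/3}` over the times between `a` and `t`. -/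
def mass (G : ℝ × Plane → ℂ) (a t : ℝ) : ℝ := ∫ s in a..t, (sliceMass G s).toReal

theorem continuous_mass {G : ℝ × Plane → ℂ} (hG : MemLp G (4 / 3) volume) (a : ℝ) :
    Continuous (mass G a) :=
  intervalIntegral.continuous_primitive
    (fun _ _ => (integrable_sliceMass hG).intervalIntegrable) a

theorem mass_sub_mass {G : ℝ × Plane → ℂ} (hG : MemLp G (4 / 3) volume) (a s t : ℝ) :
    mass G a t - mass G a s = mass G s t :=
  intervalIntegral.integral_interval_sub_left (integrable_sliceMass hG).intervalIntegrable
    (integrable_sliceMass hG).intervalIntegrable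

theorem ofReal_abs_mass {G : ℝ × Plane → ℂ} (hG : MemLp G (4 / 3) volume) (a t : ℝ) :
    ENNReal.ofReal |mass G a t| = ∫⁻ s in Set.uIoc a t, sliceMass G s := by
  rw [mass, intervalIntegral.abs_intervalIntegral_eq, abs_of_nonneg
    (integral_nonneg fun s => ENNReal.toReal_nonneg), integral_toReal
    (aemeasurable_sliceMass hG).restrict, ENNReal.ofReal_toReal]
  · exact ((setLIntegral_le_lintegral _ _).trans_lt (lintegral_sliceMass_ne_top hG).lt_top).ne
  · exact ae_restrict_of_ae
      (ae_lt_top' (aemeasurable_sliceMass hG) (lintegral_sliceMass_ne_top hG))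

theorem abs_mass_le {G : ℝ × Plane → ℂ} (hG : MemLp G (4 / 3) volume) (a t : ℝ) :
    |mass G a t| ≤ (∫⁻ y, ‖G y‖ₑ ^ (4 / 3 : ℝ)).toReal := by
  rw [← ENNReal.ofReal_le_iff_le_toReal (lintegral_enorm_rpow_ne_top hG), ofReal_abs_mass hG,
    ← lintegral_sliceMass hG]
  exact setLIntegral_le_lintegral _ _

theorem integrable_mul_freeWave {G : ℝ × Plane → ℂ} (hG : MemLp G (4 / 3) volume)
    (φ : 𝓢(Plane, ℂ)) :
    Integrable fun y : ℝ × Plane => G y * freeWave (𝓕⁻ φ : 𝓢(Plane, ℂ)) (-y.1) y.2 := by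
  refine ⟨hG.1.mul (continuous_freeWave_neg φ).aestronglyMeasurable, ?_⟩
  refine (lintegral_mul_freeWave_le le_rfl hG.1 φ).trans_lt (ENNReal.mul_lt_top ?_ ?_)
  · exact ENNReal.rpow_lt_top_of_nonneg (by norm_num) (lintegral_enorm_rpow_ne_top hG)
  · exact ENNReal.mul_lt_top (by norm_num) enorm_lt_top

theorem freeWave_add {g h : Plane → ℂ} (hg : Integrable g) (hh : Integrable h) (t : ℝ) (x : Plane) :
    freeWave (g + h) t x = freeWave g t x + freeWave h t x := by
  have hb : ∀ {g : Plane → ℂ}, Integrable g → Integrable fun ξ =>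
      Complex.exp (Complex.I * ((-(2 * Real.pi * inner ℝ x ξ + t * (2 * Real.pi * ‖ξ‖) ^ 2) : ℝ) : ℂ)) *
        g ξ := fun hg => by
    refine hg.bdd_mul (c := 1) (Continuous.aestronglyMeasurable (by fun_prop)) ?_
    exact Filter.Eventually.of_forall fun ξ => (norm_exp_I_mul_ofReal _).le
  rw [freeWave, freeWave, freeWave, ← integral_add (hb hg) (hb hh)]
  simp only [Pi.add_apply, mul_add]

theorem freeWave_smul (c : ℂ) (g : Plane → ℂ) (t : ℝ) (x : Plane) :
    freeWave (c • g) t x = c * freeWave g t x := by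
  rw [freeWave, freeWave, ← integral_const_mul]
  simp only [Pi.smul_apply, smul_eq_mul, mul_left_comm c]

/-- The functional `φ ↦ ∫_a^b ∫ G(s, x) (e^{-isΔ} φ)(x) dx ds`. -/
def pairing {G : ℝ × Plane → ℂ} (hG : MemLp G (4 / 3) volume) (a b : ℝ) : 𝓢(Plane, ℂ) →ₗ[ℂ] ℂ where
  toFun φ := ∫ s in a..b, ∫ x, G (s, x) * freeWave (𝓕⁻ φ : 𝓢(Plane, ℂ)) (-s) x
  map_add' φ ψ := by
    have h1 := integrable_mul_freeWave hG φ
    have h2 := integrable_mul_freeWave hG ψ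
    rw [← intervalIntegral.integral_add h1.integral_prod_left.intervalIntegrable
      h2.integral_prod_left.intervalIntegrable]
    refine intervalIntegral.integral_congr_ae ?_
    filter_upwards [h1.prod_right_ae, h2.prod_right_ae] with s h3 h4 _
    rw [← integral_add h3 h4]
    refine integral_congr_ae (Filter.Eventually.of_forall fun x => ?_)
    simp only
    rw [← mul_add, FourierTransform.fourierInv_add, ← freeWave_add
      (𝓕⁻ φ : 𝓢(Plane, ℂ)).integrable (𝓕⁻ ψ : 𝓢(Plane, ℂ)).integrable]
    rfl
  map_smul' c φ := by
    have h1 : ∀ s x, G (s, x) * freeWave (𝓕⁻ (c • φ) : 𝓢(Plane, ℂ)) (-s) x =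
        c * (G (s, x) * freeWave (𝓕⁻ φ : 𝓢(Plane, ℂ)) (-s) x) := fun s x => by
      have : freeWave (𝓕⁻ (c • φ) : 𝓢(Plane, ℂ)) (-s) x =
          c * freeWave (𝓕⁻ φ : 𝓢(Plane, ℂ)) (-s) x := by
        rw [FourierTransform.fourierInv_smul, ← freeWave_smul]
        rfl
      rw [this]
      ring
    simp_rw [h1, integral_const_mul, intervalIntegral.integral_const_mul]
    rfl

theorem pairing_apply {G : ℝ × Plane → ℂ} (hG : MemLp G (4 / 3) volume) (a b : ℝ) (φ : 𝓢(Plane, ℂ)) :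
    pairing hG a b φ = ∫ s in a..b, ∫ x, G (s, x) * freeWave (𝓕⁻ φ : 𝓢(Plane, ℂ)) (-s) x := rfl

theorem pairing_sub_pairing {G : ℝ × Plane → ℂ} (hG : MemLp G (4 / 3) volume) (a s t : ℝ)
    (φ : 𝓢(Plane, ℂ)) : pairing hG a t φ - pairing hG a s φ = pairing hG s t φ :=
  intervalIntegral.integral_interval_sub_left
    (integrable_mul_freeWave hG φ).integral_prod_left.intervalIntegrable
    (integrable_mul_freeWave hG φ).integral_prod_left.intervalIntegrable

/-- This is the dual Strichartz estimate on a time interval: the L^{4/3} norm of G over it is the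
3/4 power of the mass. The absolute value covers b < a. -/
theorem norm_pairing_le {G : ℝ × Plane → ℂ} (hG : MemLp G (4 / 3) volume) (a b : ℝ)
    (φ : 𝓢(Plane, ℂ)) :
    ‖pairing hG a b φ‖ ≤ 2 * |mass G a b| ^ (3 / 4 : ℝ) * ‖φ.toLp 2 volume‖ := by
  have hle : (volume.restrict (Set.uIoc a b)).prod (volume : Measure Plane) ≤ volume := by
    rw [restrict_prod_volume]
    exact Measure.restrict_le_self
  have hG' := hG.1.mono_measure hle
  have hmass : ∫⁻ y, ‖G y‖ₑ ^ (4 / 3 : ℝ) ∂((volume.restrict (Set.uIoc a b)).prod volume) =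
      ENNReal.ofReal |mass G a b| := by
    rw [ofReal_abs_mass hG, lintegral_prod _ (hG'.enorm.pow_const _)]
    rfl
  have hm : AEMeasurable (fun y : ℝ × Plane =>
      ‖G y * freeWave (𝓕⁻ φ : 𝓢(Plane, ℂ)) (-y.1) y.2‖ₑ)
      ((volume.restrict (Set.uIoc a b)).prod volume) :=
    (hG'.mul (continuous_freeWave_neg φ).aestronglyMeasurable).enorm
  have key : ‖pairing hG a b φ‖ₑ ≤
      ENNReal.ofReal |mass G a b| ^ (3 / 4 : ℝ) * (2 * ‖φ.toLp 2 volume‖ₑ) := by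
    rw [← hmass]
    refine le_trans ?_ (lintegral_mul_freeWave_le hle hG' φ)
    rw [lintegral_prod _ hm, ← ofReal_norm, pairing_apply, intervalIntegral.norm_intervalIntegral_eq,
      ofReal_norm]
    refine (enorm_integral_le_lintegral_enorm _).trans (lintegral_mono fun s => ?_)
    exact enorm_integral_le_lintegral_enorm _
  rw [ENNReal.ofReal_rpow_of_nonneg (abs_nonneg _) (by norm_num), ← ofReal_norm,
    ← ofReal_norm] at key
  have hN := norm_nonneg (φ.toLp 2 volume)
  generalize ‖φ.toLp 2 volume‖ = N at key hN ⊢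
  have h2 : 2 * ENNReal.ofReal N = ENNReal.ofReal (2 * N) := by
    rw [ENNReal.ofReal_mul (by norm_num), ENNReal.ofReal_ofNat]
  rw [h2, ← ENNReal.ofReal_mul (by positivity), ENNReal.ofReal_le_ofReal_iff (by positivity)] at key
  linarith

/-- The backwards evolution of the forcing term, `∫_a^t e^{-isΔ} G(s) ds`, as an element of `L²`. -/
theorem exists_forcing {G : ℝ × Plane → ℂ} (hG : MemLp G (4 / 3) volume) (a : ℝ) :
    ∃ D : ℝ → L2, (∀ t φ, Lp.toTemperedDistribution (D t) φ = pairing hG a t φ) ∧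
      ∀ t s, ‖D t - D s‖ ≤ 2 * |mass G a t - mass G a s| ^ (3 / 4 : ℝ) := by
  have h := fun s t => exists_toTemperedDistribution_eq (pairing hG s t)
    (K := 2 * |mass G s t| ^ (3 / 4 : ℝ)) (by positivity) (norm_pairing_le hG s t)
  choose D hD1 hD2 using h
  refine ⟨D a, hD2 a, fun t s => ?_⟩
  -- Additivity in the time interval turns the bound for each interval into the modulus of
  -- continuity of the path.
  have : D a t - D a s = D s t := toTemperedDistribution_injective fun φ => by
    rw [hD2, ← pairing_sub_pairing hG a s t, ← hD2, ← hD2]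
    exact DFunLike.congr_fun
      ((Lp.toTemperedDistributionCLM ℂ (volume : Measure Plane) 2).map_sub (D a t) (D a s)) φ
  rw [this, mass_sub_mass hG]
  exact hD1 s t

/-! ### Rotation invariance of the forcing term -/

/-- A Schwartz function composed with a rotation. -/
def rotS (θ : ℝ) (φ : 𝓢(Plane, ℂ)) : 𝓢(Plane, ℂ) :=
  SchwartzMap.compCLMOfContinuousLinearEquiv ℂ (rot θ).toContinuousLinearEquiv φ

theorem rotS_apply (θ : ℝ) (φ : 𝓢(Plane, ℂ)) (x : Plane) : rotS θ φ x = φ (rot θ x) := rfl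

theorem toTemperedDistribution_rotL2 (θ : ℝ) (d : L2) (φ : 𝓢(Plane, ℂ)) :
    Lp.toTemperedDistribution (rotL2 θ d) φ = Lp.toTemperedDistribution d (rotS θ φ) := by
  rw [Lp.toTemperedDistribution_apply, Lp.toTemperedDistribution_apply]
  symm
  rw [← (rot θ).symm.measurePreserving.integral_comp (rot θ).symm.toHomeomorph.measurableEmbedding]
  refine integral_congr_ae ?_
  filter_upwards [rotL2_ae_eq θ d] with x hx
  rw [hx, rotS_apply, LinearIsometryEquiv.apply_symm_apply]

theorem freeWave_fourierInv_rotS (θ t : ℝ) (φ : 𝓢(Plane, ℂ)) (x : Plane) :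
    freeWave (𝓕⁻ (rotS θ φ) : 𝓢(Plane, ℂ)) t x = freeWave (𝓕⁻ φ : 𝓢(Plane, ℂ)) t (rot θ x) := by
  have h1 : ∀ ξ, (𝓕⁻ (rotS θ φ) : 𝓢(Plane, ℂ)) ξ = (𝓕⁻ φ : 𝓢(Plane, ℂ)) (rot θ ξ) := fun ξ => by
    rw [SchwartzMap.fourierInv_coe, SchwartzMap.fourierInv_coe]
    exact Real.fourierInv_comp_linearIsometry (rot θ) φ ξ
  rw [freeWave, freeWave]
  symm
  rw [← (rot θ).measurePreserving.integral_comp (rot θ).toHomeomorph.measurableEmbedding]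
  refine integral_congr_ae (Filter.Eventually.of_forall fun ξ => ?_)
  simp only
  rw [h1, LinearIsometryEquiv.inner_map_map, LinearIsometryEquiv.norm_map]

/-- The free wave commutes with rotating the test function. A change of variables moves the rotation
onto the slices of G, which almost all absorb it. -/
theorem isRotInvariant_of_pairing {G : ℝ × Plane → ℂ} (hG : MemLp G (4 / 3) volume)
    (hrad : ∀ᵐ s, IsRotInvariant fun x => G (s, x)) {a t : ℝ} {d : L2}
    (hd : ∀ φ, Lp.toTemperedDistribution d φ = pairing hG a t φ) : IsRotInvariant d := by
  rw [isRotInvariant_iff]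
  refine fun θ => toTemperedDistribution_injective fun φ => ?_
  rw [toTemperedDistribution_rotL2, hd, hd, pairing_apply, pairing_apply]
  refine intervalIntegral.integral_congr_ae ?_
  filter_upwards [hrad] with s hs _
  simp_rw [freeWave_fourierInv_rotS]
  rw [← (rot θ).symm.measurePreserving.integral_comp (rot θ).symm.toHomeomorph.measurableEmbedding]
  refine integral_congr_ae ?_
  filter_upwards [hs θ] with x hx
  rw [hx, LinearIsometryEquiv.apply_symm_apply]

/-! ### The Duhamel formula -/

/-- The forcing term, extended by zero to all times. -/
def extendForcing (I : Set ℝ) (f : ℝ → Plane → ℂ) : ℝ × Plane → ℂ :=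
  (I ×ˢ Set.univ).indicator (Function.uncurry f)

theorem extendForcing_of_mem {I : Set ℝ} {f : ℝ → Plane → ℂ} {s : ℝ} (hs : s ∈ I) (x : Plane) :
    extendForcing I f (s, x) = f s x :=
  Set.indicator_of_mem (by simpa using hs) _

theorem memLp_extendForcing {I : Set ℝ} (hI : MeasurableSet I) {f : ℝ → Plane → ℂ}
    (hf : MemLp (Function.uncurry f) (4 / 3) ((volume.restrict I).prod volume)) :
    MemLp (extendForcing I f) (4 / 3) volume := by
  rw [restrict_prod_volume] at hf
  exact (memLp_indicator_iff_restrict (hI.prod MeasurableSet.univ)).2 hf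

theorem eLpNorm_extendForcing {I : Set ℝ} (hI : MeasurableSet I) (f : ℝ → Plane → ℂ) :
    eLpNorm (extendForcing I f) (4 / 3) volume =
      eLpNorm (Function.uncurry f) (4 / 3) ((volume.restrict I).prod volume) := by
  rw [restrict_prod_volume]
  exact eLpNorm_indicator_eq_eLpNorm_restrict (hI.prod MeasurableSet.univ)

theorem isRotInvariant_extendForcing {I : Set ℝ} (hI : MeasurableSet I) {f : ℝ → Plane → ℂ}
    (hf : ∀ᵐ t ∂(volume.restrict I), IsRadial (f t)) :
    ∀ᵐ s, IsRotInvariant fun x => extendForcing I f (s, x) := by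
  rw [ae_restrict_iff' hI] at hf
  filter_upwards [hf] with s hs
  by_cases h : s ∈ I
  · simp_rw [extendForcing_of_mem h]
    exact (hs h).isRotInvariant
  · have : ∀ x, extendForcing I f (s, x) = 0 := fun x =>
      Set.indicator_of_notMem (by simpa using h) _
    simp_rw [this]
    exact fun θ => Filter.EventuallyEq.rfl

theorem ae_memLp_slice {G : ℝ × Plane → ℂ} (hG : MemLp G (4 / 3) volume) :
    ∀ᵐ s, MemLp (fun x => G (s, x)) (4 / 3) volume := by
  filter_upwards [ae_lt_top' (aemeasurable_sliceMass hG) (lintegral_sliceMass_ne_top hG),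
    hG.1.prodMk_left] with s h1 h2
  refine ⟨h2, ?_⟩
  rw [eLpNorm_lt_top_iff_lintegral_rpow_enorm_lt_top (by simp)
    (ENNReal.div_lt_top (by simp) (by simp)).ne]
  simpa [ENNReal.toReal_div, sliceMass] using h1

/-- By the group law, the dependence on t is moved into the test function. One path D, built with
e^{-isΔ} alone, thereby serves every t. Almost every slice is in L^{4/3}, so the default value in
`sliceDistribution` does not intervene. -/
theorem ae_propagator_sliceDistribution {I : Set ℝ} (hI : MeasurableSet I) {f : ℝ → Plane → ℂ}
    (hf : MemLp (Function.uncurry f) (4 / 3) ((volume.restrict I).prod volume)) (t : ℝ)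
    (φ : 𝓢(Plane, ℂ)) :
    ∀ᵐ s, s ∈ I → propagator (t - s) (sliceDistribution (f s)) φ =
      ∫ x, extendForcing I f (s, x) * freeWave (𝓕⁻ (propagatorS t φ) : 𝓢(Plane, ℂ)) (-s) x := by
  filter_upwards [ae_memLp_slice (memLp_extendForcing hI hf)] with s hs hsI
  simp_rw [extendForcing_of_mem hsI] at hs ⊢
  rw [propagator_apply, sliceDistribution, dif_pos hs, Lp.toTemperedDistribution_apply]
  refine integral_congr_ae ?_
  filter_upwards [hs.coeFn_toLp] with x hx
  rw [hx, propagatorS_apply, freeWave_fourierInv_propagatorS, smul_eq_mul, mul_comm, sub_eq_add_neg]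

/-- The solutions of the Duhamel formula in terms of the backwards evolution of the forcing. -/
theorem isDuhamel_iff {I : Set ℝ} (hI : I.OrdConnected) {t₀ : ℝ} (ht₀ : t₀ ∈ I) (u₀ : L2)
    {f : ℝ → Plane → ℂ}
    (hf : MemLp (Function.uncurry f) (4 / 3) ((volume.restrict I).prod volume)) {D : ℝ → L2}
    (hD : ∀ t φ, Lp.toTemperedDistribution (D t) φ =
      pairing (memLp_extendForcing hI.measurableSet hf) t₀ t φ) (u : ℝ → L2) :
    IsDuhamel I t₀ u₀ f u ↔
      ∀ t ∈ I, u t = propagatorL2 t (propagatorL2 (-t₀) u₀ - Complex.I • D t) := by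
  have hG := memLp_extendForcing hI.measurableSet hf
  refine forall₂_congr fun t ht => ?_
  have hsub : Set.uIoc t₀ t ⊆ I := Set.uIoc_subset_uIcc.trans (hI.uIcc_subset ht₀ ht)
  have hae : ∀ φ, ∀ᵐ s, s ∈ Set.uIoc t₀ t → propagator (t - s) (sliceDistribution (f s)) φ =
      ∫ x, extendForcing I f (s, x) * freeWave (𝓕⁻ (propagatorS t φ) : 𝓢(Plane, ℂ)) (-s) x :=
    fun φ => (ae_propagator_sliceDistribution hI.measurableSet hf t φ).mono
      fun s hs hst => hs (hsub hst)
  have hint : ∀ φ, IntervalIntegrable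
      (fun s => propagator (t - s) (sliceDistribution (f s)) φ) volume t₀ t := fun φ => by
    refine (integrable_mul_freeWave hG
      (propagatorS t φ)).integral_prod_left.intervalIntegrable.congr_ae ?_
    rw [Filter.EventuallyEq, ae_restrict_iff' measurableSet_uIoc]
    exact (hae φ).mono fun s hs hst => (hs hst).symm
  have heq : ∀ φ, propagator (t - t₀) (Lp.toTemperedDistribution u₀) φ -
        Complex.I * ∫ s in t₀..t, propagator (t - s) (sliceDistribution (f s)) φ =
      Lp.toTemperedDistribution (propagatorL2 t (propagatorL2 (-t₀) u₀ - Complex.I • D t)) φ := by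
    intro φ
    rw [propagatorL2_sub, propagatorL2_propagatorL2, propagatorL2_smul, ← sub_eq_add_neg]
    have h1 : Lp.toTemperedDistribution
        (propagatorL2 (t - t₀) u₀ - Complex.I • propagatorL2 t (D t)) φ =
        Lp.toTemperedDistribution (propagatorL2 (t - t₀) u₀) φ -
          Complex.I * Lp.toTemperedDistribution (propagatorL2 t (D t)) φ := by
      have := (Lp.toTemperedDistributionCLM ℂ (volume : Measure Plane) 2).map_sub
        (propagatorL2 (t - t₀) u₀) (Complex.I • propagatorL2 t (D t))
      rw [map_smul] at this
      exact DFunLike.congr_fun this φ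
    rw [h1, toTemperedDistribution_propagatorL2, toTemperedDistribution_propagatorL2,
      propagator_apply t, hD, pairing_apply, intervalIntegral.integral_congr_ae (hae φ)]
  constructor
  · intro h
    exact toTemperedDistribution_injective fun φ => by rw [(h φ).2, heq]
  · intro h φ
    exact ⟨hint φ, by rw [heq, h]⟩

/-! ### The weighted estimate -/

/-- The propagator preserves rotation invariance, so the countable supremum formula applies at time
t. Its adjoint is then moved onto the test functions, leaving the maximal function of the profile h.
-/
theorem eLpNorm_weighted_eq {u : ℝ → L2} {t : ℝ} {h : L2} (hu : u t = propagatorL2 t h)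
    (hh : IsRotInvariant h) :
    eLpNorm (weighted u t) ⊤ volume = ⨆ n, ‖inner ℂ (propagatorL2 (-t) (testL2 n)) h‖ₑ := by
  have h1 : weighted u t = fun x => ((√‖x‖ : ℝ) : ℂ) * propagatorL2 t h x := by
    ext x
    rw [weighted, hu, Real.sqrt_eq_rpow]
  rw [h1, eLpNorm_top_sqrt_norm_mul_eq (hh.propagatorL2 t)]
  simp_rw [inner_propagatorL2_left, neg_neg]

theorem continuous_of_norm_sub_le_mass {G : ℝ × Plane → ℂ} (hG : MemLp G (4 / 3) volume) {a : ℝ}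
    {D : ℝ → L2} (hD : ∀ t s, ‖D t - D s‖ ≤ 2 * |mass G a t - mass G a s| ^ (3 / 4 : ℝ)) :
    Continuous D := by
  rw [continuous_iff_continuousAt]
  intro s
  rw [ContinuousAt, tendsto_iff_norm_sub_tendsto_zero]
  have hc : Continuous fun t => 2 * |mass G a t - mass G a s| ^ (3 / 4 : ℝ) :=
    continuous_const.mul ((((continuous_mass hG a).sub continuous_const).abs).rpow_const
      fun _ => Or.inr (by norm_num))
  have h0 := hc.tendsto s
  rw [sub_self, abs_zero, Real.zero_rpow (by norm_num), mul_zero] at h0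
  exact squeeze_zero (fun t => norm_nonneg _) (fun t => hD t s) h0

/-- The weighted estimate for the forcing term, as a maximal inequality. -/
theorem eLpNorm_iSup_inner_forcing_le {G : ℝ × Plane → ℂ} (hG : MemLp G (4 / 3) volume) {a : ℝ}
    {D : ℝ → L2} (hD : ∀ t s, ‖D t - D s‖ ≤ 2 * |mass G a t - mass G a s| ^ (3 / 4 : ℝ))
    (hDa : D a = 0) :
    eLpNorm (fun t => ⨆ n, ‖inner ℂ (propagatorL2 (-t) (testL2 n)) (D t)‖ₑ) 4 volume ≤
      208 * eLpNorm G (4 / 3) volume := by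
  set M := (∫⁻ y, ‖G y‖ₑ ^ (4 / 3 : ℝ)).toReal with hM
  have hM0 : 0 ≤ M := ENNReal.toReal_nonneg
  have hMle := abs_mass_le hG a
  have hmass_a : mass G a a = 0 := intervalIntegral.integral_same
  have hDM : ∀ t, ‖D t‖ ≤ 2 * M ^ (3 / 4 : ℝ) := fun t => by
    have := hD t a
    rw [hDa, hmass_a, sub_zero, sub_zero] at this
    refine this.trans ?_
    gcongr
    exact hMle t
  have hMG : ENNReal.ofReal (M ^ (3 / 4 : ℝ)) = eLpNorm G (4 / 3) volume := by
    rw [← ENNReal.ofReal_rpow_of_nonneg hM0 (by norm_num), hM,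
      ENNReal.ofReal_toReal (lintegral_enorm_rpow_ne_top hG),
      eLpNorm_eq_lintegral_rpow_enorm_toReal (by simp) (ENNReal.div_lt_top (by simp) (by simp)).ne]
    norm_num [ENNReal.toReal_div]
  -- The chaining lemma rescales F by M and needs M > 0. For zero mass the path D vanishes.
  rcases hM0.eq_or_lt with h0 | h0
  · have : ∀ t, D t = 0 := fun t => by
      have := hDM t
      rw [← h0, Real.zero_rpow (by norm_num), mul_zero] at this
      exact norm_le_zero_iff.1 this
    simp [this]
  -- The constant is 26·4·2 = 208: from chaining, from the homogeneous estimate, and from the dual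
  -- Strichartz bound.
  · refine (eLpNorm_iSup_inner_path_le continuous_propagatorL2_neg_testL2
      lintegral_iSup_inner_testL2_le (continuous_mass hG a).measurable (A := 2) (by norm_num) h0 hMle
      hDM hD).trans_eq ?_
    rw [ENNReal.ofReal_mul (by norm_num), hMG, ENNReal.ofReal_ofNat, ← mul_assoc]
    norm_num

theorem measurable_iSup_inner_path {P : ℝ → L2} (hP : Continuous P) :
    Measurable fun t => ⨆ n, ‖inner ℂ (propagatorL2 (-t) (testL2 n)) (P t)‖ₑ :=
  Measurable.iSup fun n => ((continuous_propagatorL2_neg_testL2 n).inner hP).enorm.measurable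

theorem eLpNorm_iSup_inner_sub_le {h : L2} {D : ℝ → L2} (hD : Continuous D) {c d : ℝ≥0∞}
    (hc : eLpNorm (fun t => ⨆ n, ‖inner ℂ (propagatorL2 (-t) (testL2 n)) h‖ₑ) 4 volume ≤ c)
    (hd : eLpNorm (fun t => ⨆ n, ‖inner ℂ (propagatorL2 (-t) (testL2 n)) (D t)‖ₑ) 4 volume ≤ d) :
    eLpNorm (fun t => ⨆ n, ‖inner ℂ (propagatorL2 (-t) (testL2 n)) (h - Complex.I • D t)‖ₑ) 4
      volume ≤ c + d := by
  refine le_trans (eLpNorm_mono_enorm (g :=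
    (fun t => ⨆ n, ‖inner ℂ (propagatorL2 (-t) (testL2 n)) h‖ₑ) +
      fun t => ⨆ n, ‖inner ℂ (propagatorL2 (-t) (testL2 n)) (D t)‖ₑ) fun t => ?_)
    ((eLpNorm_add_le (measurable_iSup_inner_path continuous_const).aestronglyMeasurable
      (measurable_iSup_inner_path hD).aestronglyMeasurable (by norm_num)).trans (add_le_add hc hd))
  simp only [enorm_eq_self, Pi.add_apply]
  rw [sub_eq_add_neg]
  refine (iSup_inner_add_le _ _ _).trans_eq ?_
  congr 2
  ext n
  rw [inner_neg_right, inner_smul_right, enorm_neg, enorm_mul, ← ofReal_norm Complex.I,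
    Complex.norm_I, ENNReal.ofReal_one, one_mul]

/-- The weighted endpoint Strichartz estimate for evolutions of the form
`e^{itΔ}(h - i D(t))`. -/
theorem mixedNorm_weighted_le {I : Set ℝ} (hI : MeasurableSet I) {G : ℝ × Plane → ℂ}
    (hG : MemLp G (4 / 3) volume) {a : ℝ} {D u : ℝ → L2} {h : L2}
    (hDD : ∀ t s, ‖D t - D s‖ ≤ 2 * |mass G a t - mass G a s| ^ (3 / 4 : ℝ)) (hDa : D a = 0)
    (hinv : ∀ t, IsRotInvariant (h - Complex.I • D t : L2))
    (hu : ∀ t ∈ I, u t = propagatorL2 t (h - Complex.I • D t)) :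
    AEMeasurable (fun t => eLpNorm (weighted u t) ⊤ volume) (volume.restrict I) ∧
      mixedNorm 4 ⊤ I (weighted u) ≤ 208 * (‖h‖ₑ + eLpNorm G (4 / 3) volume) := by
  have hsup : (fun t => eLpNorm (weighted u t) ⊤ volume) =ᵐ[volume.restrict I]
      fun t => ⨆ n, ‖inner ℂ (propagatorL2 (-t) (testL2 n)) (h - Complex.I • D t)‖ₑ := by
    rw [Filter.EventuallyEq, ae_restrict_iff' hI]
    exact Filter.Eventually.of_forall fun t ht => eLpNorm_weighted_eq (hu t ht) (hinv t)
  have hDc := continuous_of_norm_sub_le_mass hG hDD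
  refine ⟨(measurable_iSup_inner_path
    (continuous_const.sub (hDc.const_smul Complex.I))).aemeasurable.congr hsup.symm, ?_⟩
  rw [mixedNorm, eLpNorm_congr_ae hsup]
  have hhom : eLpNorm (fun t => ⨆ n, ‖inner ℂ (propagatorL2 (-t) (testL2 n)) h‖ₑ) 4 volume ≤
      4 * ‖h‖ₑ := by
    rw [eLpNorm_four_le_iff]
    exact lintegral_iSup_inner_testL2_le h
  refine (eLpNorm_mono_measure _ Measure.restrict_le_self).trans
    ((eLpNorm_iSup_inner_sub_le hDc hhom (eLpNorm_iSup_inner_forcing_le hG hDD hDa)).trans ?_)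
  rw [mul_add]
  exact add_le_add (mul_le_mul' (by norm_num) le_rfl) le_rfl

theorem toTemperedDistribution_zero (φ : 𝓢(Plane, ℂ)) :
    Lp.toTemperedDistribution (0 : L2) φ = 0 :=
  DFunLike.congr_fun (Lp.toTemperedDistributionCLM ℂ (volume : Measure Plane) 2).map_zero φ

theorem duhamel_weighted_estimate {I : Set ℝ} (hI : I.OrdConnected) {t₀ : ℝ} (ht₀ : t₀ ∈ I)
    {u₀ : L2} (hu₀ : IsRadial u₀) {f : ℝ → Plane → ℂ}
    (hf : MemLp (Function.uncurry f) (4 / 3) ((volume.restrict I).prod volume))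
    (hrad : ∀ᵐ t ∂(volume.restrict I), IsRadial (f t)) :
    (∃ u, IsDuhamel I t₀ u₀ f u) ∧ ∀ u, IsDuhamel I t₀ u₀ f u →
      (∀ v, IsDuhamel I t₀ u₀ f v → Set.EqOn v u I) ∧
      AEMeasurable (fun t => eLpNorm (weighted u t) ⊤ volume) (volume.restrict I) ∧
      mixedNorm 4 ⊤ I (weighted u) ≤ 208 *
        (‖u₀‖ₑ + eLpNorm (Function.uncurry f) (4 / 3) ((volume.restrict I).prod volume)) := by
  have hG := memLp_extendForcing hI.measurableSet hf
  obtain ⟨D, hD, hDD⟩ := exists_forcing hG t₀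
  have hDu := isDuhamel_iff hI ht₀ u₀ hf hD
  -- The equivalence `hDu` determines u(t) in L² for each t in I, so it yields existence and
  -- uniqueness together.
  refine ⟨⟨fun t => propagatorL2 t (propagatorL2 (-t₀) u₀ - Complex.I • D t),
    (hDu _).2 fun t _ => rfl⟩, fun u hu => ?_⟩
  have hueq := (hDu u).1 hu
  refine ⟨fun v hv t ht => ((hDu v).1 hv t ht).trans (hueq t ht).symm, ?_⟩
  have hDt₀ : D t₀ = 0 := toTemperedDistribution_injective fun φ => by
    rw [hD, pairing_apply, intervalIntegral.integral_same, toTemperedDistribution_zero]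
  have hinv : ∀ t, IsRotInvariant (propagatorL2 (-t₀) u₀ - Complex.I • D t : L2) := fun t =>
    (hu₀.isRotInvariant.propagatorL2 _).sub ((isRotInvariant_of_pairing hG
      (isRotInvariant_extendForcing hI.measurableSet hrad) (hD t)).const_smul _)
  have hn : ‖propagatorL2 (-t₀) u₀‖ₑ = ‖u₀‖ₑ := by
    rw [← ofReal_norm, norm_propagatorL2, ofReal_norm]
  have := mixedNorm_weighted_le hI.measurableSet hG hDD hDt₀ hinv hueq
  rwa [hn, eLpNorm_extendForcing hI.measurableSet] at this

end WeightedStrichartz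

end

theorem mainTheorem10 :
    ∃ C : ℝ≥0, ∀ (I : Set ℝ), I.OrdConnected → ∀ t₀ ∈ I,
      ∀ u₀ : Lp ℂ 2 (volume : Measure WeightedStrichartz.Plane),
        WeightedStrichartz.IsRadial u₀ →
      ∀ f : ℝ → WeightedStrichartz.Plane → ℂ,
        MemLp (Function.uncurry f) (4 / 3) ((volume.restrict I).prod volume) →
        (∀ᵐ t ∂(volume.restrict I), WeightedStrichartz.IsRadial (f t)) →
      (∃ u, WeightedStrichartz.IsDuhamel I t₀ u₀ f u) ∧
      ∀ u, WeightedStrichartz.IsDuhamel I t₀ u₀ f u →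
        (∀ v, WeightedStrichartz.IsDuhamel I t₀ u₀ f v → Set.EqOn v u I) ∧
        AEMeasurable (fun t => eLpNorm (WeightedStrichartz.weighted u t) ⊤ volume)
          (volume.restrict I) ∧
        WeightedStrichartz.mixedNorm 4 ⊤ I (WeightedStrichartz.weighted u) ≤
          C * (‖u₀‖ₑ +
            eLpNorm (Function.uncurry f) (4 / 3) ((volume.restrict I).prod volume)) :=
  ⟨208, fun _ hI _ ht₀ _ hu₀ _ hf hrad =>
    WeightedStrichartz.duhamel_weighted_estimate hI ht₀ hu₀ hf hrad⟩
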